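/- Let $k$ be a field and let $A$ be a finite-dimensional symmetric $k$-algebra (that is, $A\cong \mathrm{Hom}_k(A,k)$ as $A$-$A$-bimodules) satisfying the condition (#) for every finitely generated non-projective right $A$-module $M$ there are infinitely many integers $n$ with $\mathrm{Ext}_A^n(M,M)\neq 0$. For a finite-dimensional $k$-algebra $B$ let $\mathcal{D}(\mathrm{Mod}\text{-}B)$ be the unbounded derived category of right $B$-modules, a $k$-linear triangulated category. All triangle functors are understood to be $k$-linear. A recollement of $\mathcal{D}(\mathrm{Mod}\text{-}A)$ by $\mathcal{D}(\mathrm{Mod}\text{-}B)$ and $\mathcal{D}(\mathrm{Mod}\text{-}C)$, with $B$, $C$ finite-dimensional $k$-algebras and with functors $i^*, i_*=i_!, i^!, j_!, j^!=j^*, j_*$, is called nontrivial if none of the full embeddings $i_*$, $j_!$, $j_*$ is an equivalence. A finite-dimensional algebra $B$, or its derived category $\mathcal{D}(\mathrm{Mod}\text{-}B)$, is called simple if $B\neq 0$ and $\mathcal{D}(\mathrm{Mod}\text{-}B)$ is not the middle term of a nontrivial recollement of this form. A stratification of $\mathcal{D}(\mathrm{Mod}\text{-}A)$ is a (possibly infinite)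 full rooted binary tree whose nodes are derived categories $\mathcal{D}(\mathrm{Mod}\text{-}B)$ of finite-dimensional $k$-algebras $B$, whose root is $\mathcal{D}(\mathrm{Mod}\text{-}A)$, whose leaves are simple (they are the simple factors of the stratification), and in which every node that is not a leaf is a nontrivial recollement of its two child nodes. A block of $A$ is a nonzero indecomposable algebra direct summand of $A$. Then: 1. If $A\neq 0$, then $\mathcal{D}(\mathrm{Mod}\text{-}A)$ has a stratification. 2. Every stratification of $\mathcal{D}(\mathrm{Mod}\text{-}A)$ is finite. 3. The simple factors of any two stratifications of $\mathcal{D}(\mathrm{Mod}\text{-}A)$ are the same, counted with multiplicity and up to reordering and $k$-linear triangle equivalence: for every stratification there is a bijection between its leaves and the blocks of $A$ such that the simple factor at a leaf is equivalent, as a $k$-linear triangulated category, to the derived category $\mathcal{D}(\mathrm{Mod}\text{-}A_i)$ of the corresponding block $A_i$. -/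

import Mathlib

open CategoryTheory CategoryTheory.Limits CategoryTheory.Pretriangulated

universe u

/-! ### Finite-dimensional algebras, symmetric algebras, blocks -/

/-- A finite-dimensional algebra over the field `k`. -/
structure FDAlg (k : Type u) [Field k] where
  carrier : Type u
  [ring : Ring carrier]
  [algebra : Algebra k carrier]
  [finite : FiniteDimensional k carrier]

attribute [instance] FDAlg.ring FDAlg.algebra FDAlg.finite

/-- Bundling a finite-dimensional algebra. -/
abbrev FDAlg.of (k : Type u) [Field k] (A : Type u) [Ring A] [Algebra k A]
    [FiniteDimensional k A] : FDAlg k where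
  carrier := A

/-- `A` is symmetric: `A` is isomorphic to its `k`-dual `DA` as an `A`-`A`-bimodule, where the
bimodule structure of `DA` is `(a f b)(y) = f (b y a)`. -/
def IsSymmetricAlg (k : Type u) [Field k] (A : Type u) [Ring A] [Algebra k A] : Prop :=
  ∃ φ : A ≃ₗ[k] Module.Dual k A, ∀ a b x y : A, φ (a * x * b) y = φ x (b * y * a)

/-- The condition (#): every finitely generated non-projective right `A`-module `M` has
`Ext^n(M, M) ≠ 0` for infinitely many `n`. -/
def SatisfiesSharp (A : Type u) [Ring A] : Prop :=
  ∀ M : ModuleCat.{u} Aᵐᵒᵖ, Module.Finite Aᵐᵒᵖ M → ¬ Module.Projective Aᵐᵒᵖ M →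
    {n : ℕ | Nontrivial (Abelian.Ext M M n)}.Infinite

/-- A nonzero algebra is indecomposable if it is not isomorphic to a direct product of two
nonzero algebras. -/
def IsIndecomposableAlg (k : Type u) [Field k] (A : Type u) [Ring A] [Algebra k A] : Prop :=
  Nontrivial A ∧ ∀ (B C : Type u) [Ring B] [Ring C] [Algebra k B] [Algebra k C],
    Nontrivial B → Nontrivial C → IsEmpty (A ≃ₐ[k] B × C)

section Corner

variable {k : Type u} [Field k] {A : Type u} [Ring A] [Algebra k A] {e : A}

/-- Scalar multiplication on the corner ring `e A e`. -/
instance cornerSMul (he : IsIdempotentElem e) : SMul k he.Corner where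
  smul c x := ⟨c • x.1, by
    obtain ⟨r, hr⟩ := x.2
    exact ⟨c • r, by simp [← hr]⟩⟩

theorem corner_smul_val (he : IsIdempotentElem e) (c : k) (x : he.Corner) :
    (c • x).1 = c • x.1 := rfl

theorem corner_add_val (he : IsIdempotentElem e) (x y : he.Corner) :
    (x + y).1 = x.1 + y.1 := rfl

theorem corner_mul_val (he : IsIdempotentElem e) (x y : he.Corner) :
    (x * y).1 = x.1 * y.1 := rfl

instance cornerModule (he : IsIdempotentElem e) : Module k he.Corner where
  one_smul x := Subtype.ext (one_smul k x.1)
  mul_smul c d x := Subtype.ext (mul_smul c d x.1)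
  smul_zero c := Subtype.ext (smul_zero c)
  smul_add c x y := Subtype.ext (smul_add c x.1 y.1)
  add_smul c d x := Subtype.ext (add_smul c d x.1)
  zero_smul x := Subtype.ext (zero_smul k x.1)

/-- The `k`-algebra structure on the corner ring `e A e`, whose unit is `e`. -/
instance cornerAlgebra (he : IsIdempotentElem e) : Algebra k he.Corner :=
  Algebra.ofModule
    (fun c x y => Subtype.ext (by
      simp only [corner_smul_val, corner_mul_val, smul_mul_assoc]))
    (fun c x y => Subtype.ext (by
      simp only [corner_smul_val, corner_mul_val, mul_smul_comm]))

instance corner_finite [FiniteDimensional k A] (he : IsIdempotentElem e) :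
    FiniteDimensional k he.Corner :=
  Module.Finite.of_injective
    ({ toFun := fun x => x.1
       map_add' := corner_add_val he
       map_smul' := corner_smul_val he } : he.Corner →ₗ[k] A)
    Subtype.val_injective

end Corner

/-- A block of `A`: an indecomposable algebra direct summand of `A`. The algebra direct summands
of `A` are the algebras `e A = e A e` for the central idempotents `e` of `A`. -/
structure Block (k : Type u) [Field k] (A : Type u) [Ring A] [Algebra k A] where
  e : A
  central : e ∈ Subring.center A
  idem : IsIdempotentElem e
  indecomposable : IsIndecomposableAlg k idem.Corner

/-- The algebra underlying a block. -/
abbrev Block.alg {k : Type u} [Field k] {A : Type u} [Ring A] [Algebra k A]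
    [FiniteDimensional k A] (b : Block k A) : FDAlg k :=
  FDAlg.of k b.idem.Corner

/-! ### Recollements of `k`-linear triangulated categories -/

section Recollement

variable (k : Type*) [Field k]
  (𝒟' : Type*) [Category 𝒟'] [HasZeroObject 𝒟'] [Preadditive 𝒟'] [Linear k 𝒟'] [HasShift 𝒟' ℤ]
  [∀ n : ℤ, (shiftFunctor 𝒟' n).Additive] [Pretriangulated 𝒟']
  (𝒟 : Type*) [Category 𝒟] [HasZeroObject 𝒟] [Preadditive 𝒟] [Linear k 𝒟] [HasShift 𝒟 ℤ]
  [∀ n : ℤ, (shiftFunctor 𝒟 n).Additive] [Pretriangulated 𝒟]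
  (𝒟'' : Type*) [Category 𝒟''] [HasZeroObject 𝒟''] [Preadditive 𝒟''] [Linear k 𝒟'']
  [HasShift 𝒟'' ℤ] [∀ n : ℤ, (shiftFunctor 𝒟'' n).Additive] [Pretriangulated 𝒟'']

/-- A `k`-linear triangle functor from `𝒟'` to `𝒟`. -/
structure TriFunctor where
  functor : 𝒟' ⥤ 𝒟
  [commShift : functor.CommShift ℤ]
  [isTriangulated : functor.IsTriangulated]
  [linear : functor.Linear k]

attribute [instance] TriFunctor.commShift TriFunctor.isTriangulated TriFunctor.linear

/-- `𝒟'` and `𝒟` are equivalent as `k`-linear triangulated categories. -/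
def TriEquivalent : Prop :=
  ∃ F : TriFunctor k 𝒟' 𝒟, F.functor.IsEquivalence

/-- A recollement of `𝒟` relative to `𝒟'` and `𝒟''`:
`iLower` is `i_* = i_!`, `iStar` is `i^*`, `iShriek` is `i^!`, `jStar` is `j^* = j^!`,
`jLower` is `j_*` and `jShriek` is `j_!`. -/
structure Recollement where
  iLower : TriFunctor k 𝒟' 𝒟
  iStar : TriFunctor k 𝒟 𝒟'
  iShriek : TriFunctor k 𝒟 𝒟'
  jStar : TriFunctor k 𝒟 𝒟''
  jLower : TriFunctor k 𝒟'' 𝒟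
  jShriek : TriFunctor k 𝒟'' 𝒟
  adjIStar : iStar.functor ⊣ iLower.functor
  adjIShriek : iLower.functor ⊣ iShriek.functor
  adjJShriek : jShriek.functor ⊣ jStar.functor
  adjJLower : jStar.functor ⊣ jLower.functor
  iLower_full : iLower.functor.Full
  iLower_faithful : iLower.functor.Faithful
  jLower_full : jLower.functor.Full
  jLower_faithful : jLower.functor.Faithful
  jShriek_full : jShriek.functor.Full
  jShriek_faithful : jShriek.functor.Faithful
  iShriek_jLower : ∀ X : 𝒟'', IsZero (iShriek.functor.obj (jLower.functor.obj X))
  /-- the triangle `i_! i^! X → X → j_* j^* X → i_! i^! X[1]` -/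
  triangle₁ : ∀ X : 𝒟, ∃ h : jLower.functor.obj (jStar.functor.obj X) ⟶
      (iLower.functor.obj (iShriek.functor.obj X))⟦(1 : ℤ)⟧,
    Triangle.mk (adjIShriek.counit.app X) (adjJLower.unit.app X) h ∈ distTriang 𝒟
  /-- the triangle `j_! j^! X → X → i_* i^* X → j_! j^! X[1]` -/
  triangle₂ : ∀ X : 𝒟, ∃ h : iLower.functor.obj (iStar.functor.obj X) ⟶
      (jShriek.functor.obj (jStar.functor.obj X))⟦(1 : ℤ)⟧,
    Triangle.mk (adjJShriek.counit.app X) (adjIStar.unit.app X) h ∈ distTriang 𝒟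

variable {k 𝒟' 𝒟 𝒟''} in
/-- A recollement is nontrivial if none of the full embeddings `i_*`, `j_*`, `j_!` is an
equivalence. -/
def Recollement.IsNontrivial (R : Recollement k 𝒟' 𝒟 𝒟'') : Prop :=
  ¬ R.iLower.functor.IsEquivalence ∧ ¬ R.jLower.functor.IsEquivalence ∧
    ¬ R.jShriek.functor.IsEquivalence

end Recollement

/-! ### Unbounded derived categories, derived simple algebras, stratifications -/

/-- The choice of a model for the derived category of a module category: the localization of
the category of complexes at the quasi-isomorphisms. -/
noncomputable instance moduleCatHasDerivedCategory (R : Type u) [Ring R] :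
    HasDerivedCategory.{u + 1} (ModuleCat.{u} R) :=
  HasDerivedCategory.standard _

/-- The unbounded derived category `𝒟(Mod-A)` of right `A`-modules. -/
abbrev DMod {k : Type u} [Field k] (A : FDAlg k) : Type (u + 1) :=
  DerivedCategory (ModuleCat.{u} A.carrierᵐᵒᵖ)

/-- `A` is `𝒟(Mod)`-simple: it is nonzero and `𝒟(Mod-A)` is not the middle term of a nontrivial
recollement of derived categories of finite-dimensional algebras. -/
def IsDerivedSimple {k : Type u} [Field k] (A : FDAlg k) : Prop :=
  Nontrivial A.carrier ∧
    ∀ (B C : FDAlg k) (R : Recollement k (DMod B) (DMod A) (DMod C)), ¬ R.IsNontrivial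

/-- A stratification of `𝒟(Mod-A)`: a possibly infinite full rooted binary tree, whose nodes are
derived categories `𝒟(Mod-B)` of finite-dimensional algebras `B`, whose root is `𝒟(Mod-A)`, whose
leaves are derived simple, and each of whose other nodes is a nontrivial recollement of its two
children. A node is addressed by the list of the turns on the way to it from the root, the
last turn first: the root is `[]`, and the children of `w` are `false :: w` and `true :: w`. -/
structure Stratification {k : Type u} [Field k] (A : FDAlg k) where
  nodes : Set (List Bool)
  /-- the algebra at a node (irrelevant at an address which is not a node) -/
  alg : List Bool → FDAlg k
  root_mem : [] ∈ nodes
  parent_mem : ∀ (b : Bool) (w : List Bool), b :: w ∈ nodes → w ∈ nodes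
  full : ∀ w : List Bool, false :: w ∈ nodes ↔ true :: w ∈ nodes
  alg_root : alg [] = A
  simple_of_leaf : ∀ w ∈ nodes, false :: w ∉ nodes → IsDerivedSimple (alg w)
  recollement_of_not_leaf : ∀ w ∈ nodes, false :: w ∈ nodes →
    ∃ R : Recollement k (DMod (alg (false :: w))) (DMod (alg w)) (DMod (alg (true :: w))),
      R.IsNontrivial

namespace Stratification

variable {k : Type u} [Field k] {A : FDAlg k}

/-- The stratification is finite: the tree has finitely many nodes. -/
def IsFinite (S : Stratification A) : Prop := S.nodes.Finite

/-- The leaves of the tree. -/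
def Leaf (S : Stratification A) : Type :=
  {w : List Bool // w ∈ S.nodes ∧ false :: w ∉ S.nodes}

/-- The simple factor of a stratification at a leaf is the derived category of this algebra. -/
def factor (S : Stratification A) (l : S.Leaf) : FDAlg k := S.alg l.1

end Stratification

/-! Right `A`-modules are left modules over `R = Aᵐᵒᵖ`, which is again symmetric. Everything rests
on one claim: a recollement of `𝒟(R)`, or of the derived category of a direct factor of `R`, splits,
and therefore comes from a decomposition of the unit into two central idempotents.

In a recollement there are no morphisms from the image of `j_!` to the image of `i_*`; for a
splitting there must be none in the other direction either. Symmetry provides Serre duality: for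
perfect `P`, every linear functional on `Hom(P, X)` is composition with some `X ⟶ P` followed by one
fixed functional on `End P` (`IsStrictlyPerfect.exists_duality`). On complexes this fixed functional
is an alternating sum of traces. So if `i_* S` is perfect, where `S` is the regular module on the
left hand side, then morphisms from the shifts of `i_* S` to `j_! Z` vanish because those in the
opposite direction do. Since `S` generates, all morphisms from `i_* Y` to `j_! Z` vanish
(`Gluing.hom_eq_zero`).

Perfection of `i_* S` uses both adjoints of `i_*` and the condition (#). The left adjoint merges a
family of morphisms from `R` to shifts of `i_* S` into a single morphism to the image of a product
of shifts of `S`. Duality for `R` and the right adjoint show that this morphism is a finite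
combination of morphisms through images of shifts of `S` (`exists_finite_factorization`). Hence the
total homology of `i_* S` is finite-dimensional. As `i_*` is fully faithful, `i_* S` has no
self-extensions in nonzero degrees. Taking cones of morphisms from shifts of `R` reduces it to a
module without self-extensions in high degrees, which is projective by (#) (`isPerfect_of_bounded`).

A splitting decomposes the regular module itself. The two projections are multiplications by
complementary central idempotents, and these cut out the two sides (`Gluing.exists_central`). So the
nodes of a stratification are labelled by central idempotents of `A`, each inner label being the
orthogonal sum of the labels of its children. Dimensions drop along branches, which bounds the
depth; derived simple nodes are those with primitive label; and every primitive central idempotent,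
that is, every block, labels exactly one leaf. -/

/-! ### Symmetrizing forms and the trace pairing for finitely generated projective modules -/

section SymmetrizingForm

variable {k : Type u} [Field k] {R : Type u} [Ring R] [Algebra k R]

/-- A symmetrizing form on a `k`-algebra: a nondegenerate trace form. -/
structure IsSymmetrizingForm (t : R →ₗ[k] k) : Prop where
  comm : ∀ a b, t (a * b) = t (b * a)
  nondeg : ∀ c, (∀ a, t (a * c) = 0) → c = 0

/-- Nondegeneracy makes `c ↦ t (- * c)` an injection of `R` into its dual, and both have the same
finite dimension. -/
theorem IsSymmetrizingForm.exists_repr [FiniteDimensional k R] {t : R →ₗ[k] k}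
    (ht : IsSymmetrizingForm t) (l : R →ₗ[k] k) : ∃ c, ∀ a, l a = t (a * c) := by
  let B : R →ₗ[k] Module.Dual k R :=
    { toFun := fun c => t ∘ₗ LinearMap.mulRight k c
      map_add' := fun x y => by ext; simp [mul_add]
      map_smul' := fun x y => by ext; simp }
  have hB : Function.Injective B := by
    rw [injective_iff_map_eq_zero]
    intro c hc
    exact ht.nondeg c fun a => by simpa [B] using LinearMap.congr_fun hc a
  obtain ⟨c, hc⟩ := (LinearMap.injective_iff_surjective_of_finrank_eq_finrank
    (Subspace.dual_finrank_eq (K := k) (V := R)).symm).1 hB l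
  exact ⟨c, fun a => by simpa [B] using (LinearMap.congr_fun hc a).symm⟩

/-- The form is `φ 1`: the two sides of the bimodule structure give `φ x y = φ 1 (y * x)` and `φ x y
= φ 1 (x * y)`. It is transported to the opposite algebra because right modules are treated as left
modules over it. -/
theorem IsSymmetricAlg.exists_form (h : IsSymmetricAlg k R) :
    ∃ t : Rᵐᵒᵖ →ₗ[k] k, IsSymmetrizingForm t := by
  obtain ⟨φ, hφ⟩ := h
  have key : ∀ x y, φ x y = φ 1 (y * x) := fun x y => by
    have := hφ x 1 1 y
    simpa using this
  have key' : ∀ x y, φ x y = φ 1 (x * y) := fun x y => by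
    have := hφ 1 x 1 y
    simpa using this
  refine ⟨(φ 1) ∘ₗ (MulOpposite.opLinearEquiv k).symm.toLinearMap, ?_, ?_⟩
  · intro a b
    change φ 1 (b.unop * a.unop) = φ 1 (a.unop * b.unop)
    rw [← key, ← key']
  · intro c hc
    have : φ c.unop = 0 := by
      ext y
      have := hc (MulOpposite.op y)
      simpa [key'] using this
    simpa using this

/-- The coordinates of a finite dual basis of a module. -/
structure FinDualBasis (R : Type u) [Ring R] (P : Type u) [AddCommGroup P] [Module R P] where
  n : ℕ
  x : Fin n → P
  φ : Fin n → P →ₗ[R] R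
  sum_eq : ∀ p, ∑ j, φ j p • x j = p

theorem FinDualBasis.nonempty (P : Type u) [AddCommGroup P] [Module R P] [Module.Finite R P]
    [Module.Projective R P] : Nonempty (FinDualBasis R P) := by
  obtain ⟨n, f, g, -, -, h⟩ := Module.Finite.exists_comp_eq_id_of_projective R P
  refine ⟨⟨n, fun j => f (Pi.single j 1), fun j => LinearMap.proj j ∘ₗ g, fun p => ?_⟩⟩
  have : f (g p) = p := LinearMap.congr_fun h p
  conv_rhs => rw [← this, LinearMap.pi_apply_eq_sum_univ f (g p)]
  refine Finset.sum_congr rfl fun j _ => ?_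
  simp only [LinearMap.comp_apply, LinearMap.proj_apply]
  congr 2
  ext i
  simp [Pi.single_apply, eq_comm]

namespace FinDualBasis

variable {P Q Z : Type u} [AddCommGroup P] [Module R P] [AddCommGroup Q] [Module R Q]
  [AddCommGroup Z] [Module R Z]

/-- The trace of an endomorphism with respect to a form on the ring. -/
def trace (b : FinDualBasis R P) (t : R →ₗ[k] k) (u : P →ₗ[R] P) : k :=
  ∑ j, t (b.φ j (u (b.x j)))

variable (b : FinDualBasis R P) (c : FinDualBasis R Q) {t : R →ₗ[k] k}

theorem trace_add (u v : P →ₗ[R] P) : b.trace t (u + v) = b.trace t u + b.trace t v := by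
  simp [trace, Finset.sum_add_distrib]

theorem trace_neg (u : P →ₗ[R] P) : b.trace t (-u) = -b.trace t u := by
  simp [trace]

/-- Expanding both traces in the two dual bases gives the same double sum, up to the order of the
factors inside `t`. -/
theorem trace_comm (ht : IsSymmetrizingForm t) (f : P →ₗ[R] Q) (g : Q →ₗ[R] P) :
    b.trace t (g ∘ₗ f) = c.trace t (f ∘ₗ g) := by
  have h1 : ∀ j, b.φ j (g (f (b.x j))) = ∑ l, c.φ l (f (b.x j)) * b.φ j (g (c.x l)) := by
    intro j
    conv_lhs => rw [← c.sum_eq (f (b.x j))]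
    simp
  have h2 : ∀ l, c.φ l (f (g (c.x l))) = ∑ j, b.φ j (g (c.x l)) * c.φ l (f (b.x j)) := by
    intro l
    conv_lhs => rw [← b.sum_eq (g (c.x l))]
    simp
  simp only [trace, LinearMap.comp_apply, h1, h2, map_sum]
  rw [Finset.sum_comm]
  exact Finset.sum_congr rfl fun l _ => Finset.sum_congr rfl fun j _ => ht.comm _ _

/-- Testing against the rank one maps `p ↦ φ j p • a • z` gives `t (a * φ j (w z)) = 0` for all `a`,
and nondegeneracy kills every coordinate of `w z`. -/
theorem eq_zero_of_trace (ht : IsSymmetrizingForm t) (w : Z →ₗ[R] P)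
    (h : ∀ f : P →ₗ[R] Z, b.trace t (w ∘ₗ f) = 0) : w = 0 := by
  have key : ∀ z j, b.φ j (w z) = 0 := fun z j => ht.nondeg _ fun a => by
    have h1 := h ((LinearMap.toSpanSingleton R Z (a • z)) ∘ₗ b.φ j)
    rw [← h1]
    have h2 : b.φ j (w z) = ∑ l, b.φ l (w z) * b.φ j (b.x l) := by
      conv_lhs => rw [← b.sum_eq (w z)]
      simp
    simp only [trace, LinearMap.comp_apply, LinearMap.toSpanSingleton_apply, map_smul,
      smul_eq_mul]
    rw [h2, Finset.mul_sum, map_sum]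
    refine Finset.sum_congr rfl fun l _ => ?_
    rw [← mul_assoc, ht.comm, ← mul_assoc]
  ext z
  rw [← b.sum_eq (w z)]
  simp [key]

/-- On the rank one maps `p ↦ φ j p • a • z` the functional is `k`-linear in `a`, hence equals `t (a
* r j z)`; the map sought is `z ↦ ∑ r j z • x j`. The hypothesis on `l` expresses `k`-linearity
through `algebraMap`, so that `P` and `Z` need no separate `k`-module structure. -/
theorem exists_trace_eq [FiniteDimensional k R] (ht : IsSymmetrizingForm t)
    (l : (P →ₗ[R] Z) →+ k)
    (hl : ∀ (c : k) (f g : P →ₗ[R] Z), (∀ p, g p = algebraMap k R c • f p) → l g = c * l f) :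
    ∃ g : Z →ₗ[R] P, ∀ f, l f = b.trace t (g ∘ₗ f) := by
  have h1 : ∀ (j : Fin b.n) (z : Z), ∃ r : R, ∀ a : R,
      l (LinearMap.toSpanSingleton R Z (a • z) ∘ₗ b.φ j) = t (a * r) := fun j z => by
    let m : R →ₗ[k] k :=
      { toFun := fun a => l (LinearMap.toSpanSingleton R Z (a • z) ∘ₗ b.φ j)
        map_add' := fun a a' => by
          rw [← map_add]; congr 1; ext; simp [add_smul]
        map_smul' := fun c a => by
          rw [RingHom.id_apply, smul_eq_mul]
          refine hl _ _ _ fun p => ?_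
          simp only [LinearMap.comp_apply, LinearMap.toSpanSingleton_apply, ← mul_smul,
            Algebra.smul_def]
          rw [← mul_assoc, ← mul_assoc, Algebra.commutes] }
    exact ht.exists_repr m
  choose r hr using h1
  have ext' : ∀ c d : R, (∀ a, t (a * c) = t (a * d)) → c = d := fun c d h =>
    sub_eq_zero.1 (ht.nondeg _ fun a => by rw [mul_sub, map_sub, h, sub_self])
  let γ : Fin b.n → Z →ₗ[R] R := fun j =>
    { toFun := r j
      map_add' := fun z z' => ext' _ _ fun a => by
        rw [mul_add, map_add, ← hr, ← hr, ← hr, ← map_add]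
        congr 1; ext; simp
      map_smul' := fun s z => ext' _ _ fun a => by
        rw [RingHom.id_apply, smul_eq_mul, ← mul_assoc, ← hr, ← hr, mul_smul] }
  refine ⟨∑ j, LinearMap.toSpanSingleton R P (b.x j) ∘ₗ γ j, fun f => ?_⟩
  have h2 : f = ∑ j, LinearMap.toSpanSingleton R Z (f (b.x j)) ∘ₗ b.φ j := by
    ext p
    conv_lhs => rw [← b.sum_eq p]
    simp
  have h3 : ∀ j, l (LinearMap.toSpanSingleton R Z (f (b.x j)) ∘ₗ b.φ j) = t (r j (f (b.x j))) := by
    intro j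
    simpa using hr j (f (b.x j)) 1
  conv_lhs => rw [h2, map_sum]
  simp only [h3, trace, LinearMap.comp_apply]
  have h4 : ∀ j, b.φ j ((∑ l, LinearMap.toSpanSingleton R P (b.x l) ∘ₗ γ l) (f (b.x j))) =
      ∑ l, r l (f (b.x j)) * b.φ j (b.x l) := by
    intro j
    simp [γ]
  have h5 : ∀ l, r l (f (b.x l)) = ∑ j, b.φ j (b.x l) * r l (f (b.x j)) := by
    intro l
    change γ l (f (b.x l)) = ∑ j, b.φ j (b.x l) * γ l (f (b.x j))
    conv_lhs => rw [← b.sum_eq (b.x l)]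
    simp
  simp only [h4, map_sum]
  conv_lhs => enter [2, l]; rw [h5 l, map_sum]
  rw [Finset.sum_comm]
  exact Finset.sum_congr rfl fun l _ => Finset.sum_congr rfl fun j _ => ht.comm _ _

end FinDualBasis

end SymmetrizingForm

/-! ### Morphisms in the derived category out of K-projective and into K-injective complexes -/

section DerivedHom

universe w v v'

variable {C : Type v} [Category.{v'} C] [Abelian C]

open DerivedCategory

/-- A description of null-homotopic maps of cochain complexes. -/
theorem nonempty_homotopy_zero_iff {K L : CochainComplex C ℤ} (f : K ⟶ L) :
    Nonempty (Homotopy f 0) ↔ ∃ s : ∀ i : ℤ, K.X (i + 1) ⟶ L.X i,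
      ∀ i : ℤ, f.f (i + 1) = K.d (i + 1) (i + 1 + 1) ≫ s (i + 1) + s i ≫ L.d i (i + 1) := by
  constructor
  · rintro ⟨h⟩
    refine ⟨fun i => h.hom (i + 1) i, fun i => ?_⟩
    have := h.comm (i + 1)
    rw [dNext_eq (i := i + 1) (i' := i + 1 + 1) h.hom (by simp),
      prevD_eq (j := i + 1) (j' := i) h.hom (by simp)] at this
    simpa using this
  · rintro ⟨s, hs⟩
    -- The components `s` are transported to every related pair of degrees, as null-homotopic maps
    -- are indexed by such pairs.
    let z : ∀ i j : ℤ, (ComplexShape.up ℤ).Rel j i → (K.X i ⟶ L.X j) := fun i j h =>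
      eqToHom (by rw [show j + 1 = i from h]) ≫ s j
    have hz : ∀ i, z (i + 1) i rfl = s i := fun i => by simp [z]
    refine ⟨(Homotopy.ofEq ?_).trans (Homotopy.nullHomotopy' z)⟩
    ext j
    obtain ⟨i, rfl⟩ : ∃ i, j = i + 1 := ⟨j - 1, by omega⟩
    rw [Homotopy.nullHomotopicMap'_f (k₂ := i) (k₁ := i + 1) (k₀ := i + 1 + 1) rfl rfl, hz, hz, hs]

variable [HasDerivedCategory.{w} C]

theorem Q_map_eq_zero_of_homotopy {K L : CochainComplex C ℤ} {f : K ⟶ L} (h : Homotopy f 0) :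
    Q.map f = 0 := by
  rw [Q_map_eq_of_homotopy _ h, Functor.map_zero]

theorem Q_map_surjective_of_isKProjective (K L : CochainComplex C ℤ) [K.IsKProjective] :
    Function.Surjective (Q.map : (K ⟶ L) → (Q.obj K ⟶ Q.obj L)) := by
  intro f
  obtain ⟨g, hg⟩ := (CochainComplex.IsKProjective.Qh_map_bijective K
    ((HomotopyCategory.quotient _ _).obj L)).2
      ((quotientCompQhIso C).hom.app K ≫ f ≫ (quotientCompQhIso C).inv.app L)
  obtain ⟨g, rfl⟩ := (HomotopyCategory.quotient _ _).map_surjective g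
  refine ⟨g, ?_⟩
  rw [← cancel_epi ((quotientCompQhIso C).hom.app K), ← quotientCompQhIso_hom_naturality, hg]
  simp

theorem Q_map_surjective_of_isKInjective (K L : CochainComplex C ℤ) [L.IsKInjective] :
    Function.Surjective (Q.map : (K ⟶ L) → (Q.obj K ⟶ Q.obj L)) := by
  intro f
  obtain ⟨g, hg⟩ := (CochainComplex.IsKInjective.Qh_map_bijective
    ((HomotopyCategory.quotient _ _).obj K) L).2
      ((quotientCompQhIso C).hom.app K ≫ f ≫ (quotientCompQhIso C).inv.app L)
  obtain ⟨g, rfl⟩ := (HomotopyCategory.quotient _ _).map_surjective g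
  refine ⟨g, ?_⟩
  rw [← cancel_epi ((quotientCompQhIso C).hom.app K), ← quotientCompQhIso_hom_naturality, hg]
  simp

theorem nonempty_homotopy_of_isKProjective {K L : CochainComplex C ℤ} [K.IsKProjective]
    {f : K ⟶ L} (hf : Q.map f = 0) : Nonempty (Homotopy f 0) := by
  refine ⟨HomotopyCategory.homotopyOfEq _ _ ?_⟩
  apply (CochainComplex.IsKProjective.Qh_map_bijective K
    ((HomotopyCategory.quotient _ _).obj L)).1
  rw [← cancel_mono ((quotientCompQhIso C).hom.app L), quotientCompQhIso_hom_naturality, hf]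
  simp

end DerivedHom

/-! ### Serre duality for perfect complexes over a symmetric algebra -/

section Duality

open DerivedCategory

variable {k : Type u} [Field k] {R : Type u} [Ring R] [Algebra k R]

theorem trace_eq_zero_of_isZero {M : ModuleCat.{u} R} (hM : IsZero M) (t : R →ₗ[k] k)
    (c : FinDualBasis R M) (u : M →ₗ[R] M) : c.trace t u = 0 := by
  have : Subsingleton M := ModuleCat.subsingleton_of_isZero hM
  exact Finset.sum_eq_zero fun j _ => by rw [Subsingleton.elim (u (c.x j)) 0, map_zero, map_zero]

section Supertrace

variable {P : CochainComplex (ModuleCat.{u} R) ℤ} (b : ∀ i, FinDualBasis R (P.X i))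
  (t : R →ₗ[k] k) (a : ℤ) (n : ℕ)

/-- The alternating sum of the traces of the components of an endomorphism. -/
def supertrace : (P ⟶ P) →ₗ[k] k where
  toFun u := ∑ j ∈ Finset.range n, (-1) ^ j * (b (a + j)).trace t (u.f (a + j)).hom
  map_add' u v := by
    rw [← Finset.sum_add_distrib]
    refine Finset.sum_congr rfl fun j _ => ?_
    rw [← mul_add, ← (b (a + j)).trace_add]
    rfl
  map_smul' c u := by
    rw [RingHom.id_apply, smul_eq_mul, Finset.mul_sum]
    refine Finset.sum_congr rfl fun j _ => ?_
    rw [mul_left_comm]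
    congr 1
    simp only [FinDualBasis.trace, Finset.mul_sum]
    refine Finset.sum_congr rfl fun l _ => ?_
    have : ((c • u).f (a + j)).hom ((b (a + j)).x l) =
      algebraMap k R c • (u.f (a + j)).hom ((b (a + j)).x l) := rfl
    rw [this, map_smul, smul_eq_mul, ← Algebra.smul_def, map_smul, smul_eq_mul]

/-- By `trace_comm`, the trace of `d s + s d` in degree `i` is `α i + α (i - 1)`. The alternating
sum telescopes, and its two end terms vanish by boundedness. -/
theorem supertrace_eq_zero {t : R →ₗ[k] k} (ht : IsSymmetrizingForm t) [P.IsStrictlyGE a]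
    [P.IsStrictlyLE (a + n)] {u : P ⟶ P} (h : Nonempty (Homotopy u 0)) :
    supertrace b t a (n + 1) u = 0 := by
  obtain ⟨s, hs⟩ := (nonempty_homotopy_zero_iff u).1 h
  let α : ℤ → k := fun i => (b (i + 1)).trace t (s i ≫ P.d i (i + 1)).hom
  have h1 : ∀ i, (b (i + 1)).trace t (u.f (i + 1)).hom = α (i + 1) + α i := fun i => by
    rw [hs]
    refine ((b (i + 1)).trace_add _ _).trans ?_
    congr 1
    exact (b (i + 1)).trace_comm (b (i + 1 + 1)) ht _ _
  have h2 : ∀ i, (b i).trace t (u.f i).hom = α i + α (i - 1) := fun i => by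
    obtain ⟨i, rfl⟩ : ∃ j, i = j + 1 := ⟨i - 1, by omega⟩
    rw [h1, add_sub_cancel_right]
  have h3 : α (a - 1) = 0 := by
    have : s (a - 1) = 0 := (P.isZero_of_isStrictlyGE a (a - 1) (by omega)).eq_of_tgt _ _
    change (b (a - 1 + 1)).trace t (s (a - 1) ≫ P.d (a - 1) (a - 1 + 1)).hom = 0
    rw [this, zero_comp]
    simp [FinDualBasis.trace]
  have h4 : α (a + n) = 0 := trace_eq_zero_of_isZero
    (P.isZero_of_isStrictlyLE (a + n) (a + n + 1) (by omega)) _ _ _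
  have h5 : ∀ m : ℕ, ∑ j ∈ Finset.range m, (-1 : k) ^ j * (α (a + j) + α (a + j - 1)) =
      α (a - 1) - (-1) ^ m * α (a + m - 1) := fun m => by
    induction m with
    | zero => simp
    | succ m ih =>
      rw [Finset.sum_range_succ, ih]
      have : a + ((m + 1 : ℕ) : ℤ) - 1 = a + m := by push_cast; ring
      rw [this]
      ring
  change ∑ j ∈ Finset.range (n + 1), (-1) ^ j * (b (a + j)).trace t (u.f (a + j)).hom = 0
  simp only [h2, h5, h3]
  have : a + ((n + 1 : ℕ) : ℤ) - 1 = a + n := by push_cast; ring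
  rw [this, h4]
  simp

end Supertrace

variable [FiniteDimensional k R]

theorem exists_trace_eq_hom {P Z : ModuleCat.{u} R} (b : FinDualBasis R P) {t : R →ₗ[k] k}
    (ht : IsSymmetrizingForm t) (l : (P ⟶ Z) →ₗ[k] k) :
    ∃ g : Z ⟶ P, ∀ f : P ⟶ Z, l f = b.trace t (f ≫ g).hom := by
  obtain ⟨g, hg⟩ := b.exists_trace_eq ht
    (l.toAddMonoidHom.comp (ModuleCat.homAddEquiv (M := P) (N := Z)).symm.toAddMonoidHom)
    (fun c f g h => by
      change l (ModuleCat.ofHom g) = c * l (ModuleCat.ofHom f)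
      rw [← smul_eq_mul, ← map_smul]
      congr 1
      ext p
      exact h p)
  exact ⟨ModuleCat.ofHom g, fun f => hg f.hom⟩

/-- Over a symmetric algebra finitely generated projective modules are injective. -/
theorem injective_of_symmetrizingForm {P : ModuleCat.{u} R} (b : FinDualBasis R P) {t : R →ₗ[k] k}
    (ht : IsSymmetrizingForm t) : Injective P where
  factors {N N'} f i hi := by
    let T : (P ⟶ P) →ₗ[k] k :=
      { toFun := fun u => b.trace t u.hom
        map_add' := fun u v => b.trace_add _ _
        map_smul' := fun c u => by
          simp only [FinDualBasis.trace, RingHom.id_apply, smul_eq_mul, Finset.mul_sum]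
          refine Finset.sum_congr rfl fun j _ => ?_
          have : (c • u).hom (b.x j) = algebraMap k R c • u.hom (b.x j) := rfl
          rw [this, map_smul, smul_eq_mul, ← Algebra.smul_def, map_smul, smul_eq_mul] }
    -- Maps out of `P` turn the extension problem into linear algebra: the functional `u ↦ tr (u ≫
    -- f)` on `P ⟶ N` extends along the injection into `P ⟶ N'`, and the extended functional is
    -- represented by a map `N' ⟶ P`.
    let ι : (P ⟶ N) →ₗ[k] (P ⟶ N') := Linear.rightComp k P i
    have hι : Function.Injective ι := fun x y h => (cancel_mono i).1 h
    obtain ⟨ρ, hρ⟩ := ι.exists_leftInverse_of_injective (LinearMap.ker_eq_bot.2 hι)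
    obtain ⟨g, hg⟩ := exists_trace_eq_hom b ht (T ∘ₗ Linear.rightComp k P f ∘ₗ ρ)
    refine ⟨g, ?_⟩
    rw [← sub_eq_zero]
    ext1
    refine b.eq_zero_of_trace ht _ fun u => ?_
    have h1 := hg (ModuleCat.ofHom u ≫ i)
    have h2 : ρ (ModuleCat.ofHom u ≫ i) = ModuleCat.ofHom u := LinearMap.congr_fun hρ _
    simp only [LinearMap.comp_apply, h2] at h1
    have h3 : b.trace t ((ModuleCat.ofHom u ≫ i ≫ g).hom - (ModuleCat.ofHom u ≫ f).hom) = 0 := by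
      rw [sub_eq_add_neg, b.trace_add, b.trace_neg, ← Category.assoc, ← h1]
      exact add_neg_cancel _
    exact h3

/-- A bounded complex of finitely generated projective modules. -/
structure IsStrictlyPerfect (P : CochainComplex (ModuleCat.{u} R) ℤ) : Prop where
  finite : ∀ i, Module.Finite R (P.X i)
  projective : ∀ i, Module.Projective R (P.X i)
  bounded : ∃ (a : ℤ) (n : ℕ), P.IsStrictlyGE a ∧ P.IsStrictlyLE (a + n)

theorem IsStrictlyPerfect.isKProjective {P : CochainComplex (ModuleCat.{u} R) ℤ}
    (hP : IsStrictlyPerfect P) : P.IsKProjective := by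
  obtain ⟨a, n, h1, h2⟩ := hP.bounded
  have : ∀ i, Projective (P.X i) := fun i => by
    have := hP.projective i
    exact (IsProjective.iff_projective (P.X i)).1 this
  exact CochainComplex.isKProjective_of_projective P (a + n)

theorem IsStrictlyPerfect.isKInjective {P : CochainComplex (ModuleCat.{u} R) ℤ}
    (hP : IsStrictlyPerfect P) {t : R →ₗ[k] k} (ht : IsSymmetrizingForm t) : P.IsKInjective := by
  obtain ⟨a, n, h1, h2⟩ := hP.bounded
  have : ∀ i, Injective (P.X i) := fun i => by
    have := hP.projective i
    have := hP.finite i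
    exact injective_of_symmetrizingForm (FinDualBasis.nonempty (P.X i)).some ht
  exact CochainComplex.isKInjective_of_injective P a

section Supertrace

variable {P : CochainComplex (ModuleCat.{u} R) ℤ} (b : ∀ i, FinDualBasis R (P.X i))
  (a : ℤ) (n : ℕ)

/-- Trace duality in each degree yields a representing family of components; vanishing on
null-homotopic maps is exactly what makes this family, up to signs, a chain map. -/
theorem exists_supertrace_eq {t : R →ₗ[k] k} (ht : IsSymmetrizingForm t) [P.IsStrictlyGE a]
    [P.IsStrictlyLE (a + n)] (K : CochainComplex (ModuleCat.{u} R) ℤ) (l : (P ⟶ K) →ₗ[k] k)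
    (hl : ∀ f : P ⟶ K, Nonempty (Homotopy f 0) → l f = 0) :
    ∃ g : K ⟶ P, ∀ f, l f = supertrace b t a (n + 1) (f ≫ g) := by
  let ι : (P ⟶ K) →ₗ[k] (∀ i, P.X i ⟶ K.X i) :=
    { toFun := fun f i => f.f i
      map_add' := fun f g => rfl
      map_smul' := fun c f => rfl }
  have hι : Function.Injective ι := fun f g h => by
    ext1 i
    exact congrFun h i
  -- The functional is extended from chain maps to arbitrary families of components, where it can be
  -- represented degree by degree.
  obtain ⟨ρ, hρ⟩ := ι.exists_leftInverse_of_injective (LinearMap.ker_eq_bot.2 hι)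
  let l' : (∀ i, P.X i ⟶ K.X i) →ₗ[k] k := l ∘ₗ ρ
  have hl' : ∀ f : P ⟶ K, l' (fun i => f.f i) = l f := fun f =>
    congrArg l (LinearMap.congr_fun hρ f)
  have hg : ∀ i, ∃ g : K.X i ⟶ P.X i, ∀ f : P.X i ⟶ K.X i,
      l' (Pi.single i f) = (b i).trace t (f ≫ g).hom := fun i =>
    exists_trace_eq_hom (b i) ht (l' ∘ₗ LinearMap.single k (fun i => P.X i ⟶ K.X i) i)
  choose g hg using hg
  have hout : ∀ i, (∀ j ∈ Finset.range (n + 1), i ≠ a + j) → IsZero (P.X i) := fun i hi => by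
    by_cases h1 : i < a
    · exact P.isZero_of_isStrictlyGE a i h1
    · refine P.isZero_of_isStrictlyLE (a + n) i ?_
      by_contra h2
      exact hi (i - a).toNat (by simp; omega) (by omega)
  have hsum : ∀ f : ∀ i, P.X i ⟶ K.X i,
      l' f = ∑ j ∈ Finset.range (n + 1), (b (a + j)).trace t (f (a + j) ≫ g (a + j)).hom := by
    intro f
    have : f = ∑ j ∈ Finset.range (n + 1), Pi.single (a + (j : ℤ)) (f (a + j)) := by
      ext1 i
      rw [Finset.sum_apply]
      by_cases hi : ∃ j ∈ Finset.range (n + 1), i = a + (j : ℤ)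
      · obtain ⟨j, hj, rfl⟩ := hi
        rw [Finset.sum_eq_single j]
        · simp
        · intro j' _ hj'
          rw [Pi.single_eq_of_ne]
          omega
        · exact fun h => absurd hj h
      · push Not at hi
        exact (hout i hi).eq_of_src _ _
    conv_lhs => rw [this, map_sum]
    exact Finset.sum_congr rfl fun j _ => hg _ _
  have hsingle : ∀ (i : ℤ) (f : P.X i ⟶ K.X i), l' (Pi.single i f) = (b i).trace t (f ≫ g i).hom :=
    hg
  -- The test maps are the null-homotopic ones whose homotopy has a single component `h`, from
  -- degree `i + 1` to degree `i`. They have only two components, and `trace_comm` moves both traces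
  -- to degree `i + 1`.
  have hcomm : ∀ i, g i ≫ P.d i (i + 1) = - (K.d i (i + 1) ≫ g (i + 1)) := fun i => by
    rw [← sub_eq_zero, sub_neg_eq_add]
    ext1
    refine (b (i + 1)).eq_zero_of_trace ht _ fun h => ?_
    let s : ∀ p : ℤ, P.X (p + 1) ⟶ K.X p := Pi.single i (ModuleCat.ofHom h)
    let z : ∀ p q : ℤ, (ComplexShape.up ℤ).Rel q p → (P.X p ⟶ K.X q) := fun p q hpq =>
      eqToHom (by rw [show q + 1 = p from hpq]) ≫ s q
    have hz : ∀ p, z (p + 1) p rfl = s p := fun p => by simp [z]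
    have hf0 := hl (Homotopy.nullHomotopicMap' z) ⟨Homotopy.nullHomotopy' z⟩
    have hf : (fun p => (Homotopy.nullHomotopicMap' z).f p) =
        Pi.single (M := fun p => P.X p ⟶ K.X p) i (P.d i (i + 1) ≫ ModuleCat.ofHom h) +
          Pi.single (M := fun p => P.X p ⟶ K.X p) (i + 1) (ModuleCat.ofHom h ≫ K.d i (i + 1)) := by
      ext1 p
      obtain ⟨p, rfl⟩ : ∃ q, p = q + 1 := ⟨p - 1, by omega⟩
      rw [Homotopy.nullHomotopicMap'_f (k₂ := p) (k₁ := p + 1) (k₀ := p + 1 + 1) rfl rfl, hz, hz,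
        Pi.add_apply]
      congr 1
      · by_cases hp : p + 1 = i
        · subst hp
          simp [s]
        · rw [Pi.single_eq_of_ne hp]
          simp [s, Pi.single_eq_of_ne hp]
      · by_cases hp : p = i
        · subst hp
          simp [s]
        · rw [Pi.single_eq_of_ne (by omega)]
          simp [s, Pi.single_eq_of_ne hp]
    rw [← hl', hf, map_add, hsingle, hsingle] at hf0
    rw [← hf0]
    refine ((b (i + 1)).trace_add (t := t) ((P.d i (i + 1)).hom ∘ₗ (g i).hom ∘ₗ h)
      ((g (i + 1)).hom ∘ₗ (K.d i (i + 1)).hom ∘ₗ h)).trans ?_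
    congr 1
    exact (b (i + 1)).trace_comm (b i) ht ((g i).hom ∘ₗ h) (P.d i (i + 1)).hom
  -- The components anticommute with the differentials; the signs of the supertrace, counted from
  -- degree `a`, correct this.
  let g' : K ⟶ P :=
    { f := fun i => (i - a).negOnePow • g i
      comm' := fun i j hij => by
        obtain rfl : i + 1 = j := hij
        rw [Linear.units_smul_comp, hcomm, Linear.comp_units_smul, add_sub_right_comm,
          Int.negOnePow_succ]
        simp }
  refine ⟨g', fun f => ?_⟩
  rw [← hl', hsum]
  refine Finset.sum_congr rfl fun j _ => ?_
  have h1 : (f ≫ g').f (a + j) = (j : ℤ).negOnePow • (f.f (a + j) ≫ g (a + j)) := by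
    change f.f (a + j) ≫ ((a + j - a).negOnePow • g (a + j)) = _
    rw [Linear.comp_units_smul, add_sub_cancel_left]
  rw [h1]
  rcases Nat.even_or_odd j with hj | hj
  · rw [Int.negOnePow_even _ (by exact_mod_cast hj), hj.neg_one_pow, one_smul, one_mul]
  · rw [Int.negOnePow_odd _ (by exact_mod_cast hj), hj.neg_one_pow, Units.neg_smul, one_smul,
      neg_one_mul]
    exact (neg_eq_iff_eq_neg.2 ((b (a + j)).trace_neg _)).symm

end Supertrace

/-- Serre duality for a strictly perfect complex over a symmetric algebra. -/
theorem IsStrictlyPerfect.exists_duality {P : CochainComplex (ModuleCat.{u} R) ℤ}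
    (hP : IsStrictlyPerfect P) {t : R →ₗ[k] k} (ht : IsSymmetrizingForm t) :
    ∃ σ : (Q.obj P ⟶ Q.obj P) →ₗ[k] k, ∀ (X : DerivedCategory (ModuleCat.{u} R))
      (l : (Q.obj P ⟶ X) →ₗ[k] k), ∃ g : X ⟶ Q.obj P, ∀ f, l f = σ (f ≫ g) := by
  obtain ⟨a, n, h1, h2⟩ := hP.bounded
  have := hP.isKProjective
  have b : ∀ i, FinDualBasis R (P.X i) := fun i => by
    have := hP.projective i
    have := hP.finite i
    exact (FinDualBasis.nonempty (P.X i)).some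
  -- A linear choice of chain maps representing the endomorphisms. The supertrace does not depend on
  -- the representative, since it vanishes on null-homotopic maps.
  obtain ⟨s, hs⟩ := (Functor.mapLinearMap k Q (X := P) (Y := P)).exists_rightInverse_of_surjective
    (LinearMap.range_eq_top.2 (Q_map_surjective_of_isKProjective P P))
  have hσ : ∀ u : P ⟶ P, supertrace b t a (n + 1) (s (Q.map u)) = supertrace b t a (n + 1) u := by
    intro u
    rw [← sub_eq_zero, ← map_sub]
    refine supertrace_eq_zero b a n ht (nonempty_homotopy_of_isKProjective ?_)
    rw [Functor.map_sub, sub_eq_zero]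
    exact LinearMap.congr_fun hs (Q.map u)
  refine ⟨supertrace b t a (n + 1) ∘ₗ s, fun X l => ?_⟩
  let e := Q.objObjPreimageIso X
  obtain ⟨g, hg⟩ := exists_supertrace_eq b a n ht (Q.objPreimage X)
    (l ∘ₗ Linear.rightComp k _ e.hom ∘ₗ Functor.mapLinearMap k Q) (fun f hf => by
      have : Q.map f = 0 := Q_map_eq_zero_of_homotopy hf.some
      simp [this])
  refine ⟨e.inv ≫ Q.map g, fun f => ?_⟩
  obtain ⟨f', hf'⟩ := Q_map_surjective_of_isKProjective P (Q.objPreimage X) (f ≫ e.inv)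
  have h := hg f'
  rw [← hσ, Q.map_comp] at h
  have h3 : f = Q.map f' ≫ e.hom := by rw [hf']; simp
  rw [LinearMap.comp_apply, ← Category.assoc, ← hf', ← h, h3]
  simp

end Duality

/-! ### Direct factors of an algebra -/

noncomputable section

/-- The data which exhibit an algebra `S` as the direct factor `e R` of `R`, for a central
idempotent `e` of `R`. -/
structure DirectFactor (k : Type u) [Field k] (R S : Type u) [Ring R] [Ring S] [Algebra k R]
    [Algebra k S] where
  π : R →ₐ[k] S
  ι : S →ₗ[k] R
  π_ι : ∀ s, π (ι s) = s
  e : R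
  ι_π : ∀ r, ι (π r) = e * r
  comm : ∀ r, e * r = r * e

namespace DirectFactor

variable {k : Type u} [Field k] {R S : Type u} [Ring R] [Ring S] [Algebra k R]
    [Algebra k S] (d : DirectFactor k R S)

theorem ι_one : d.ι 1 = d.e := by
  rw [← map_one d.π, d.ι_π, mul_one]

theorem π_e : d.π d.e = 1 := by
  rw [← d.ι_one, d.π_ι]

theorem isIdempotentElem : d.e * d.e = d.e := by
  rw [← d.ι_π, d.π_e, d.ι_one]

theorem e_mul_ι (s : S) : d.e * d.ι s = d.ι s := by
  rw [← d.ι_π, d.π_ι]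

theorem ι_mul (s t : S) : d.ι (s * t) = d.ι s * d.ι t := by
  rw [← d.π_ι s, ← d.π_ι t, ← map_mul, d.ι_π, d.π_ι, d.π_ι, ← mul_assoc, d.e_mul_ι]

/-- The direct factor of the opposite algebra. -/
def op : DirectFactor k Rᵐᵒᵖ Sᵐᵒᵖ where
  π := AlgHom.op d.π
  ι := (MulOpposite.opLinearEquiv k).toLinearMap ∘ₗ d.ι ∘ₗ
    (MulOpposite.opLinearEquiv k).symm.toLinearMap
  π_ι s := by
    refine MulOpposite.unop_injective ?_
    exact d.π_ι _
  e := MulOpposite.op d.e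
  ι_π r := by
    refine MulOpposite.unop_injective ?_
    exact (d.ι_π _).trans (d.comm _)
  comm r := by
    refine MulOpposite.unop_injective ?_
    exact (d.comm _).symm

/-- Restriction of modules to `R`. -/
abbrev res : ModuleCat.{u} S ⥤ ModuleCat.{u} R := ModuleCat.restrictScalars d.π.toRingHom

theorem res_smul (N : ModuleCat.{u} S) (r : R) (n : d.res.obj N) :
    r • n = (d.π r • (show N from n) : N) := rfl

section

variable (M : Type u) [AddCommGroup M] [Module R M]

/-- The direct summand `e M` of an `R`-module `M`. -/
def part : AddSubgroup M where
  carrier := {m | d.e • m = m}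
  add_mem' {a b} ha hb := by
    change d.e • (a + b) = a + b
    rw [smul_add, show d.e • a = a from ha, show d.e • b = b from hb]
  zero_mem' := smul_zero _
  neg_mem' {a} ha := by
    change d.e • (-a) = -a
    rw [smul_neg, show d.e • a = a from ha]

variable {M}

theorem smul_mem_part (r : R) {m : M} (hm : m ∈ d.part M) : r • m ∈ d.part M := by
  change d.e • r • m = r • m
  rw [← mul_smul, d.comm, mul_smul, show d.e • m = m from hm]

theorem e_smul_mem_part (m : M) : d.e • m ∈ d.part M := by
  change d.e • d.e • m = d.e • m
  rw [← mul_smul, d.isIdempotentElem]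

instance : SMul S (d.part M) := ⟨fun s m => ⟨d.ι s • m.1, d.smul_mem_part _ m.2⟩⟩

theorem part_smul_val (s : S) (m : d.part M) : (s • m).1 = d.ι s • m.1 := rfl

instance : Module S (d.part M) where
  one_smul m := Subtype.ext (by rw [part_smul_val, d.ι_one]; exact m.2)
  mul_smul s t m := Subtype.ext (by simp only [part_smul_val, d.ι_mul, mul_smul])
  smul_zero s := Subtype.ext (smul_zero _)
  smul_add s m m' := Subtype.ext (smul_add _ m.1 m'.1)
  add_smul s t m := Subtype.ext (by
    change d.ι (s + t) • m.1 = d.ι s • m.1 + d.ι t • m.1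
    rw [map_add, add_smul])
  zero_smul m := Subtype.ext (by
    change d.ι 0 • m.1 = 0
    rw [map_zero, zero_smul])

end

/-- The functor `M ↦ e M`. -/
def cut : ModuleCat.{u} R ⥤ ModuleCat.{u} S where
  obj M := ModuleCat.of S (d.part M)
  map {M N} f := ModuleCat.ofHom
    { toFun := fun m => ⟨f.hom m.1, by
        change d.e • f.hom m.1 = f.hom m.1
        rw [← map_smul, show d.e • m.1 = m.1 from m.2]⟩
      map_add' := fun m m' => Subtype.ext (map_add f.hom m.1 m'.1)
      map_smul' := fun s m => Subtype.ext (map_smul f.hom (d.ι s) m.1) }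

/-- The inclusion `e M ⟶ M`. -/
def incl (M : ModuleCat.{u} R) : d.res.obj (d.cut.obj M) ⟶ M :=
  ModuleCat.ofHom (X := d.res.obj (d.cut.obj M)) (Y := M)
    { toFun := fun m : d.part M => m.1
      map_add' := fun _ _ => rfl
      map_smul' := fun r m => by
        change d.ι (d.π r) • (show d.part M from m).1 = r • (show d.part M from m).1
        rw [d.ι_π, d.comm, mul_smul, show d.e • (show d.part M from m).1 = _ from m.2] }

/-- The projection `M ⟶ e M`. -/
def proj (M : ModuleCat.{u} R) : M ⟶ d.res.obj (d.cut.obj M) :=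
  ModuleCat.ofHom (X := M) (Y := d.res.obj (d.cut.obj M))
    { toFun := fun m : M => (⟨d.e • m, d.e_smul_mem_part m⟩ : d.part M)
      map_add' := fun _ _ => Subtype.ext (smul_add _ _ _)
      map_smul' := fun r m => Subtype.ext (by
        change d.e • r • m = d.ι (d.π r) • d.e • m
        rw [d.ι_π, d.comm, mul_smul, ← mul_smul d.e d.e, d.isIdempotentElem, ← mul_smul,
          ← mul_smul, d.comm]) }

/-- The isomorphism `e N = N` for an `S`-module `N`. -/
def cutRes (N : ModuleCat.{u} S) : d.cut.obj (d.res.obj N) ≅ N where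
  hom := ModuleCat.ofHom (X := d.cut.obj (d.res.obj N)) (Y := N)
    { toFun := fun m : d.part (d.res.obj N) => (m.1 : N)
      map_add' := fun _ _ => rfl
      map_smul' := fun s m => by
        change d.π (d.ι s) • (show N from m.1) = s • (show N from m.1)
        rw [d.π_ι] }
  inv := ModuleCat.ofHom (X := N) (Y := d.cut.obj (d.res.obj N))
    { toFun := fun n : N => (⟨n, by
        change d.π d.e • n = n
        rw [d.π_e, one_smul]⟩ : d.part (d.res.obj N))
      map_add' := fun _ _ => rfl
      map_smul' := fun s m => Subtype.ext (by
        change s • m = d.π (d.ι s) • m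
        rw [d.π_ι]) }
  hom_inv_id := rfl
  inv_hom_id := rfl

/-- `M ↦ e M` is right adjoint to restriction. -/
def resAdjCut : d.res ⊣ d.cut := Adjunction.mkOfUnitCounit
  { unit := { app := fun N => (d.cutRes N).inv, naturality := fun _ _ _ => rfl }
    counit := { app := fun M => d.incl M, naturality := fun _ _ _ => rfl }
    left_triangle := rfl
    right_triangle := rfl }

/-- `M ↦ e M` is left adjoint to restriction. -/
def cutAdjRes : d.cut ⊣ d.res := Adjunction.mkOfUnitCounit
  { unit := { app := fun M => d.proj M, naturality := fun M N f => by
                ext m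
                exact Subtype.ext (map_smul f.hom d.e m).symm }
    counit := { app := fun N => (d.cutRes N).hom, naturality := fun _ _ _ => rfl }
    left_triangle := by
      ext M m
      exact Subtype.ext m.2
    right_triangle := by
      ext N n
      change d.π d.e • (show N from n) = n
      rw [d.π_e, one_smul] }

instance : d.res.Additive := inferInstance
instance : d.cut.Additive where
  map_add := rfl

instance : d.res.Linear k where
  map_smul {X Y} f c := by
    ext x
    change algebraMap k S c • (show Y from f.hom x) = d.π (algebraMap k R c) • (show Y from f.hom x)
    rw [AlgHom.commutes]

instance : d.cut.Linear k where
  map_smul f c := by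
    ext x
    refine Subtype.ext ?_
    change algebraMap k R c • f.hom x.1 = d.ι (algebraMap k S c) • f.hom x.1
    -- A scalar of `S` becomes a multiple of `e`, which acts as the identity on `e M`.
    have h : d.ι (algebraMap k S c) = algebraMap k R c * d.e := by
      rw [Algebra.algebraMap_eq_smul_one, map_smul, d.ι_one, Algebra.smul_def]
    rw [h, mul_smul, ← map_smul f.hom d.e]
    congr 2
    exact x.2.symm

instance : PreservesFiniteLimits d.res := by
  have := d.cutAdjRes.rightAdjoint_preservesLimits
  infer_instance
instance : PreservesFiniteColimits d.res := by
  have := d.resAdjCut.leftAdjoint_preservesColimits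
  infer_instance
instance : PreservesFiniteLimits d.cut := by
  have := d.resAdjCut.rightAdjoint_preservesLimits
  infer_instance
instance : PreservesFiniteColimits d.cut := by
  have := d.cutAdjRes.leftAdjoint_preservesColimits
  infer_instance

end DirectFactor

end

/-! ### Derived functors of adjoint exact functors -/

noncomputable section

section

universe w₁ w₂ v₁ v₂ u₁ u₂

open DerivedCategory

variable {C : Type u₁} [Category.{v₁} C] [Abelian C] [HasDerivedCategory.{w₁} C]
  {D : Type u₂} [Category.{v₂} D] [Abelian D] [HasDerivedCategory.{w₂} D]
  {F : C ⥤ D} {G : D ⥤ C} [F.Additive] [G.Additive]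

/-- The adjunction between categories of complexes induced by an adjunction. -/
def CategoryTheory.Adjunction.mapCochainComplex (adj : F ⊣ G) :
    F.mapHomologicalComplex (ComplexShape.up ℤ) ⊣ G.mapHomologicalComplex (ComplexShape.up ℤ) where
  unit :=
    { app := fun K => { f := fun i => adj.unit.app (K.X i)
                        comm' := fun i j _ => (adj.unit.naturality (K.d i j)).symm }
      naturality := fun K L f => by ext i; exact adj.unit.naturality (f.f i) }
  counit :=
    { app := fun K => { f := fun i => adj.counit.app (K.X i)
                        comm' := fun i j _ => (adj.counit.naturality (K.d i j)).symm }
      naturality := fun K L f => by ext i; exact adj.counit.naturality (f.f i) }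
  left_triangle_components K := by ext i; exact adj.left_triangle_components (K.X i)
  right_triangle_components K := by ext i; exact adj.right_triangle_components (K.X i)

variable [PreservesFiniteLimits F] [PreservesFiniteColimits F] [PreservesFiniteLimits G]
  [PreservesFiniteColimits G]

instance : CatCommSq (F.mapHomologicalComplex (ComplexShape.up ℤ)) Q Q F.mapDerivedCategory where
  iso := F.mapDerivedCategoryFactors.symm

/-- The adjunction between derived categories induced by an adjunction of exact functors. -/
def CategoryTheory.Adjunction.mapDerivedCategory (adj : F ⊣ G) :
    F.mapDerivedCategory ⊣ G.mapDerivedCategory :=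
  adj.mapCochainComplex.localization Q (HomologicalComplex.quasiIso C (ComplexShape.up ℤ))
    Q (HomologicalComplex.quasiIso D (ComplexShape.up ℤ)) _ _

theorem CategoryTheory.Adjunction.mapDerivedCategory_unit_app_Q (adj : F ⊣ G)
    (K : CochainComplex C ℤ) :
    adj.mapDerivedCategory.unit.app (Q.obj K) =
      Q.map (adj.mapCochainComplex.unit.app K) ≫
        G.mapDerivedCategoryFactors.inv.app _ ≫
          G.mapDerivedCategory.map (F.mapDerivedCategoryFactors.inv.app K) :=
  Adjunction.localization_unit_app ..

theorem CategoryTheory.Adjunction.mapDerivedCategory_counit_app_Q (adj : F ⊣ G)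
    (K : CochainComplex D ℤ) :
    adj.mapDerivedCategory.counit.app (Q.obj K) =
      F.mapDerivedCategory.map (G.mapDerivedCategoryFactors.hom.app K) ≫
        F.mapDerivedCategoryFactors.hom.app _ ≫
          Q.map (adj.mapCochainComplex.counit.app K) :=
  Adjunction.localization_counit_app ..

/-- On complexes the unit is the given one in each degree, and on objects `Q.obj K` the derived unit
differs from its image only by isomorphisms. -/
theorem CategoryTheory.Adjunction.isIso_mapDerivedCategory_unit (adj : F ⊣ G)
    [IsIso adj.unit] : IsIso adj.mapDerivedCategory.unit := by
  have h : ∀ K, IsIso (adj.mapCochainComplex.unit.app K) := fun K => by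
    have : ∀ i, IsIso ((adj.mapCochainComplex.unit.app K).f i) := fun i =>
      inferInstanceAs (IsIso (adj.unit.app (K.X i)))
    exact HomologicalComplex.Hom.isIso_of_components _
  have : ∀ X, IsIso (adj.mapDerivedCategory.unit.app X) := fun X => by
    have e := Q.objObjPreimageIso X
    rw [← NatTrans.isIso_app_iff_of_iso _ e, adj.mapDerivedCategory_unit_app_Q]
    infer_instance
  exact NatIso.isIso_of_isIso_app _

end

end

/-! ### The regular module generates the derived category -/

noncomputable section

section Generator

open DerivedCategory

variable (R : Type u) [Ring R]

/-- The regular module, placed in degree `n`, as a complex. -/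
abbrev genComplex (n : ℤ) : CochainComplex (ModuleCat.{u} R) ℤ :=
  (HomologicalComplex.single (ModuleCat.{u} R) (ComplexShape.up ℤ) n).obj (ModuleCat.of R R)

/-- The regular module, placed in degree `n`. -/
abbrev gen (n : ℤ) : DerivedCategory (ModuleCat.{u} R) :=
  Q.obj (genComplex R n)

instance isKProjective_single_regular (n : ℤ) : 
    CochainComplex.IsKProjective (genComplex R n) := by
  have h : Projective (ModuleCat.of R R) := (IsProjective.iff_projective R).1 inferInstance
  have : ∀ i, Projective (((HomologicalComplex.single (ModuleCat.{u} R)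
      (ComplexShape.up ℤ) n).obj (ModuleCat.of R R)).X i) := fun i => by
    by_cases hi : i = n
    · subst hi
      exact Projective.of_iso (HomologicalComplex.singleObjXSelf _ _ _).symm h
    · exact (HomologicalComplex.isZero_single_obj_X _ _ _ _ hi).projective
  exact CochainComplex.isKProjective_of_projective _ n

variable {R}

/-- The chain map from the regular module, placed in degree `n`, defined by a cycle. -/
def cycleHom (K : CochainComplex (ModuleCat.{u} R) ℤ) (n : ℤ) (x : K.X n)
    (hx : (K.d n (n + 1)).hom x = 0) :
    genComplex R n ⟶ K :=
  HomologicalComplex.mkHomFromSingle (ModuleCat.ofHom (LinearMap.toSpanSingleton R _ x))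
    (fun m hm => by
      obtain rfl : n + 1 = m := hm
      ext
      simpa using hx)

theorem cycleHom_f_apply (K : CochainComplex (ModuleCat.{u} R) ℤ) (n : ℤ) (x : K.X n)
    (hx : (K.d n (n + 1)).hom x = 0) (r : R) :
    ((cycleHom K n x hx).f n).hom ((HomologicalComplex.singleObjXSelf (ComplexShape.up ℤ) n
      (ModuleCat.of R R)).inv.hom r) = r • x := by
  rw [cycleHom, HomologicalComplex.mkHomFromSingle_f]
  change ((HomologicalComplex.singleObjXSelf (ComplexShape.up ℤ) n (ModuleCat.of R R)).inv ≫
    (HomologicalComplex.singleObjXSelf (ComplexShape.up ℤ) n (ModuleCat.of R R)).hom ≫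
      ModuleCat.ofHom (LinearMap.toSpanSingleton R _ x)).hom r = r • x
  rw [Iso.inv_hom_id_assoc]
  rfl

theorem single_hom_ext {K : CochainComplex (ModuleCat.{u} R) ℤ} {n : ℤ}
    {f g : genComplex R n ⟶ K}
    (h : (f.f n).hom ((HomologicalComplex.singleObjXSelf (ComplexShape.up ℤ) n
      (ModuleCat.of R R)).inv.hom 1) = (g.f n).hom ((HomologicalComplex.singleObjXSelf
        (ComplexShape.up ℤ) n (ModuleCat.of R R)).inv.hom 1)) : f = g := by
  refine HomologicalComplex.from_single_hom_ext ?_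
  rw [← cancel_epi (HomologicalComplex.singleObjXSelf (ComplexShape.up ℤ) n
    (ModuleCat.of R R)).inv]
  ext1
  exact LinearMap.ext_ring h

theorem exists_cycleHom {K : CochainComplex (ModuleCat.{u} R) ℤ} {n : ℤ}
    (f : genComplex R n ⟶ K) : ∃ x hx, f = cycleHom K n x hx := by
  refine ⟨(f.f n).hom ((HomologicalComplex.singleObjXSelf (ComplexShape.up ℤ) n
      (ModuleCat.of R R)).inv.hom 1), ?_, ?_⟩
  · change (f.f n ≫ K.d n (n + 1)).hom _ = 0
    rw [f.comm, HomologicalComplex.single_obj_d, zero_comp]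
    rfl
  · refine single_hom_ext ?_
    rw [cycleHom_f_apply, one_smul]

/-- The morphism in the derived category defined by a cycle. -/
def cycleMap (K : CochainComplex (ModuleCat.{u} R) ℤ) (n : ℤ) (x : K.X n)
    (hx : (K.d n (n + 1)).hom x = 0) : gen R n ⟶ Q.obj K :=
  Q.map (cycleHom K n x hx)

theorem exists_cycleMap {K : CochainComplex (ModuleCat.{u} R) ℤ} {n : ℤ}
    (f : gen R n ⟶ Q.obj K) : ∃ x hx, f = cycleMap K n x hx := by
  obtain ⟨f, rfl⟩ := Q_map_surjective_of_isKProjective _ _ f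
  obtain ⟨x, hx, rfl⟩ := exists_cycleHom f
  exact ⟨x, hx, rfl⟩

theorem cycleMap_comp {K L : CochainComplex (ModuleCat.{u} R) ℤ} (f : K ⟶ L) (n : ℤ) (x : K.X n)
    (hx : (K.d n (n + 1)).hom x = 0) : cycleMap K n x hx ≫ Q.map f =
      cycleMap L n ((f.f n).hom x) (by
        change (f.f n ≫ L.d n (n + 1)).hom x = 0
        rw [f.comm]
        change (f.f (n + 1)).hom ((K.d n (n + 1)).hom x) = 0
        rw [hx, map_zero]) := by
  rw [cycleMap, cycleMap, ← Q.map_comp]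
  congr 1
  refine single_hom_ext ?_
  rw [cycleHom_f_apply, one_smul, HomologicalComplex.comp_f]
  change (f.f n).hom (((cycleHom K n x hx).f n).hom _) = _
  rw [cycleHom_f_apply, one_smul]

/-- Since the source is K-projective, vanishing means being null-homotopic; a null-homotopy out of a
complex concentrated in one degree amounts to one element `y` with boundary `x`. -/
theorem cycleMap_eq_zero_iff (K : CochainComplex (ModuleCat.{u} R) ℤ) (n : ℤ) (x : K.X (n + 1))
    (hx : (K.d (n + 1) (n + 1 + 1)).hom x = 0) :
    cycleMap K (n + 1) x hx = 0 ↔ ∃ y, (K.d n (n + 1)).hom y = x := by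
  constructor
  · intro h
    obtain ⟨s, hs⟩ := (nonempty_homotopy_zero_iff _).1 (nonempty_homotopy_of_isKProjective h)
    have h1 := cycleHom_f_apply K (n + 1) x hx 1
    rw [hs, one_smul] at h1
    refine ⟨(s n).hom ((HomologicalComplex.singleObjXSelf (ComplexShape.up ℤ) (n + 1)
        (ModuleCat.of R R)).inv.hom (1 : R)), h1.symm.trans ?_ |>.symm⟩
    · rw [HomologicalComplex.single_obj_d, zero_comp, zero_add]
      rfl
  · rintro ⟨y, rfl⟩
    refine Q_map_eq_zero_of_homotopy (Nonempty.some ?_)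
    -- The homotopy sends the generator to `y` in degree `n` and is zero elsewhere; the case
    -- distinction carries the identification of the degrees.
    let z : ∀ p q : ℤ, (ComplexShape.up ℤ).Rel q p →
        (((HomologicalComplex.single (ModuleCat.{u} R) (ComplexShape.up ℤ) (n + 1)).obj
          (ModuleCat.of R R)).X p ⟶ K.X q) := fun p q hpq =>
      if h : n = q then eqToHom (by rw [← show q + 1 = p from hpq, h]) ≫
        (HomologicalComplex.singleObjXSelf (ComplexShape.up ℤ) (n + 1) (ModuleCat.of R R)).hom ≫
        ModuleCat.ofHom (LinearMap.toSpanSingleton R _ y) ≫ eqToHom (by rw [h]) else 0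
    refine ⟨(Homotopy.ofEq (single_hom_ext ?_)).trans (Homotopy.nullHomotopy' z)⟩
    rw [cycleHom_f_apply, one_smul, Homotopy.nullHomotopicMap'_f (k₂ := n) (k₁ := n + 1)
      (k₀ := n + 1 + 1) rfl rfl, HomologicalComplex.single_obj_d, zero_comp, zero_add]
    have hz : z (n + 1) n rfl = (HomologicalComplex.singleObjXSelf (ComplexShape.up ℤ) (n + 1)
        (ModuleCat.of R R)).hom ≫ ModuleCat.ofHom (LinearMap.toSpanSingleton R _ y) := by
      simp [z]
    rw [hz]
    change _ = ((HomologicalComplex.singleObjXSelf (ComplexShape.up ℤ) (n + 1)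
      (ModuleCat.of R R)).inv ≫ ((HomologicalComplex.singleObjXSelf (ComplexShape.up ℤ) (n + 1)
        (ModuleCat.of R R)).hom ≫ ModuleCat.ofHom (LinearMap.toSpanSingleton R _ y)) ≫
          K.d n (n + 1)).hom (1 : R)
    rw [Category.assoc, Iso.inv_hom_id_assoc]
    change _ = (K.d n (n + 1)).hom ((1 : R) • y)
    rw [one_smul]

/-- Morphisms from the regular module in degree `n` see all homology classes of degree `n`, so the
hypothesis makes a representing complex acyclic. -/
theorem isZero_of_gen (X : DerivedCategory (ModuleCat.{u} R))
    (h : ∀ (n : ℤ) (f : gen R n ⟶ X), f = 0) : IsZero X := by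
  let K := Q.objPreimage X
  have e : Q.obj K ≅ X := Q.objObjPreimageIso X
  refine IsZero.of_iso ?_ e.symm
  have hK : K.Acyclic := fun n => by
    obtain ⟨n, rfl⟩ : ∃ m, n = m + 1 := ⟨n - 1, by omega⟩
    rw [HomologicalComplex.exactAt_iff' _ n (n + 1) (n + 1 + 1) (by simp) (by simp),
      ShortComplex.moduleCat_exact_iff]
    intro x hx
    exact (cycleMap_eq_zero_iff K n x hx).1 (by
      rw [← cancel_mono e.hom, zero_comp]
      exact h _ _)
  -- On an acyclic complex the zero endomorphism is a quasi-isomorphism, so zero becomes invertible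
  -- in the derived category.
  have h1 : QuasiIso (0 : K ⟶ K) := by
    rw [quasiIso_iff]
    intro n
    rw [quasiIsoAt_iff_exactAt _ _ (hK n)]
    exact hK n
  have h2 : IsIso (Q.map (0 : K ⟶ K)) := inferInstance
  rw [Functor.map_zero] at h2
  exact (IsZero.iff_id_eq_zero _).2 ((cancel_epi (0 : Q.obj K ⟶ Q.obj K)).1 (by simp))

end Generator

end

/-! ### Derived categories of direct factors -/

noncomputable section

open DerivedCategory

/-- Right multiplication by `c` on the regular module placed in degree `n`. -/
def genMul {R : Type u} [Ring R] (n : ℤ) (c : R) : gen R n ⟶ gen R n :=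
  Q.map ((HomologicalComplex.single (ModuleCat.{u} R) (ComplexShape.up ℤ) n).map
    (ModuleCat.ofHom (LinearMap.toSpanSingleton R R c)))

theorem genMul_add {R : Type u} [Ring R] (n : ℤ) (c c' : R) :
    genMul n (c + c') = genMul n c + genMul n c' := by
  rw [genMul, genMul, genMul, ← Functor.map_add, ← Functor.map_add]
  congr 2
  ext
  simp

theorem genMul_zero {R : Type u} [Ring R] (n : ℤ) : genMul n (0 : R) = 0 := by
  have := genMul_add n (0 : R) 0
  rwa [add_zero, left_eq_add] at this

theorem genMul_one {R : Type u} [Ring R] (n : ℤ) : genMul n (1 : R) = 𝟙 _ := by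
  rw [genMul, ← Q.map_id, ← CategoryTheory.Functor.map_id]
  congr 2
  ext
  simp

theorem genMul_comp {R : Type u} [Ring R] (n : ℤ) (c c' : R) :
    genMul n c ≫ genMul n c' = genMul n (c * c') := by
  rw [genMul, genMul, genMul, ← Q.map_comp, ← Functor.map_comp]
  congr 2
  ext
  simp

theorem genMul_cycleMap {R : Type u} [Ring R] (K : CochainComplex (ModuleCat.{u} R) ℤ) (n : ℤ)
    (c : R) (x : K.X n) (hx : (K.d n (n + 1)).hom x = 0) :
    genMul n c ≫ cycleMap K n x hx = cycleMap K n (c • x) (by rw [map_smul, hx, smul_zero]) := by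
  rw [genMul, cycleMap, cycleMap, ← Q.map_comp]
  congr 1
  refine single_hom_ext ?_
  rw [cycleHom_f_apply, one_smul, HomologicalComplex.comp_f, HomologicalComplex.single_map_f_self]
  change ((cycleHom K n x hx).f n).hom (((HomologicalComplex.singleObjXSelf (ComplexShape.up ℤ) n
      (ModuleCat.of R R)).inv ≫ (HomologicalComplex.singleObjXSelf (ComplexShape.up ℤ) n
      (ModuleCat.of R R)).hom ≫ ModuleCat.ofHom (LinearMap.toSpanSingleton R R c) ≫
      (HomologicalComplex.singleObjXSelf (ComplexShape.up ℤ) n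
      (ModuleCat.of R R)).inv).hom (1 : R)) = _
  rw [Iso.inv_hom_id_assoc]
  change ((cycleHom K n x hx).f n).hom ((HomologicalComplex.singleObjXSelf (ComplexShape.up ℤ) n
      (ModuleCat.of R R)).inv.hom ((1 : R) • c)) = _
  rw [cycleHom_f_apply, one_smul]

namespace DirectFactor

variable {k : Type u} [Field k] {R S : Type u} [Ring R] [Ring S] [Algebra k R]
    [Algebra k S] (d : DirectFactor k R S)

/-- Restriction `𝒟(S) ⥤ 𝒟(R)`. -/
abbrev dRes : DerivedCategory (ModuleCat.{u} S) ⥤ DerivedCategory (ModuleCat.{u} R) :=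
  d.res.mapDerivedCategory

/-- The derived functor `𝒟(R) ⥤ 𝒟(S)` of `M ↦ e M`. -/
abbrev dCut : DerivedCategory (ModuleCat.{u} R) ⥤ DerivedCategory (ModuleCat.{u} S) :=
  d.cut.mapDerivedCategory

def dResAdjCut : d.dRes ⊣ d.dCut := d.resAdjCut.mapDerivedCategory

def dCutAdjRes : d.dCut ⊣ d.dRes := d.cutAdjRes.mapDerivedCategory

instance : IsIso d.resAdjCut.unit := by
  have : ∀ N, IsIso (d.resAdjCut.unit.app N) := fun N =>
    inferInstanceAs (IsIso (d.cutRes N).inv)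
  exact NatIso.isIso_of_isIso_app _

instance : IsIso d.dResAdjCut.unit := d.resAdjCut.isIso_mapDerivedCategory_unit

instance : d.dRes.Full := d.dResAdjCut.fullyFaithfulLOfIsIsoUnit.full

instance : d.dRes.Faithful := d.dResAdjCut.fullyFaithfulLOfIsIsoUnit.faithful

/-- This brings the composite `X ⟶ e X ⟶ X` back to complexes, where it is multiplication by `e` in
each degree. -/
theorem unit_comp_counit_Q (K : CochainComplex (ModuleCat.{u} R) ℤ) :
    d.dCutAdjRes.unit.app (Q.obj K) ≫ d.dResAdjCut.counit.app (Q.obj K) =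
      Q.map (d.cutAdjRes.mapCochainComplex.unit.app K ≫
        d.resAdjCut.mapCochainComplex.counit.app K) := by
  rw [dCutAdjRes, dResAdjCut, Adjunction.mapDerivedCategory_unit_app_Q,
    Adjunction.mapDerivedCategory_counit_app_Q, Q.map_comp]
  simp only [Category.assoc]
  congr 1
  slice_lhs 2 3 => rw [← Functor.map_comp, Iso.inv_hom_id_app]
  erw [CategoryTheory.Functor.map_id]
  simp

/-- The idempotent `e` acts on an object of the derived category as the composition
`X ⟶ e X ⟶ X`. -/
theorem comp_unit_comp_counit {X : DerivedCategory (ModuleCat.{u} R)} {n : ℤ} (f : gen R n ⟶ X) :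
    f ≫ d.dCutAdjRes.unit.app X ≫ d.dResAdjCut.counit.app X = genMul n d.e ≫ f := by
  let e := Q.objObjPreimageIso X
  obtain ⟨x, hx, h⟩ := exists_cycleMap (f ≫ e.inv)
  have hf : f = cycleMap _ n x hx ≫ e.hom := by
    rw [← h, Category.assoc, e.inv_hom_id, Category.comp_id]
  have h1 := d.dCutAdjRes.unit.naturality e.hom
  have h2 := d.dResAdjCut.counit.naturality e.hom
  dsimp only [Functor.comp_obj, Functor.id_obj, Functor.comp_map, Functor.id_map] at h1 h2
  rw [hf, Category.assoc, reassoc_of% h1, h2, ← Category.assoc, ← Category.assoc, ← Category.assoc,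
    Category.assoc (cycleMap _ n x hx), unit_comp_counit_Q, genMul_cycleMap, cycleMap_comp]
  rfl

/-- The objects of `𝒟(R)` on which `e` acts as the identity are those which come from `𝒟(S)`. -/
theorem isIso_unit_iff (X : DerivedCategory (ModuleCat.{u} R)) :
    IsIso (d.dCutAdjRes.unit.app X) ↔ ∀ (n : ℤ) (f : gen R n ⟶ X), genMul n (1 - d.e) ≫ f = 0 := by
  constructor
  · intro h n f
    -- Up to isomorphism `X` is the restriction of a complex of `S`-modules, on which `1 - e` acts
    -- as zero.
    let L := Q.objPreimage (d.dCut.obj X)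
    let i : X ≅ Q.obj ((d.res.mapHomologicalComplex (ComplexShape.up ℤ)).obj L) :=
      asIso (d.dCutAdjRes.unit.app X) ≪≫ d.dRes.mapIso (Q.objObjPreimageIso _).symm ≪≫
        d.res.mapDerivedCategoryFactors.app L
    obtain ⟨x, hx, hf⟩ := exists_cycleMap (f ≫ i.hom)
    rw [← cancel_mono i.hom, zero_comp, Category.assoc, hf, genMul_cycleMap]
    obtain ⟨n, rfl⟩ : ∃ m, n = m + 1 := ⟨n - 1, by omega⟩
    rw [cycleMap_eq_zero_iff]
    refine ⟨0, ?_⟩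
    rw [map_zero, sub_smul, one_smul, eq_comm, sub_eq_zero, eq_comm]
    change d.π d.e • (show L.X (n + 1) from x) = x
    rw [d.π_e, one_smul]
  · intro h
    -- The composite `e X ⟶ X ⟶ e X` is invertible, by naturality and the triangle identities; so
    -- the unit is a split epimorphism, and its fibre `W` embeds into `X`.
    have hs : IsIso (d.dResAdjCut.counit.app X ≫ d.dCutAdjRes.unit.app X) := by
      have h1 := d.dCutAdjRes.unit.naturality (d.dResAdjCut.counit.app X)
      dsimp only [Functor.comp_obj, Functor.id_obj, Functor.comp_map, Functor.id_map] at h1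
      rw [h1]
      have h2 : IsIso (d.dCut.map (d.dResAdjCut.counit.app X)) := by
        have h3 := d.dResAdjCut.right_triangle_components X
        have : IsIso (d.dResAdjCut.unit.app (d.dCut.obj X) ≫
            d.dCut.map (d.dResAdjCut.counit.app X)) := by
          rw [h3]
          exact IsIso.id _
        exact IsIso.of_isIso_comp_left (d.dResAdjCut.unit.app (d.dCut.obj X)) _
      have h4 : IsIso (d.dCutAdjRes.unit.app (d.dRes.obj (d.dCut.obj X))) := by
        have h3 := d.dCutAdjRes.right_triangle_components (d.dCut.obj X)
        have : IsIso (d.dCutAdjRes.unit.app (d.dRes.obj (d.dCut.obj X)) ≫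
            d.dRes.map (d.dCutAdjRes.counit.app (d.dCut.obj X))) := by
          rw [h3]
          exact IsIso.id _
        exact IsIso.of_isIso_comp_right _ (d.dRes.map (d.dCutAdjRes.counit.app (d.dCut.obj X)))
      infer_instance
    have hepi : Epi (d.dCutAdjRes.unit.app X) :=
      epi_of_epi (d.dResAdjCut.counit.app X) (d.dCutAdjRes.unit.app X)
    obtain ⟨W, κ, δ, hT⟩ := distinguished_cocone_triangle₁ (d.dCutAdjRes.unit.app X)
    change W ⟶ X at κ
    have hκ : Mono κ := Triangle.mono₁ _ hT (Triangle.mor₃_eq_zero_of_epi₂ _ hT hepi)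
    have hκη : κ ≫ d.dCutAdjRes.unit.app X = 0 := comp_distTriang_mor_zero₁₂ _ hT
    -- A morphism from a generator to `W`, viewed in `X`, is killed by `e` because the unit vanishes
    -- on `W`, and by `1 - e` by hypothesis.
    refine (Triangle.isZero₁_iff_isIso₂ _ hT).1 (isZero_of_gen W fun n f => ?_)
    rw [← cancel_mono κ, zero_comp]
    have h1 := d.comp_unit_comp_counit (f ≫ κ)
    rw [Category.assoc, reassoc_of% hκη, zero_comp, comp_zero] at h1
    have h2 := h n (f ≫ κ)
    rw [sub_eq_add_neg, genMul_add, genMul_one, Preadditive.add_comp, Category.id_comp] at h2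
    have h3 : genMul n (-d.e) = - genMul n d.e := by
      rw [eq_neg_iff_add_eq_zero, ← genMul_add, neg_add_cancel]
      have := genMul_add n (0 : R) 0
      rwa [add_zero, left_eq_add] at this
    rw [h3, Preadditive.neg_comp, ← h1, neg_zero, add_zero] at h2
    exact h2

end DirectFactor

end

/-! ### Triangle functors and triangle equivalences -/

noncomputable section

section TriFunctor

variable {k : Type*} [Field k]
  {𝒟₁ : Type*} [Category 𝒟₁] [HasZeroObject 𝒟₁] [Preadditive 𝒟₁] [Linear k 𝒟₁] [HasShift 𝒟₁ ℤ]
  [∀ n : ℤ, (shiftFunctor 𝒟₁ n).Additive] [Pretriangulated 𝒟₁]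
  {𝒟₂ : Type*} [Category 𝒟₂] [HasZeroObject 𝒟₂] [Preadditive 𝒟₂] [Linear k 𝒟₂] [HasShift 𝒟₂ ℤ]
  [∀ n : ℤ, (shiftFunctor 𝒟₂ n).Additive] [Pretriangulated 𝒟₂]
  {𝒟₃ : Type*} [Category 𝒟₃] [HasZeroObject 𝒟₃] [Preadditive 𝒟₃] [Linear k 𝒟₃]
  [HasShift 𝒟₃ ℤ] [∀ n : ℤ, (shiftFunctor 𝒟₃ n).Additive] [Pretriangulated 𝒟₃]

/-- The composition of two triangle functors. -/
def TriFunctor.comp (F : TriFunctor k 𝒟₁ 𝒟₂) (G : TriFunctor k 𝒟₂ 𝒟₃) : TriFunctor k 𝒟₁ 𝒟₃ where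
  functor := F.functor ⋙ G.functor

/-- The right adjoint of a triangle functor is a triangle functor. -/
def TriFunctor.rightAdjoint (F : TriFunctor k 𝒟₁ 𝒟₂) (G : 𝒟₂ ⥤ 𝒟₁) (adj : F.functor ⊣ G)
    [G.Linear k] : TriFunctor k 𝒟₂ 𝒟₁ :=
  letI := adj.rightAdjointCommShift ℤ
  haveI := adj.commShift_of_leftAdjoint ℤ
  { functor := G
    isTriangulated := adj.isTriangulated_rightAdjoint }

/-- The inverse of a triangle equivalence. -/
def TriFunctor.inv (F : TriFunctor k 𝒟₁ 𝒟₂) [F.functor.IsEquivalence] : TriFunctor k 𝒟₂ 𝒟₁ :=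
  haveI : F.functor.asEquivalence.functor.Linear k := F.linear
  F.rightAdjoint F.functor.asEquivalence.inverse F.functor.asEquivalence.toAdjunction

/-- A triangle equivalence is left adjoint to its inverse. -/
def TriFunctor.adjInv (F : TriFunctor k 𝒟₁ 𝒟₂) [F.functor.IsEquivalence] :
    F.functor ⊣ F.inv.functor :=
  F.functor.asEquivalence.toAdjunction

/-- A triangle equivalence is right adjoint to its inverse. -/
def TriFunctor.invAdj (F : TriFunctor k 𝒟₁ 𝒟₂) [F.functor.IsEquivalence] :
    F.inv.functor ⊣ F.functor :=
  F.functor.asEquivalence.symm.toAdjunction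

instance (F : TriFunctor k 𝒟₁ 𝒟₂) [F.functor.IsEquivalence] : F.inv.functor.IsEquivalence :=
  inferInstanceAs (F.functor.asEquivalence.inverse.IsEquivalence)

theorem TriEquivalent.refl : TriEquivalent k 𝒟₁ 𝒟₁ :=
  ⟨{ functor := 𝟭 𝒟₁ }, inferInstanceAs (𝟭 𝒟₁).IsEquivalence⟩

theorem TriEquivalent.symm (h : TriEquivalent k 𝒟₁ 𝒟₂) : TriEquivalent k 𝒟₂ 𝒟₁ := by
  obtain ⟨F, hF⟩ := h
  exact ⟨F.inv, inferInstance⟩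

theorem TriEquivalent.trans (h : TriEquivalent k 𝒟₁ 𝒟₂) (h' : TriEquivalent k 𝒟₂ 𝒟₃) :
    TriEquivalent k 𝒟₁ 𝒟₃ := by
  obtain ⟨F, hF⟩ := h
  obtain ⟨G, hG⟩ := h'
  exact ⟨F.comp G, inferInstanceAs (F.functor ⋙ G.functor).IsEquivalence⟩

instance (F : TriFunctor k 𝒟₁ 𝒟₂) : F.functor.Additive := inferInstance

end TriFunctor

namespace DirectFactor

open DerivedCategory

variable {k : Type u} [Field k] {R S : Type u} [Ring R] [Ring S] [Algebra k R]
    [Algebra k S] (d : DirectFactor k R S)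

/-- Restriction as a triangle functor. -/
def triRes : TriFunctor k (DerivedCategory (ModuleCat.{u} S)) (DerivedCategory (ModuleCat.{u} R)) where
  functor := d.dRes

/-- The functor `X ↦ e X` as a triangle functor. -/
def triCut : TriFunctor k (DerivedCategory (ModuleCat.{u} R)) (DerivedCategory (ModuleCat.{u} S)) where
  functor := d.dCut

variable {𝒟₁ : Type*} [Category 𝒟₁] [HasZeroObject 𝒟₁] [Preadditive 𝒟₁] [Linear k 𝒟₁]
  [HasShift 𝒟₁ ℤ] [∀ n : ℤ, (shiftFunctor 𝒟₁ n).Additive] [Pretriangulated 𝒟₁]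

instance isIso_unit_dRes (N : DerivedCategory (ModuleCat.{u} S)) :
    IsIso (d.dCutAdjRes.unit.app (d.dRes.obj N)) := by
  have h3 := d.dCutAdjRes.right_triangle_components N
  have : IsIso (d.dCutAdjRes.unit.app (d.dRes.obj N) ≫
      d.dRes.map (d.dCutAdjRes.counit.app N)) := by
    rw [h3]
    exact IsIso.id _
  exact IsIso.of_isIso_comp_right _ (d.dRes.map (d.dCutAdjRes.counit.app N))

/-- A category with a fully faithful functor to `𝒟(R)` whose essential image consists of the
objects on which `e` acts as the identity is equivalent to `𝒟(S)`. -/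
theorem triEquivalent_of_essImage (Φ : TriFunctor k 𝒟₁ (DerivedCategory (ModuleCat.{u} R)))
    [Φ.functor.Full] [Φ.functor.Faithful]
    (h : ∀ X, Φ.functor.essImage X ↔ IsIso (d.dCutAdjRes.unit.app X)) :
    TriEquivalent k 𝒟₁ (DerivedCategory (ModuleCat.{u} S)) := by
  have hΦ : ∀ Y, IsIso (d.dCutAdjRes.unit.app (Φ.functor.obj Y)) := fun Y =>
    (h _).1 (Functor.obj_mem_essImage _ _)
  -- By naturality, `dCut.map` corresponds under the adjunction to composition with the unit, which
  -- is invertible on the image of `Φ`. This gives fullness and faithfulness at once.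
  have hη : ∀ {X Y : DerivedCategory (ModuleCat.{u} R)} (f : X ⟶ Y),
      d.dCutAdjRes.homEquiv _ _ (d.dCut.map f) = f ≫ d.dCutAdjRes.unit.app Y := fun f => by
    rw [Adjunction.homEquiv_unit]
    exact (d.dCutAdjRes.unit.naturality f).symm
  refine ⟨Φ.comp d.triCut, ?_⟩
  change (Φ.functor ⋙ d.dCut).IsEquivalence
  have h1 : (Φ.functor ⋙ d.dCut).Faithful := ⟨fun {X Y f g} hfg => by
    apply Φ.functor.map_injective
    rw [← cancel_mono (d.dCutAdjRes.unit.app (Φ.functor.obj Y))]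
    refine (hη _).symm.trans (Eq.trans ?_ (hη _))
    exact congrArg _ hfg⟩
  have h2 : (Φ.functor ⋙ d.dCut).Full := ⟨fun {X Y} g => by
    obtain ⟨f, hf⟩ := Φ.functor.map_surjective
      (d.dCutAdjRes.homEquiv _ _ g ≫ inv (d.dCutAdjRes.unit.app (Φ.functor.obj Y)))
    refine ⟨f, (d.dCutAdjRes.homEquiv _ _).injective ?_⟩
    refine (hη _).trans ?_
    rw [hf, Category.assoc]
    erw [IsIso.inv_hom_id, Category.comp_id]⟩
  have h3 : (Φ.functor ⋙ d.dCut).EssSurj := ⟨fun N => by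
    obtain ⟨Y, ⟨i⟩⟩ := (h (d.dRes.obj N)).2 inferInstance
    exact ⟨Y, ⟨d.dCut.mapIso i ≪≫ asIso (d.dCutAdjRes.counit.app N)⟩⟩⟩
  exact {}

end DirectFactor

end

/-! ### Gluings: one half of a recollement, transported along an equivalence. -/

noncomputable section

theorem distinguished_of_iso_middle {𝒟 : Type*} [Category 𝒟] [HasZeroObject 𝒟] [Preadditive 𝒟]
    [HasShift 𝒟 ℤ] [∀ n : ℤ, (shiftFunctor 𝒟 n).Additive] [Pretriangulated 𝒟] {X Y Y' Z : 𝒟}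
    {a : X ⟶ Y} {b : Y ⟶ Z} {c : Z ⟶ X⟦(1 : ℤ)⟧} (e : Y ≅ Y')
    (h : Triangle.mk a b c ∈ distTriang 𝒟) :
    Triangle.mk (a ≫ e.hom) (e.inv ≫ b) c ∈ distTriang 𝒟 :=
  isomorphic_distinguished _ h _
    (Triangle.isoMk _ _ (Iso.refl X) e.symm (Iso.refl Z)
      (by change (a ≫ e.hom) ≫ e.inv = 𝟙 X ≫ a; simp)
      (by change (e.inv ≫ b) ≫ 𝟙 Z = e.inv ≫ b; simp)
      (by change c ≫ (shiftFunctor 𝒟 1).map (𝟙 X) = 𝟙 Z ≫ c; simp))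

section Gluing

variable (k : Type*) [Field k]
  (𝒟' : Type*) [Category 𝒟'] [HasZeroObject 𝒟'] [Preadditive 𝒟'] [Linear k 𝒟'] [HasShift 𝒟' ℤ]
  [∀ n : ℤ, (shiftFunctor 𝒟' n).Additive] [Pretriangulated 𝒟']
  (𝒟 : Type*) [Category 𝒟] [HasZeroObject 𝒟] [Preadditive 𝒟] [Linear k 𝒟] [HasShift 𝒟 ℤ]
  [∀ n : ℤ, (shiftFunctor 𝒟 n).Additive] [Pretriangulated 𝒟]
  (𝒟'' : Type*) [Category 𝒟''] [HasZeroObject 𝒟''] [Preadditive 𝒟''] [Linear k 𝒟'']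
  [HasShift 𝒟'' ℤ] [∀ n : ℤ, (shiftFunctor 𝒟'' n).Additive] [Pretriangulated 𝒟'']

/-- The part of a recollement which is given by the triangles `j_! j^! X ⟶ X ⟶ i_* i^* X ⟶`, up to
an equivalence of the middle term. -/
structure Gluing where
  i : TriFunctor k 𝒟' 𝒟
  iL : 𝒟 ⥤ 𝒟'
  iR : 𝒟 ⥤ 𝒟'
  adjL : iL ⊣ i.functor
  adjR : i.functor ⊣ iR
  i_full : i.functor.Full
  i_faithful : i.functor.Faithful
  j : TriFunctor k 𝒟'' 𝒟
  jR : 𝒟 ⥤ 𝒟''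
  jRR : 𝒟'' ⥤ 𝒟
  adj : j.functor ⊣ jR
  adj' : jR ⊣ jRR
  j_full : j.functor.Full
  j_faithful : j.functor.Faithful
  jRR_faithful : jRR.Faithful
  orth : ∀ (Z : 𝒟'') (Y : 𝒟') (f : j.functor.obj Z ⟶ i.functor.obj Y), f = 0
  triangle : ∀ X : 𝒟, ∃ (Z : 𝒟'') (Y : 𝒟') (a : j.functor.obj Z ⟶ X) (b : X ⟶ i.functor.obj Y)
    (c : i.functor.obj Y ⟶ (j.functor.obj Z)⟦(1 : ℤ)⟧), Triangle.mk a b c ∈ distTriang 𝒟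

attribute [instance] Gluing.i_full Gluing.i_faithful Gluing.j_full Gluing.j_faithful
  Gluing.jRR_faithful

variable {k 𝒟' 𝒟 𝒟''}

/-- The gluing given by a recollement and an equivalence of its middle term. -/
def Recollement.gluing {𝒟₁ : Type*} [Category 𝒟₁] [HasZeroObject 𝒟₁] [Preadditive 𝒟₁]
    [Linear k 𝒟₁] [HasShift 𝒟₁ ℤ] [∀ n : ℤ, (shiftFunctor 𝒟₁ n).Additive] [Pretriangulated 𝒟₁]
    (r : Recollement k 𝒟' 𝒟 𝒟'') (Φ : TriFunctor k 𝒟 𝒟₁) [Φ.functor.IsEquivalence] :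
    Gluing k 𝒟' 𝒟₁ 𝒟'' where
  i := r.iLower.comp Φ
  iL := Φ.inv.functor ⋙ r.iStar.functor
  iR := Φ.inv.functor ⋙ r.iShriek.functor
  adjL := Φ.invAdj.comp r.adjIStar
  adjR := r.adjIShriek.comp Φ.adjInv
  i_full := by
    have := r.iLower_full
    exact inferInstanceAs (r.iLower.functor ⋙ Φ.functor).Full
  i_faithful := by
    have := r.iLower_faithful
    exact inferInstanceAs (r.iLower.functor ⋙ Φ.functor).Faithful
  j := r.jShriek.comp Φ
  jR := Φ.inv.functor ⋙ r.jStar.functor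
  jRR := r.jLower.functor ⋙ Φ.functor
  adj := r.adjJShriek.comp Φ.adjInv
  adj' := Φ.invAdj.comp r.adjJLower
  j_full := by
    have := r.jShriek_full
    exact inferInstanceAs (r.jShriek.functor ⋙ Φ.functor).Full
  j_faithful := by
    have := r.jShriek_faithful
    exact inferInstanceAs (r.jShriek.functor ⋙ Φ.functor).Faithful
  jRR_faithful := by
    have := r.jLower_faithful
    infer_instance
  orth Z Y f := by
    -- The vanishing of `j^* i_*` is adjoint to that of `i^! j_*`; the orthogonality of `j_!` and
    -- `i_*` follows by one more adjunction.
    have h1 : ∀ (W : 𝒟'') (g : r.jStar.functor.obj (r.iLower.functor.obj Y) ⟶ W), g = 0 := by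
      intro W g
      apply (r.adjJLower.homEquiv _ _).injective
      apply (r.adjIShriek.homEquiv _ _).injective
      exact (r.iShriek_jLower W).eq_of_tgt _ _
    have h2 : IsZero (r.jStar.functor.obj (r.iLower.functor.obj Y)) :=
      (IsZero.iff_id_eq_zero _).2 (h1 _ _)
    obtain ⟨g, rfl⟩ := Φ.functor.map_surjective f
    have : g = 0 := (r.adjJShriek.homEquiv _ _).injective (h2.eq_of_tgt _ _)
    rw [this]
    exact Φ.functor.map_zero _ _
  triangle X := by
    obtain ⟨h, hh⟩ := r.triangle₂ (Φ.inv.functor.obj X)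
    let e : Φ.functor.obj (Φ.inv.functor.obj X) ≅ X := Φ.functor.asEquivalence.counitIso.app X
    refine ⟨_, _, Φ.functor.map (r.adjJShriek.counit.app (Φ.inv.functor.obj X)) ≫ e.hom,
      e.inv ≫ Φ.functor.map (r.adjIStar.unit.app (Φ.inv.functor.obj X)),
      Φ.functor.map h ≫ (Φ.functor.commShiftIso (1 : ℤ)).hom.app _, ?_⟩
    exact distinguished_of_iso_middle e (Φ.functor.map_distinguished _ hh)

end Gluing

/-! ### Orthogonal gluings of `𝒟(S)` and central idempotents of `S`. -/

section Decomposition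

open DerivedCategory

variable {k : Type u} [Field k] {S : Type u} [Ring S] [Algebra k S]

theorem singleFunctor_map_genMul (c : S) (n : ℤ) :
    (singleFunctor (ModuleCat.{u} S) n).map
      (ModuleCat.ofHom (LinearMap.toSpanSingleton S S c)) = genMul n c := rfl

/-- The isomorphism `S[-n] ≅ S[0][-n]`. -/
def genShiftIso (S : Type u) [Ring S] (n : ℤ) : (gen S 0)⟦-n⟧ ≅ gen S n :=
  ((singleFunctors (ModuleCat.{u} S)).shiftIso (-n) n 0 (by omega)).app (ModuleCat.of S S)

theorem genShiftIso_naturality (n : ℤ) (c : S) :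
    (genMul 0 c)⟦-n⟧' ≫ (genShiftIso S n).hom = (genShiftIso S n).hom ≫ genMul n c :=
  ((singleFunctors (ModuleCat.{u} S)).shiftIso (-n) n 0 (by omega)).hom.naturality
    (ModuleCat.ofHom (LinearMap.toSpanSingleton S S c))

theorem genMul_injective {c c' : S} (h : genMul 0 c = genMul 0 c') : c = c' := by
  have h1 := (singleFunctor (ModuleCat.{u} S) 0).map_injective h
  have h2 := congrArg (fun f => f.hom (1 : S)) h1
  simpa using h2

theorem exists_genMul (f : gen S 0 ⟶ gen S 0) : ∃ c, f = genMul 0 c := by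
  obtain ⟨g, rfl⟩ := (singleFunctor (ModuleCat.{u} S) 0).map_surjective f
  refine ⟨g.hom (1 : S), ?_⟩
  rw [← singleFunctor_map_genMul]
  congr 1
  ext
  simp

variable {𝒟' : Type*} [Category 𝒟'] [HasZeroObject 𝒟'] [Preadditive 𝒟'] [Linear k 𝒟']
  [HasShift 𝒟' ℤ] [∀ n : ℤ, (shiftFunctor 𝒟' n).Additive] [Pretriangulated 𝒟']
  {𝒟'' : Type*} [Category 𝒟''] [HasZeroObject 𝒟''] [Preadditive 𝒟''] [Linear k 𝒟'']
  [HasShift 𝒟'' ℤ] [∀ n : ℤ, (shiftFunctor 𝒟'' n).Additive] [Pretriangulated 𝒟'']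

namespace Gluing

section

variable {𝒟 : Type*} [Category 𝒟] [HasZeroObject 𝒟] [Preadditive 𝒟] [Linear k 𝒟] [HasShift 𝒟 ℤ]
  [∀ n : ℤ, (shiftFunctor 𝒟 n).Additive] [Pretriangulated 𝒟] (g : Gluing k 𝒟' 𝒟 𝒟'')

/-- The connecting morphism goes from the left side to a shift of an object of the right side, hence
is zero, and a triangle with zero connecting morphism splits. -/
theorem triangle_split (horth : ∀ (Y : 𝒟') (Z : 𝒟'')
    (f : g.i.functor.obj Y ⟶ g.j.functor.obj Z), f = 0) (X : 𝒟) :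
    ∃ (Z : 𝒟'') (Y : 𝒟') (a : g.j.functor.obj Z ⟶ X) (q : X ⟶ g.j.functor.obj Z)
      (p : X ⟶ g.i.functor.obj Y) (s : g.i.functor.obj Y ⟶ X), a ≫ q = 𝟙 _ ∧ s ≫ p = 𝟙 _ ∧
        q ≫ a + p ≫ s = 𝟙 X := by
  obtain ⟨Z, Y, a, p, c, hT⟩ := g.triangle X
  have hc : c = 0 := by
    rw [← cancel_mono ((g.j.functor.commShiftIso (1 : ℤ)).inv.app Z), zero_comp]
    exact horth _ _ _
  have hp : Epi p := Triangle.epi₂ _ hT hc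
  have ha : Mono a := Triangle.mono₁ _ hT hc
  have hap : a ≫ p = 0 := comp_distTriang_mor_zero₁₂ _ hT
  obtain ⟨s, hs⟩ : ∃ s : g.i.functor.obj Y ⟶ X, 𝟙 (g.i.functor.obj Y) = s ≫ p :=
    Triangle.coyoneda_exact₃ _ hT (𝟙 (g.i.functor.obj Y)) (by
      change 𝟙 (g.i.functor.obj Y) ≫ c = 0
      rw [hc, comp_zero])
  obtain ⟨q, hq⟩ : ∃ q : X ⟶ g.j.functor.obj Z, 𝟙 X - p ≫ s = q ≫ a :=
    Triangle.coyoneda_exact₂ _ hT (𝟙 X - p ≫ s) (by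
      change (𝟙 X - p ≫ s) ≫ p = 0
      rw [Preadditive.sub_comp, Category.assoc, ← hs, Category.id_comp, Category.comp_id, sub_self])
  refine ⟨Z, Y, a, q, p, s, ?_, hs.symm, by rw [← hq, sub_add_cancel]⟩
  rw [← cancel_mono a, Category.assoc, ← hq, Preadditive.comp_sub, reassoc_of% hap, zero_comp,
    sub_zero, Category.comp_id, Category.id_comp]

end

variable (g : Gluing k 𝒟' (DerivedCategory (ModuleCat.{u} S)) 𝒟'')

/-- A gluing of `𝒟(S)` with vanishing morphisms in both directions comes from a decomposition of
`S` by central idempotents. -/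
theorem exists_central (horth : ∀ (Y : 𝒟') (Z : 𝒟'')
    (f : g.i.functor.obj Y ⟶ g.j.functor.obj Z), f = 0) :
    ∃ c₁ c₂ : S, c₁ + c₂ = 1 ∧ c₁ * c₁ = c₁ ∧ (∀ x, c₁ * x = x * c₁) ∧
      (∀ X, g.i.functor.essImage X ↔ ∀ (n : ℤ) (f : gen S n ⟶ X), genMul n c₂ ≫ f = 0) ∧
      (∀ X, g.j.functor.essImage X ↔ ∀ (n : ℤ) (f : gen S n ⟶ X), genMul n c₁ ≫ f = 0) := by
  obtain ⟨Z₀, Y₀, a, q, p, s, haq, hsp, hsum⟩ := g.triangle_split horth (gen S 0)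
  obtain ⟨c₁, hc₁⟩ := exists_genMul (p ≫ s)
  obtain ⟨c₂, hc₂⟩ := exists_genMul (q ≫ a)
  have h1 : c₁ + c₂ = 1 := genMul_injective (by
    rw [genMul_add, ← hc₁, ← hc₂, add_comm, hsum, genMul_one])
  have h2 : c₁ * c₁ = c₁ := genMul_injective (by
    rw [← genMul_comp, ← hc₁, Category.assoc, reassoc_of% hsp])
  -- The product is an endomorphism of the regular module that passes through a morphism between the
  -- two orthogonal sides. With `h21` this leaves no off-diagonal part, so `c₁` is central.
  have h12 : ∀ x, c₁ * x * c₂ = 0 := fun x => genMul_injective (by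
    rw [← genMul_comp, ← genMul_comp, ← hc₁, ← hc₂, genMul_zero, Category.assoc, Category.assoc]
    have := horth _ _ (s ≫ genMul 0 x ≫ q)
    rw [reassoc_of% this, zero_comp, comp_zero])
  have h21 : ∀ x, c₂ * x * c₁ = 0 := fun x => genMul_injective (by
    rw [← genMul_comp, ← genMul_comp, ← hc₁, ← hc₂, genMul_zero, Category.assoc, Category.assoc]
    have := g.orth _ _ (a ≫ genMul 0 x ≫ p)
    rw [reassoc_of% this, zero_comp, comp_zero])
  have hcomm : ∀ x, c₁ * x = x * c₁ := fun x => by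
    have h3 := h12 x
    have h4 := h21 x
    rw [eq_sub_of_add_eq' h1, mul_sub, mul_one, sub_eq_zero] at h3
    rw [eq_sub_of_add_eq' h1, sub_mul, one_mul, sub_mul, sub_eq_zero] at h4
    rw [h3, h4]
  -- The decomposition in degree `0`, shifted to degree `n`.
  have key : ∀ n, ∃ (Z : 𝒟'') (Y : 𝒟') (a : g.j.functor.obj Z ⟶ gen S n)
      (q : gen S n ⟶ g.j.functor.obj Z) (p : gen S n ⟶ g.i.functor.obj Y)
      (s : g.i.functor.obj Y ⟶ gen S n), a ≫ q = 𝟙 _ ∧ q ≫ a = genMul n c₂ ∧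
        p ≫ s = genMul n c₁ := fun n => by
    let ej := (g.j.functor.commShiftIso (-n)).app Z₀
    let ei := (g.i.functor.commShiftIso (-n)).app Y₀
    refine ⟨Z₀⟦-n⟧, Y₀⟦-n⟧, ej.hom ≫ a⟦-n⟧' ≫ (genShiftIso S n).hom,
      (genShiftIso S n).inv ≫ q⟦-n⟧' ≫ ej.inv, (genShiftIso S n).inv ≫ p⟦-n⟧' ≫ ei.inv,
      ei.hom ≫ s⟦-n⟧' ≫ (genShiftIso S n).hom, ?_, ?_, ?_⟩
    · simp only [Category.assoc, Iso.hom_inv_id_assoc]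
      rw [← Functor.map_comp_assoc, haq, CategoryTheory.Functor.map_id, Category.id_comp,
        ej.hom_inv_id]
      rfl
    · simp only [Category.assoc, Iso.inv_hom_id_assoc]
      rw [← Functor.map_comp_assoc, hc₂, genShiftIso_naturality, Iso.inv_hom_id_assoc]
    · simp only [Category.assoc, Iso.inv_hom_id_assoc]
      rw [← Functor.map_comp_assoc, hc₁, genShiftIso_naturality, Iso.inv_hom_id_assoc]
  have hdec : ∀ (n : ℤ) (X : DerivedCategory (ModuleCat.{u} S)) (f : gen S n ⟶ X),
      f = genMul n c₁ ≫ f + genMul n c₂ ≫ f := fun n X f => by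
    rw [← Preadditive.add_comp, ← genMul_add, h1, genMul_one, Category.id_comp]
  have hjR : ∀ Y, IsZero (g.jR.obj (g.i.functor.obj Y)) := fun Y => by
    have : ∀ f : g.jR.obj (g.i.functor.obj Y) ⟶ g.jR.obj (g.i.functor.obj Y), f = 0 := fun f => by
      apply (g.adj.homEquiv _ _).symm.injective
      rw [g.orth _ _ ((g.adj.homEquiv _ _).symm f), g.orth _ _ ((g.adj.homEquiv _ _).symm 0)]
    exact (IsZero.iff_id_eq_zero _).2 (this _)
  refine ⟨c₁, c₂, h1, h2, hcomm, fun X => ⟨?_, fun h => ?_⟩, fun X => ⟨?_, fun h => ?_⟩⟩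
  · rintro ⟨Y, ⟨e⟩⟩ n f
    obtain ⟨Z, -, a, q, -, -, -, hqa, -⟩ := key n
    rw [← hqa, ← cancel_mono e.inv, Category.assoc, Category.assoc, zero_comp,
      g.orth _ _ (a ≫ f ≫ e.inv), comp_zero]
  · obtain ⟨Z, Y, a', q', p', s', haq', hsp', hsum'⟩ := g.triangle_split horth X
    -- Here `W` is the right hand part of a generator. A morphism from it to the right hand part of
    -- `X` factors through the action of `c₂` on morphisms to `X`, which is zero by hypothesis.
    have hZ : ∀ (W : 𝒟'') (n : ℤ) (b : g.j.functor.obj W ⟶ gen S n)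
        (b' : gen S n ⟶ g.j.functor.obj W) (_ : b ≫ b' = 𝟙 _) (_ : b' ≫ b = genMul n c₂)
        (f : W ⟶ Z), f = 0 := fun W n b b' hb hb' f => by
      apply g.j.functor.map_injective
      have h3 := h n (b' ≫ g.j.functor.map f ≫ a')
      rw [← hb', Category.assoc, reassoc_of% hb] at h3
      have h4 := b ≫= h3
      rw [reassoc_of% hb, comp_zero] at h4
      have h5 := h4 =≫ q'
      rw [Category.assoc, haq', Category.comp_id, zero_comp] at h5
      rw [h5, Functor.map_zero]
    -- Morphisms from a generator to `jRR Z` split into two parts: the part from the left side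
    -- vanishes since `jR` kills that side, the other is adjoint to a morphism `W ⟶ Z`. Faithfulness
    -- of `jRR` then gives `Z = 0`.
    have hZ0 : IsZero (g.jRR.obj Z) := isZero_of_gen _ fun n f => by
      obtain ⟨W, V, b, b', t, t', hb, hb', ht⟩ := key n
      have hF : ∀ f : g.i.functor.obj V ⟶ g.jRR.obj Z, f = 0 := fun f => by
        apply (g.adj'.homEquiv _ _).symm.injective
        exact (hjR V).eq_of_src _ _
      have hG : ∀ f : g.j.functor.obj W ⟶ g.jRR.obj Z, f = 0 := fun f => by
        apply (g.adj'.homEquiv _ _).symm.injective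
        have : IsIso (g.adj.unit.app W) := inferInstance
        rw [← cancel_epi (g.adj.unit.app W)]
        exact (hZ W n b b' hb hb' _).trans (hZ W n b b' hb hb' _).symm
      rw [hdec n _ f, ← ht, ← hb', Category.assoc, Category.assoc, hF (t' ≫ f), hG (b ≫ f),
        comp_zero, comp_zero, add_zero]
    have hZ1 : IsZero Z := by
      rw [IsZero.iff_id_eq_zero]
      apply g.jRR.map_injective
      exact hZ0.eq_of_src _ _
    have ha' : q' = 0 := by
      have : IsZero (g.j.functor.obj Z) := g.j.functor.map_isZero hZ1
      exact this.eq_of_tgt _ _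
    rw [ha', zero_comp, zero_add] at hsum'
    exact ⟨Y, ⟨⟨s', p', hsp', hsum'⟩⟩⟩
  · rintro ⟨Z, ⟨e⟩⟩ n f
    obtain ⟨-, Y, -, -, p, s, -, -, hps⟩ := key n
    rw [← hps, ← cancel_mono e.inv, Category.assoc, Category.assoc, zero_comp,
      horth _ _ (s ≫ f ≫ e.inv), comp_zero]
  · obtain ⟨Z, Y, a', q', p', s', haq', hsp', hsum'⟩ := g.triangle_split horth X
    have hY : IsZero (g.i.functor.obj Y) := isZero_of_gen _ fun n f => by
      obtain ⟨W, -, b, b', -, -, -, hb', -⟩ := key n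
      have h3 := h n (f ≫ s') =≫ p'
      rw [Category.assoc, Category.assoc, hsp', Category.comp_id, zero_comp] at h3
      rw [hdec n _ f, h3, zero_add, ← hb', Category.assoc, g.orth _ _ (b ≫ f), comp_zero]
    have hp' : p' = 0 := hY.eq_of_tgt _ _
    rw [hp', zero_comp, add_zero] at hsum'
    exact ⟨Z, ⟨⟨a', q', haq', hsum'⟩⟩⟩

end Gluing

end Decomposition

end

/-! ### Products of complexes and morphisms into products of shifts of the regular module -/

noncomputable section

section Products

open DerivedCategory

/-- Over a finite-dimensional algebra the powers of the regular module are projective. -/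
theorem projective_pi {k : Type u} [Field k] {S : Type u} [Ring S] [Algebra k S]
    [FiniteDimensional k S] (J : Type) : Module.Projective S (J → S) := by
  -- As `S` is finite-dimensional, the canonical map `S ⊗ k^J → S^J` is bijective; so a `k`-basis of
  -- `k^J`, with coordinates viewed in `S`, is an `S`-basis of `S^J`.
  let s := Module.finBasis k S
  let v := Module.Basis.ofVectorSpace k (J → k)
  let Ψ : (_ →₀ S) →ₗ[S] (J → S) := Finsupp.linearCombination S fun β j => algebraMap k S (v β j)
  have hΨ : ∀ x j, Ψ x j = x.sum fun β c => v β j • c := fun x j => by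
    simp only [Ψ, Finsupp.linearCombination_apply, Finsupp.sum, Finset.sum_apply, Pi.smul_apply,
      smul_eq_mul, Algebra.smul_def, Algebra.commutes]
  have h1 : Function.Injective Ψ := by
    rw [injective_iff_map_eq_zero]
    intro x hx
    have h2 : ∀ a, x.mapRange (s.coord a) (map_zero _) = 0 := fun a => by
      have h3 := linearIndependent_iff.1 v.linearIndependent (x.mapRange (s.coord a) (map_zero _))
      refine h3 ?_
      ext j
      have h4 := congrArg (s.coord a) (congrFun hx j)
      rw [hΨ, Pi.zero_apply, map_zero, Finsupp.sum, map_sum] at h4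
      rw [Finsupp.linearCombination_apply, Finsupp.sum_mapRange_index (by simp), Finsupp.sum,
        Finset.sum_apply, Pi.zero_apply, ← h4]
      refine Finset.sum_congr rfl fun β _ => ?_
      rw [map_smul, Pi.smul_apply, smul_eq_mul, smul_eq_mul, mul_comm]
    ext β
    refine s.ext_elem fun a => ?_
    simpa using DFunLike.congr_fun (h2 a) β
  have h2 : Function.Surjective Ψ := fun x => by
    let c : Fin (Module.finrank k S) → (J → k) := fun a j => s.repr (x j) a
    refine ⟨∑ a, (v.repr (c a)).mapRange (fun t => t • s a) (zero_smul _ _), ?_⟩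
    ext j
    rw [map_sum, Finset.sum_apply]
    conv_rhs => rw [← s.sum_repr (x j)]
    refine Finset.sum_congr rfl fun a _ => ?_
    rw [hΨ, Finsupp.sum_mapRange_index (by simp)]
    have h3 := congrFun (v.linearCombination_repr (c a)) j
    rw [Finsupp.linearCombination_apply, Finsupp.sum, Finset.sum_apply] at h3
    change _ = c a j • s a
    rw [← h3, Finset.sum_smul]
    refine Finset.sum_congr rfl fun β _ => ?_
    change v β j • v.repr (c a) β • s a = _
    rw [smul_smul, Pi.smul_apply, smul_eq_mul, mul_comm]
  exact Module.Projective.of_equiv (LinearEquiv.ofBijective Ψ ⟨h1, h2⟩)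

variable {R : Type u} [Ring R]

theorem cycleMap_sub {K : CochainComplex (ModuleCat.{u} R) ℤ} {n : ℤ} (x y : K.X n)
    (hx : (K.d n (n + 1)).hom x = 0) (hy : (K.d n (n + 1)).hom y = 0) :
    cycleMap K n (x - y) (by rw [map_sub, hx, hy, sub_zero]) =
      cycleMap K n x hx - cycleMap K n y hy := by
  rw [cycleMap, cycleMap, cycleMap, ← Functor.map_sub]
  congr 1
  refine single_hom_ext ?_
  rw [cycleHom_f_apply, one_smul]
  change _ = ((cycleHom K n x hx).f n).hom _ - ((cycleHom K n y hy).f n).hom _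
  rw [cycleHom_f_apply, cycleHom_f_apply, one_smul, one_smul]

/-- The long exact sequence shows that no nonzero morphism from a generator reaches the fibre:
injectivity in degree `n` and surjectivity in degree `n - 1` suffice. -/
theorem isIso_of_gen {X Y : DerivedCategory (ModuleCat.{u} R)} (f : X ⟶ Y)
    (h : ∀ (n : ℤ) (x : gen R n ⟶ X), x ≫ f = 0 → x = 0)
    (h' : ∀ (n : ℤ) (y : gen R n ⟶ Y), ∃ x, x ≫ f = y) : IsIso f := by
  obtain ⟨Z, a, b, hT⟩ := distinguished_cocone_triangle₁ f
  change Z ⟶ X at a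
  change Y ⟶ Z⟦(1 : ℤ)⟧ at b
  have haf : a ≫ f = 0 := comp_distTriang_mor_zero₁₂ _ hT
  have hfb : f ≫ b = 0 := comp_distTriang_mor_zero₂₃ _ hT
  have hZ : IsZero Z := isZero_of_gen Z fun n z => by
    have hza : z ≫ a = 0 := h n _ (by rw [Category.assoc, haf, comp_zero])
    obtain ⟨w, hw⟩ := Triangle.coyoneda_exact₁ _ hT (z⟦(1 : ℤ)⟧') (by
      change z⟦(1 : ℤ)⟧' ≫ a⟦(1 : ℤ)⟧' = 0
      rw [← Functor.map_comp, hza, Functor.map_zero])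
    change (gen R n)⟦(1 : ℤ)⟧ ⟶ Y at w
    change z⟦(1 : ℤ)⟧' = w ≫ b at hw
    let ε : (gen R n)⟦(1 : ℤ)⟧ ≅ gen R (n - 1) :=
      ((singleFunctors (ModuleCat.{u} R)).shiftIso 1 (n - 1) n (by omega)).app (ModuleCat.of R R)
    obtain ⟨x, hx⟩ := h' (n - 1) (ε.inv ≫ w)
    have h2 : z⟦(1 : ℤ)⟧' = 0 := by
      rw [hw, ← cancel_epi ε.inv, ← Category.assoc, ← hx, Category.assoc, hfb, comp_zero, comp_zero]
    exact (shiftFunctor (DerivedCategory (ModuleCat.{u} R)) (1 : ℤ)).map_injective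
      (by rw [h2, Functor.map_zero])
  exact (Triangle.isZero₁_iff_isIso₂ _ hT).1 hZ

variable {J : Type} (K : J → CochainComplex (ModuleCat.{u} R) ℤ)

/-- The product of a family of complexes of modules. -/
def prodComplex : CochainComplex (ModuleCat.{u} R) ℤ where
  X n := ModuleCat.of R (∀ j, (K j).X n)
  d m n := ModuleCat.ofHom (LinearMap.pi fun j => ((K j).d m n).hom ∘ₗ LinearMap.proj j)
  shape m n h := by
    ext x j
    change ((K j).d m n).hom ((show ∀ j, (K j).X m from x) j) = 0
    rw [(K j).shape m n h]
    rfl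
  d_comp_d' m n p _ _ := by
    ext x j
    change ((K j).d m n ≫ (K j).d n p).hom ((show ∀ j, (K j).X m from x) j) = 0
    rw [(K j).d_comp_d]
    rfl

variable {K}

/-- The projections of a product of complexes. -/
def prodComplexProj (j : J) : prodComplex K ⟶ K j where
  f n := ModuleCat.ofHom (X := (prodComplex K).X n) (Y := (K j).X n)
    (LinearMap.proj (φ := fun j => (K j).X n) j)

/-- A family of morphisms of complexes induces a morphism to the product. -/
def prodComplexLift {L : CochainComplex (ModuleCat.{u} R) ℤ} (f : ∀ j, L ⟶ K j) :
    L ⟶ prodComplex K where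
  f n := ModuleCat.ofHom (X := L.X n) (Y := (prodComplex K).X n)
    (LinearMap.pi fun j => ((f j).f n).hom)
  comm' m n _ := by
    ext x
    funext j
    exact congrArg (fun g => g.hom x) ((f j).comm m n)

theorem prodComplexLift_proj {L : CochainComplex (ModuleCat.{u} R) ℤ} (f : ∀ j, L ⟶ K j) (j : J) :
    prodComplexLift f ≫ prodComplexProj j = f j := rfl

/-- Products of modules are exact: preimages and bounding elements are chosen in each factor. -/
theorem isIso_Q_map_prod {L : J → CochainComplex (ModuleCat.{u} R) ℤ} (f : ∀ j, K j ⟶ L j)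
    [∀ j, IsIso (Q.map (f j))] :
    IsIso (Q.map (prodComplexLift (K := L) fun j => prodComplexProj j ≫ f j)) := by
  refine isIso_of_gen _ (fun n x hx => ?_) (fun n y => ?_)
  · obtain ⟨x, hx', rfl⟩ := exists_cycleMap x
    obtain ⟨n, rfl⟩ : ∃ m, n = m + 1 := ⟨n - 1, by omega⟩
    rw [cycleMap_comp, cycleMap_eq_zero_iff] at hx
    obtain ⟨y, hy⟩ := hx
    have h : ∀ j, ∃ z, ((K j).d n (n + 1)).hom z = (show ∀ j, (K j).X (n + 1) from x) j := fun j => by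
      have hxj : ((K j).d (n + 1) (n + 1 + 1)).hom ((show ∀ j, (K j).X (n + 1) from x) j) = 0 :=
        congrFun hx' j
      refine (cycleMap_eq_zero_iff (K j) n _ hxj).1 ?_
      rw [← cancel_mono (Q.map (f j)), zero_comp, cycleMap_comp, cycleMap_eq_zero_iff]
      exact ⟨(show ∀ j, (L j).X n from y) j, congrFun hy j⟩
    choose z hz using h
    exact (cycleMap_eq_zero_iff _ n _ hx').2 ⟨z, funext hz⟩
  · obtain ⟨y, hy, rfl⟩ := exists_cycleMap y
    obtain ⟨n, rfl⟩ : ∃ m, n = m + 1 := ⟨n - 1, by omega⟩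
    have h : ∀ j, ∃ (x : (K j).X (n + 1)) (_ : ((K j).d (n + 1) (n + 1 + 1)).hom x = 0)
        (z : (L j).X n), ((L j).d n (n + 1)).hom z =
          ((f j).f (n + 1)).hom x - (show ∀ j, (L j).X (n + 1) from y) j := fun j => by
      have hyj : ((L j).d (n + 1) (n + 1 + 1)).hom ((show ∀ j, (L j).X (n + 1) from y) j) = 0 :=
        congrFun hy j
      obtain ⟨x, hx, hxy⟩ := exists_cycleMap (cycleMap (L j) (n + 1) _ hyj ≫ inv (Q.map (f j)))
      refine ⟨x, hx, ?_⟩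
      rw [IsIso.comp_inv_eq, cycleMap_comp] at hxy
      have hfx : ((L j).d (n + 1) (n + 1 + 1)).hom (((f j).f (n + 1)).hom x) = 0 := by
        change ((f j).f (n + 1) ≫ (L j).d (n + 1) (n + 1 + 1)).hom x = 0
        rw [(f j).comm]
        change ((f j).f _).hom (((K j).d _ _).hom x) = 0
        rw [hx, map_zero]
      refine (cycleMap_eq_zero_iff (L j) n _ (by rw [map_sub, hfx, hyj, sub_zero])).1 ?_
      rw [cycleMap_sub _ _ hfx hyj, ← hxy, sub_self]
    choose x hx z hz using h
    let x' : (prodComplex K).X (n + 1) := x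
    have hx' : ((prodComplex K).d (n + 1) (n + 1 + 1)).hom x' = 0 := funext hx
    refine ⟨cycleMap (prodComplex K) (n + 1) x' hx', ?_⟩
    rw [cycleMap_comp, ← sub_eq_zero, ← cycleMap_sub, cycleMap_eq_zero_iff]
    exact ⟨z, funext hz⟩

end Products

end

/-! ### Finiteness of the image of the regular module under a functor with adjoints -/

noncomputable section

section Finiteness

open DerivedCategory

section

variable {R : Type u} [Ring R]

/-- Every element of `X` is a cycle, so a chain map representing `φ` takes values in boundaries.
Projectivity lifts its components through the differential, and as `X` has zero differential these
lifts form a null-homotopy. No boundedness is needed. -/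
theorem eq_zero_of_cycleMap {X : CochainComplex (ModuleCat.{u} R) ℤ} (hd : ∀ m n, X.d m n = 0)
    (hX : ∀ n, Module.Projective R (X.X n)) {W : DerivedCategory (ModuleCat.{u} R)}
    (φ : Q.obj X ⟶ W)
    (h : ∀ (n : ℤ) (v : X.X n) (hv : (X.d n (n + 1)).hom v = 0), cycleMap X n v hv ≫ φ = 0) :
    φ = 0 := by
  let e : Q.obj (Q.objPreimage W) ≅ W := Q.objObjPreimageIso W
  obtain ⟨W', a, s, hs, ha⟩ := left_fac (φ ≫ e.inv)
  have hφ : φ = Q.map a ≫ inv (Q.map s) ≫ e.hom := by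
    rw [← reassoc_of% ha, e.inv_hom_id, Category.comp_id]
  have h1 : ∀ (n : ℤ) (v : X.X (n + 1)), ∃ w, (W'.d n (n + 1)).hom w = (a.f (n + 1)).hom v :=
    fun n v => by
      have hv : (X.d (n + 1) (n + 1 + 1)).hom v = 0 := by rw [hd]; rfl
      have h2 := h (n + 1) v hv
      rw [hφ, ← Category.assoc, ← Category.assoc] at h2
      have h3 : cycleMap X (n + 1) v hv ≫ Q.map a = 0 := by
        rw [← cancel_mono (inv (Q.map s)), ← cancel_mono e.hom, h2, zero_comp, zero_comp]
      rw [cycleMap_comp] at h3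
      exact (cycleMap_eq_zero_iff W' n _ _).1 h3
  have h2 : ∀ n : ℤ, ∃ t : X.X (n + 1) ⟶ W'.X n, t ≫ W'.d n (n + 1) = a.f (n + 1) := fun n => by
    have := hX (n + 1)
    let b : X.X (n + 1) →ₗ[R] LinearMap.range (W'.d n (n + 1)).hom :=
      (a.f (n + 1)).hom.codRestrict _ (h1 n)
    obtain ⟨t, ht⟩ := Module.projective_lifting_property (W'.d n (n + 1)).hom.rangeRestrict b
      (LinearMap.surjective_rangeRestrict _)
    refine ⟨ModuleCat.ofHom t, ?_⟩
    ext x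
    exact congrArg Subtype.val (LinearMap.congr_fun ht x)
  choose t ht using h2
  rw [hφ, Q_map_eq_zero_of_homotopy (((nonempty_homotopy_zero_iff a).2
    ⟨t, fun i => by rw [hd, zero_comp, zero_add, ht]⟩).some), zero_comp]

/-- In each degree every factor is a retract of `R`, so the product is a retract of a power of `R`.
-/
theorem projective_prodComplex_genComplex {k : Type u} [Field k] [Algebra k R]
    [FiniteDimensional k R] {J : Type} (m : J → ℤ) (n : ℤ) :
    Module.Projective R ((prodComplex fun j => genComplex R (m j)).X n) := by
  have h : ∀ j, ∃ (α : (genComplex R (m j)).X n →ₗ[R] R) (β : R →ₗ[R] (genComplex R (m j)).X n),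
      β ∘ₗ α = LinearMap.id := fun j => by
    by_cases hj : n = m j
    · subst hj
      let e := HomologicalComplex.singleObjXSelf (ComplexShape.up ℤ) (m j) (ModuleCat.of R R)
      exact ⟨e.hom.hom, e.inv.hom, congrArg ModuleCat.Hom.hom e.hom_inv_id⟩
    · have : Subsingleton ((genComplex R (m j)).X n) := ModuleCat.subsingleton_of_isZero
        (HomologicalComplex.isZero_single_obj_X (ComplexShape.up ℤ) (m j) _ _ hj)
      exact ⟨0, 0, LinearMap.ext fun x => Subsingleton.elim _ _⟩
  choose α β hαβ using h
  have := projective_pi (k := k) (S := R) J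
  refine Module.Projective.of_split (M := J → R) (P := ∀ j, (genComplex R (m j)).X n)
    (LinearMap.pi fun j => α j ∘ₗ LinearMap.proj j) (LinearMap.pi fun j => β j ∘ₗ LinearMap.proj j)
    ?_
  refine LinearMap.ext fun x => funext fun j => ?_
  exact LinearMap.congr_fun (hαβ j) (x j)

theorem prodComplex_genComplex_d {J : Type} (m : J → ℤ) (i n : ℤ) :
    (prodComplex fun j => genComplex R (m j)).d i n = 0 := by
  refine ModuleCat.hom_ext (LinearMap.ext fun x => funext fun j => ?_)
  change ((genComplex R (m j)).d i n).hom ((show ∀ j, (genComplex R (m j)).X i from x) j) = 0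
  rw [HomologicalComplex.single_obj_d]
  rfl

/-- Morphisms to the shifts of the regular module factor through a product complex. -/
theorem exists_lift_prodComplex {J : Type} (m : J → ℤ) {T : DerivedCategory (ModuleCat.{u} R)}
    (f : ∀ j, T ⟶ gen R (m j)) :
    ∃ F : T ⟶ Q.obj (prodComplex fun j => genComplex R (m j)),
      ∀ j, F ≫ Q.map (prodComplexProj j) = f j := by
  let e : Q.obj (Q.objPreimage T) ≅ T := Q.objObjPreimageIso T
  -- Each morphism is a fraction with a quasi-isomorphism as denominator; the product of the
  -- denominators is again a quasi-isomorphism.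
  have h := fun j => left_fac (e.hom ≫ f j)
  choose Z a s hs ha using h
  have := isIso_Q_map_prod s
  refine ⟨e.inv ≫ Q.map (prodComplexLift a) ≫
    inv (Q.map (prodComplexLift (K := Z) fun j => prodComplexProj j ≫ s j)), fun j => ?_⟩
  rw [Category.assoc, Category.assoc, e.inv_comp_eq, ha, ← cancel_mono (Q.map (s j)),
    Category.assoc, Category.assoc, Category.assoc, IsIso.inv_hom_id, Category.comp_id,
    ← Q.map_comp, ← prodComplexLift_proj (K := Z) (fun j => prodComplexProj j ≫ s j) j, Q.map_comp,
    IsIso.inv_hom_id_assoc, ← Q.map_comp, prodComplexLift_proj]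

theorem gen_hom_eq_zero {m n : ℤ} (h : m ≠ n) (f : gen R m ⟶ gen R n) : f = 0 := by
  obtain ⟨x, hx, rfl⟩ := exists_cycleMap f
  obtain ⟨m, rfl⟩ : ∃ l, m = l + 1 := ⟨m - 1, by omega⟩
  have : Subsingleton ((genComplex R n).X (m + 1)) := ModuleCat.subsingleton_of_isZero
    (HomologicalComplex.isZero_single_obj_X (ComplexShape.up ℤ) n _ _ h)
  exact (cycleMap_eq_zero_iff _ m x hx).2 ⟨0, Subsingleton.elim _ _⟩

end

variable {k : Type u} [Field k] {R : Type u} [Ring R] [Algebra k R] [FiniteDimensional k R]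

theorem isStrictlyPerfect_genComplex (n : ℤ) : IsStrictlyPerfect (genComplex R n) where
  finite i := by
    by_cases hi : i = n
    · subst hi
      exact Module.Finite.equiv (HomologicalComplex.singleObjXSelf (ComplexShape.up ℤ) i
        (ModuleCat.of R R)).symm.toLinearEquiv
    · have : Subsingleton ((genComplex R n).X i) := ModuleCat.subsingleton_of_isZero
        (HomologicalComplex.isZero_single_obj_X (ComplexShape.up ℤ) n _ _ hi)
      infer_instance
  projective i := by
    by_cases hi : i = n
    · subst hi
      exact Module.Projective.of_equiv (HomologicalComplex.singleObjXSelf (ComplexShape.up ℤ) i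
        (ModuleCat.of R R)).symm.toLinearEquiv
    · have : Subsingleton ((genComplex R n).X i) := ModuleCat.subsingleton_of_isZero
        (HomologicalComplex.isZero_single_obj_X (ComplexShape.up ℤ) n _ _ hi)
      infer_instance
  bounded := ⟨n, 0, inferInstance, by
    rw [Nat.cast_zero, add_zero]
    infer_instance⟩

/-- Over a symmetric algebra, a morphism to a shift of the regular module is zero if it vanishes in
homology. -/
theorem eq_zero_of_comp_gen {t : R →ₗ[k] k} (ht : IsSymmetrizingForm t)
    {X : DerivedCategory (ModuleCat.{u} R)} {n : ℤ} (w : X ⟶ gen R n)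
    (h : ∀ f : gen R n ⟶ X, f ≫ w = 0) : w = 0 := by
  obtain ⟨n, rfl⟩ : ∃ l, n = l + 1 := ⟨n - 1, by omega⟩
  let e : Q.obj (Q.objPreimage X) ≅ X := Q.objObjPreimageIso X
  -- Self-injectivity of `R` is used twice: to represent `w` by a chain map, and to build a
  -- null-homotopy. The chain map kills cycles, hence factors through the image of the differential,
  -- and this factorization extends to the next degree.
  have hI := (isStrictlyPerfect_genComplex (R := R) (n + 1)).isKInjective ht
  obtain ⟨a, ha⟩ := Q_map_surjective_of_isKInjective _ _ (e.hom ≫ w)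
  let K := Q.objPreimage X
  have h1 : ∀ x, (K.d (n + 1) (n + 1 + 1)).hom x = 0 → (a.f (n + 1)).hom x = 0 := fun x hx => by
    have h2 := h (cycleMap K (n + 1) x hx ≫ e.hom)
    rw [Category.assoc, ← ha, cycleMap_comp, cycleMap_eq_zero_iff] at h2
    obtain ⟨y, hy⟩ := h2
    rw [← hy, HomologicalComplex.single_obj_d]
    rfl
  have hi : Injective ((genComplex R (n + 1)).X (n + 1)) := by
    have hP := isStrictlyPerfect_genComplex (R := R) (n + 1)
    have := hP.projective (n + 1)
    have := hP.finite (n + 1)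
    exact injective_of_symmetrizingForm (FinDualBasis.nonempty _).some ht
  let D := (K.d (n + 1) (n + 1 + 1)).hom
  have hker : LinearMap.ker D ≤ LinearMap.ker (a.f (n + 1)).hom := fun x hx => h1 x hx
  let b : ModuleCat.of R (LinearMap.range D) ⟶ (genComplex R (n + 1)).X (n + 1) :=
    ModuleCat.ofHom ((LinearMap.ker D).liftQ _ hker ∘ₗ D.quotKerEquivRange.symm.toLinearMap)
  let ι : ModuleCat.of R (LinearMap.range D) ⟶ K.X (n + 1 + 1) :=
    ModuleCat.ofHom (LinearMap.range D).subtype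
  have hι : Mono ι := (ModuleCat.mono_iff_injective _).2 Subtype.val_injective
  have hD : K.d (n + 1) (n + 1 + 1) ≫ Injective.factorThru b ι = a.f (n + 1) := by
    have h3 := Injective.comp_factorThru b ι
    ext x
    have h4 := congrArg (fun g => g.hom ⟨D x, x, rfl⟩) h3
    refine h4.trans ?_
    change (LinearMap.ker D).liftQ _ hker (D.quotKerEquivRange.symm ⟨D x, x, rfl⟩) = _
    have h5 : D.quotKerEquivRange.symm ⟨D x, x, rfl⟩ = (LinearMap.ker D).mkQ x :=
      D.quotKerEquivRange_symm_apply_image x _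
    rw [h5]
    rfl
  have ha0 : Q.map a = 0 := by
    refine Q_map_eq_zero_of_homotopy ((nonempty_homotopy_zero_iff a).2
      ⟨fun i => if hi : i = n + 1 then eqToHom (by rw [hi]) ≫ Injective.factorThru b ι ≫
        eqToHom (by rw [hi]) else 0, fun i => ?_⟩).some
    rw [HomologicalComplex.single_obj_d, comp_zero, add_zero]
    by_cases hi : i = n
    · subst hi
      simpa using hD.symm
    · exact (HomologicalComplex.isZero_single_obj_X (ComplexShape.up ℤ) (n + 1) _ _
        (by omega)).eq_of_tgt _ _
  rw [← cancel_epi e.hom, ← ha, ha0, comp_zero]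

theorem gen_hom_finite (m n : ℤ) : Module.Finite k (gen R m ⟶ gen R n) := by
  by_cases h : m = n
  · subst h
    let G : R →ₗ[k] (gen R m ⟶ gen R m) :=
      { toFun := genMul m
        map_add' := genMul_add m
        map_smul' := fun c x => by
          rw [RingHom.id_apply, genMul, genMul, ← Functor.map_smul]
          congr 1
          let _ : SMul k (ModuleCat.of R R ⟶ ModuleCat.of R R) := (Linear.homModule _ _).toSMul
          have h1 : ModuleCat.ofHom (LinearMap.toSpanSingleton R R (c • x)) =
              c • ModuleCat.ofHom (LinearMap.toSpanSingleton R R x) := by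
            ext
            have h2 : (c • ModuleCat.ofHom (LinearMap.toSpanSingleton R R x)).hom (1 : R) =
              algebraMap k R c • LinearMap.toSpanSingleton R R x 1 := rfl
            rw [h2]
            simp [Algebra.smul_def]
          refine HomologicalComplex.from_single_hom_ext ?_
          rw [HomologicalComplex.smul_f_apply, HomologicalComplex.single_map_f_self,
            HomologicalComplex.single_map_f_self, h1]
          simp only [Linear.smul_comp, Linear.comp_smul] }
    refine Module.Finite.of_surjective G fun f => ?_
    obtain ⟨g, rfl⟩ := (singleFunctor (ModuleCat.{u} R) m).map_surjective f
    refine ⟨g.hom (1 : R), ?_⟩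
    change genMul m _ = _
    rw [← singleFunctor_map_genMul]
    congr 1
    ext
    simp
  · have : Subsingleton (gen R m ⟶ gen R n) :=
      ⟨fun f g => (gen_hom_eq_zero h f).trans (gen_hom_eq_zero h g).symm⟩
    infer_instance

variable {S : Type u} [Ring S] [Algebra k S] [FiniteDimensional k S]
  {iL : DerivedCategory (ModuleCat.{u} R) ⥤ DerivedCategory (ModuleCat.{u} S)}
  {i : DerivedCategory (ModuleCat.{u} S) ⥤ DerivedCategory (ModuleCat.{u} R)}
  {iR : DerivedCategory (ModuleCat.{u} R) ⥤ DerivedCategory (ModuleCat.{u} S)}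

/-- A family of morphisms from the regular module to the images of shifts of the regular
module factors through a finite family. -/
theorem exists_finite_factorization {t : R →ₗ[k] k} (ht : IsSymmetrizingForm t) [i.Linear k]
    [i.Additive] (adjL : iL ⊣ i) (adjR : i ⊣ iR) {J : Type} (m : J → ℤ)
    (f : ∀ j, gen R 0 ⟶ i.obj (gen S (m j))) :
    ∃ (Λ : Type (u + 1)) (I : Finset Λ) (n : Λ → ℤ) (h : ∀ l, gen R 0 ⟶ i.obj (gen S (n l))),
      ∀ j, ∃ x : ∀ l, gen S (n l) ⟶ gen S (m j), f j = ∑ l ∈ I, h l ≫ i.map (x l) := by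
  -- The left adjoint turns the family into one with common source `iL R`, which lifts to the
  -- product and returns as a single morphism `F'` from `R`.
  obtain ⟨F, hF⟩ := exists_lift_prodComplex m fun j => (adjL.homEquiv _ _).symm (f j)
  let X := prodComplex fun j => genComplex S (m j)
  let Y : DerivedCategory (ModuleCat.{u} R) := i.obj (Q.obj X)
  let F' : gen R 0 ⟶ Y := adjL.homEquiv _ _ F
  have hF' : ∀ j, F' ≫ i.map (Q.map (prodComplexProj j)) = f j := fun j => by
    rw [← adjL.homEquiv_naturality_right, hF, Equiv.apply_symm_apply]
  let Λ := (n : ℤ) × (gen R 0 ⟶ i.obj (gen S n)) × (gen S n ⟶ Q.obj X)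
  let v : Λ → (gen R 0 ⟶ Y) := fun l => l.2.1 ≫ i.map l.2.2
  let U : Submodule k (gen R 0 ⟶ Y) := Submodule.span k (Set.range v)
  obtain ⟨σ, hσ⟩ := (isStrictlyPerfect_genComplex (R := R) 0).exists_duality ht
  -- Duality represents all functionals on a finite-dimensional endomorphism space; by dimension,
  -- the representing endomorphism is unique.
  have hσ' : ∀ x : gen R 0 ⟶ gen R 0, (∀ y, σ (y ≫ x) = 0) → x = 0 := by
    have := gen_hom_finite (k := k) (R := R) 0 0
    let B : (gen R 0 ⟶ gen R 0) →ₗ[k] Module.Dual k (gen R 0 ⟶ gen R 0) :=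
      { toFun := fun x => σ ∘ₗ Linear.rightComp k _ x
        map_add' := fun x y => LinearMap.ext fun z =>
          (congrArg σ (Preadditive.comp_add _ _ _ z x y)).trans (map_add σ _ _)
        map_smul' := fun c x => LinearMap.ext fun z =>
          (congrArg σ (Linear.comp_smul _ _ _ z c x)).trans (map_smul σ _ _) }
    have hB : Function.Surjective B := fun l => by
      obtain ⟨g, hg⟩ := hσ _ l
      exact ⟨g, LinearMap.ext fun y => (hg y).symm⟩
    have hB' := (LinearMap.injective_iff_surjective_of_finrank_eq_finrank
      (Subspace.dual_finrank_eq (K := k) (V := gen R 0 ⟶ gen R 0)).symm).2 hB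
    exact fun x hx => hB' ((LinearMap.ext fun y => hx y : B x = 0).trans (map_zero B).symm)
  -- Otherwise a functional that kills `U` but not `F'` is represented by some `g : Y ⟶ R`, and such
  -- a `g` turns out to be zero.
  have hU : F' ∈ U := by
    by_contra hFU
    obtain ⟨l, hl, hlU⟩ := Submodule.exists_le_ker_of_notMem hFU
    obtain ⟨g, hg⟩ := hσ Y l
    have hg0 : g = 0 := by
      apply (adjR.homAddEquiv _ _).injective
      rw [map_zero, Adjunction.homAddEquiv_apply]
      -- Through the right adjoint, `g` becomes a morphism out of the product complex, which has
      -- zero differential and projective components, so cycles detect it.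
      refine eq_zero_of_cycleMap (prodComplex_genComplex_d m)
        (projective_prodComplex_genComplex (k := k) m) _ fun n w hw => ?_
      rw [← adjR.homEquiv_naturality_left]
      -- A morphism to the regular module is tested on homology, and an endomorphism of the regular
      -- module by `σ`; the resulting values are those of `l` on generators of `U`.
      have h1 : i.map (cycleMap X n w hw) ≫ g = 0 := eq_zero_of_comp_gen ht _ fun h =>
        hσ' _ fun y => by
          have h2 := hlU (Submodule.subset_span ⟨⟨n, y ≫ h, cycleMap X n w hw⟩, rfl⟩ :
            (y ≫ h) ≫ i.map (cycleMap X n w hw) ∈ U)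
          rw [LinearMap.mem_ker, hg] at h2
          rw [← h2]
          simp only [Category.assoc]
      rw [h1]
      exact map_zero (adjR.homAddEquiv _ _)
    exact hl (by rw [hg, hg0, comp_zero, map_zero])
  obtain ⟨c, hc⟩ := Finsupp.mem_span_range_iff_exists_finsupp.1 hU
  refine ⟨Λ, c.support, fun l => l.1, fun l => l.2.1, fun j =>
    ⟨fun l => c l • l.2.2 ≫ Q.map (prodComplexProj j), ?_⟩⟩
  rw [← hF', ← hc, Finsupp.sum, Preadditive.sum_comp]
  refine Finset.sum_congr rfl fun l _ => ?_
  simp only [v, Linear.smul_comp, i.map_smul, i.map_comp, Linear.comp_smul, Category.assoc]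

theorem finite_setOf_hom_ne_zero {t : R →ₗ[k] k} (ht : IsSymmetrizingForm t) [i.Linear k]
    [i.Additive] (adjL : iL ⊣ i) (adjR : i ⊣ iR) :
    {m : ℤ | ∃ f : gen R 0 ⟶ i.obj (gen S m), f ≠ 0}.Finite := by
  by_contra hinf
  let m := Set.Infinite.natEmbedding _ hinf
  choose f hf using fun j => (m j).2
  obtain ⟨Λ, I, n, h, hx⟩ := exists_finite_factorization ht adjL adjR (fun j => (m j).1) f
  have h1 : ∀ j, ∃ l ∈ I, n l = (m j).1 := fun j => by
    by_contra hj
    push Not at hj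
    obtain ⟨x, hx⟩ := hx j
    refine hf j (hx.trans (Finset.sum_eq_zero fun l hl => ?_))
    rw [gen_hom_eq_zero (hj l hl) (x l), i.map_zero, comp_zero]
  have h2 : Set.range (fun j => (m j).1) ⊆ n '' I := by
    rintro _ ⟨j, rfl⟩
    obtain ⟨l, hl, hj⟩ := h1 j
    exact ⟨l, hl, hj⟩
  exact Set.infinite_range_of_injective (f := fun j => (m j).1)
    (Subtype.val_injective.comp m.injective) ((I.finite_toSet.image n).subset h2)

/-- The same factorization, for a constant degree, would put infinitely many linearly independent
morphisms into the image of a finite-dimensional space. -/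
theorem finite_hom_gen {t : R →ₗ[k] k} (ht : IsSymmetrizingForm t) [i.Linear k]
    [i.Additive] (adjL : iL ⊣ i) (adjR : i ⊣ iR) (m : ℤ) :
    Module.Finite k (gen R 0 ⟶ i.obj (gen S m)) := by
  by_contra hinf
  let b := Module.Basis.ofVectorSpace k (gen R 0 ⟶ i.obj (gen S m))
  have h1 : Infinite (Module.Basis.ofVectorSpaceIndex k (gen R 0 ⟶ i.obj (gen S m))) := by
    by_contra hfin
    rw [not_infinite_iff_finite] at hfin
    exact hinf (Module.Finite.of_basis b)
  let ν := Infinite.natEmbedding (Module.Basis.ofVectorSpaceIndex k (gen R 0 ⟶ i.obj (gen S m)))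
  obtain ⟨Λ, I, n, h, hx⟩ := exists_finite_factorization ht adjL adjR (fun _ : ℕ => m)
    fun j => b (ν j)
  have h2 : ∀ n, Module.Finite k (gen S n ⟶ gen S m) := fun n => gen_hom_finite n m
  let G : (∀ l : I, gen S (n l) ⟶ gen S m) →ₗ[k] (gen R 0 ⟶ i.obj (gen S m)) :=
    ∑ l : I, (Linear.leftComp k _ (h l) ∘ₗ Functor.mapLinearMap k i) ∘ₗ LinearMap.proj l
  have h3 : ∀ j, b (ν j) ∈ LinearMap.range G := fun j => by
    obtain ⟨x, hx⟩ := hx j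
    refine ⟨fun l => x l, ?_⟩
    rw [hx, ← Finset.sum_coe_sort, LinearMap.sum_apply]
    rfl
  let w : ℕ → LinearMap.range G := fun j => ⟨b (ν j), h3 j⟩
  have hw : LinearIndependent k w := by
    refine LinearIndependent.of_comp (LinearMap.range G).subtype ?_
    exact b.linearIndependent.comp ν ν.injective
  have := hw.finite_of_isNoetherian
  exact not_finite ℕ

end Finiteness

end

/-! ### Perfect objects -/

noncomputable section

section Perfect

open DerivedCategory

section

variable {R : Type u} [Ring R]

/-- An object of the derived category is perfect if it is isomorphic to a bounded complex of
finitely generated projective modules. -/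
def IsPerfect (X : DerivedCategory (ModuleCat.{u} R)) : Prop :=
  ∃ P, IsStrictlyPerfect P ∧ Nonempty (Q.obj P ≅ X)

theorem IsStrictlyPerfect.mappingCocone {P P' : CochainComplex (ModuleCat.{u} R) ℤ}
    (hP : IsStrictlyPerfect P) (hP' : IsStrictlyPerfect P') (f : P ⟶ P') :
    IsStrictlyPerfect (CochainComplex.mappingCocone f) := by
  have e : ∀ i, Nonempty ((CochainComplex.mappingCocone f).X i ≃ₗ[R]
      P.X (i + (-1) + 1) × P'.X (i + (-1))) := fun i =>
    ⟨(HomologicalComplex.homotopyCofiber.XIsoBiprod f (i + (-1)) (i + (-1) + 1) rfl ≪≫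
      ModuleCat.biprodIsoProd _ _).toLinearEquiv⟩
  refine ⟨fun i => ?_, fun i => ?_, ?_⟩
  · have := hP.finite (i + (-1) + 1)
    have := hP'.finite (i + (-1))
    exact Module.Finite.equiv (e i).some.symm
  · have := hP.projective (i + (-1) + 1)
    have := hP'.projective (i + (-1))
    exact Module.Projective.of_equiv (e i).some.symm
  · obtain ⟨a, n, h1, h2⟩ := hP.bounded
    obtain ⟨a', n', h1', h2'⟩ := hP'.bounded
    have h : ∀ i, (i < min a a' ∨ max (a + n) (a' + n') + 1 < i) →
        IsZero ((CochainComplex.mappingCocone f).X i) := fun i hi => by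
      refine (CochainComplex.mappingCone.isZero_X_iff f (i + (-1))).2 ⟨?_, ?_⟩
      · rcases hi with hi | hi
        · exact P.isZero_of_isStrictlyGE a _ (by omega)
        · exact P.isZero_of_isStrictlyLE (a + n) _ (by omega)
      · rcases hi with hi | hi
        · exact P'.isZero_of_isStrictlyGE a' _ (by omega)
        · exact P'.isZero_of_isStrictlyLE (a' + n') _ (by omega)
    refine ⟨min a a', (max (a + n) (a' + n') + 1 - min a a').toNat, ?_, ?_⟩
    · exact (CochainComplex.isStrictlyGE_iff _ _).2 fun i hi => h i (Or.inl hi)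
    · exact (CochainComplex.isStrictlyLE_iff _ _).2 fun i hi => h i (Or.inr (by omega))

theorem isStrictlyPerfect_single {M : ModuleCat.{u} R} [Module.Finite R M] [Module.Projective R M]
    (n : ℤ) : IsStrictlyPerfect
      ((HomologicalComplex.single (ModuleCat.{u} R) (ComplexShape.up ℤ) n).obj M) where
  finite i := by
    by_cases hi : i = n
    · subst hi
      exact Module.Finite.equiv
        (HomologicalComplex.singleObjXSelf (ComplexShape.up ℤ) i M).symm.toLinearEquiv
    · have := ModuleCat.subsingleton_of_isZero
        (HomologicalComplex.isZero_single_obj_X (ComplexShape.up ℤ) n M _ hi)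
      infer_instance
  projective i := by
    by_cases hi : i = n
    · subst hi
      exact Module.Projective.of_equiv
        (HomologicalComplex.singleObjXSelf (ComplexShape.up ℤ) i M).symm.toLinearEquiv
    · have := ModuleCat.subsingleton_of_isZero
        (HomologicalComplex.isZero_single_obj_X (ComplexShape.up ℤ) n M _ hi)
      infer_instance
  bounded := ⟨n, 0, inferInstance, by
    rw [Nat.cast_zero, add_zero]
    infer_instance⟩

/-- The morphism between the perfect objects is represented by a chain map, because strictly perfect
complexes are K-projective; its mapping cocone then represents `X`. -/
theorem IsPerfect.of_distinguished {X Y Z : DerivedCategory (ModuleCat.{u} R)} {f : X ⟶ Y}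
    {g : Y ⟶ Z} {h : Z ⟶ X⟦(1 : ℤ)⟧} (hT : Triangle.mk f g h ∈ distTriang _) (hY : IsPerfect Y)
    (hZ : IsPerfect Z) : IsPerfect X := by
  obtain ⟨P, hP, ⟨e⟩⟩ := hY
  obtain ⟨P', hP', ⟨e'⟩⟩ := hZ
  have := hP.isKProjective
  obtain ⟨a, ha⟩ := Q_map_surjective_of_isKProjective P P' (e.hom ≫ g ≫ e'.inv)
  refine ⟨_, hP.mappingCocone hP' a, ⟨?_⟩⟩
  exact (shiftFunctor _ (1 : ℤ)).preimageIso (Triangle.π₃.mapIso (isoTriangleOfIso₁₂ _ _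
    (rot_of_distTriang _ (mappingCocone_triangle_distinguished a)) (rot_of_distTriang _ hT) e e'
    (by
      change Q.map a ≫ e'.hom = e.hom ≫ g
      rw [ha, Category.assoc, Category.assoc, e'.inv_hom_id, Category.comp_id])))

theorem isZero_homology_of_gen {X : DerivedCategory (ModuleCat.{u} R)} {n : ℤ}
    (h : ∀ f : gen R n ⟶ X, f = 0) : IsZero ((homologyFunctor (ModuleCat.{u} R) n).obj X) := by
  obtain ⟨n, rfl⟩ : ∃ m, n = m + 1 := ⟨n - 1, by omega⟩
  let K := Q.objPreimage X
  have e : Q.obj K ≅ X := Q.objObjPreimageIso X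
  refine IsZero.of_iso ?_ ((homologyFunctor (ModuleCat.{u} R) (n + 1)).mapIso e.symm ≪≫
    (homologyFunctorFactors _ _).app K)
  rw [HomologicalComplex.homologyFunctor_obj, ← HomologicalComplex.exactAt_iff_isZero_homology,
    HomologicalComplex.exactAt_iff' _ n (n + 1) (n + 1 + 1) (by simp) (by simp),
    ShortComplex.moduleCat_exact_iff]
  intro x hx
  exact (cycleMap_eq_zero_iff K n x hx).1 (by
    rw [← cancel_mono e.hom, zero_comp]
    exact h _)

/-- The shifts of the regular module. -/
def genShift (R : Type u) [Ring R] (n s m : ℤ) (h : s + m = n := by omega) :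
    (gen R n)⟦s⟧ ≅ gen R m :=
  ((singleFunctors (ModuleCat.{u} R)).shiftIso s m n h).app (ModuleCat.of R R)

theorem hom_shift_eq_zero {C : Type*} [Category C] [Preadditive C] [HasShift C ℤ]
    [∀ n : ℤ, (shiftFunctor C n).Additive] {X Y X' Y' : C} (s : ℤ) (e : X⟦s⟧ ≅ X') (e' : Y⟦s⟧ ≅ Y')
    (h : ∀ f : X' ⟶ Y', f = 0) (f : X ⟶ Y) : f = 0 := by
  apply (shiftFunctor C s).map_injective
  rw [← cancel_epi e.inv, ← cancel_mono e'.hom, h ((e.inv ≫ _) ≫ _), Functor.map_zero, comp_zero,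
    zero_comp]

/-- Modules without self-extensions in large degrees are projective. -/
def SharpHom (R : Type u) [Ring R] : Prop :=
  ∀ M : ModuleCat.{u} R, Module.Finite R M →
    (∃ N : ℤ, ∀ n, N ≤ n → ∀ f : (singleFunctor (ModuleCat.{u} R) 0).obj M ⟶
      ((singleFunctor (ModuleCat.{u} R) 0).obj M)⟦n⟧, f = 0) → Module.Projective R M

/-- Self-extensions are morphisms to shifts in the derived category; if they vanish from `N` on, the
nonzero ones occupy only finitely many degrees. -/
theorem SatisfiesSharp.sharpHom {A : Type u} [Ring A] (h : SatisfiesSharp A) :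
    SharpHom Aᵐᵒᵖ := by
  intro M hM hN
  by_contra hP
  obtain ⟨N, hN⟩ := hN
  refine h M hM hP ((Set.finite_le_nat N.toNat).subset fun n hn => ?_)
  by_contra hn'
  have hn2 : N ≤ (n : ℤ) := by
    have : ¬ n ≤ N.toNat := hn'
    omega
  have : Nontrivial (Abelian.Ext M M n) := hn
  obtain ⟨x, hx⟩ := exists_ne (0 : Abelian.Ext M M n)
  refine hx ((Abelian.Ext.homEquiv).injective ?_)
  exact (hN n hn2 _).trans (hN n hn2 _).symm

end

variable {k : Type u} [Field k] {R : Type u} [Ring R] [Algebra k R]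

theorem module_finite_of_hom_gen {M : ModuleCat.{u} R} (n : ℤ)
    (h : Module.Finite k (gen R n ⟶ (singleFunctor (ModuleCat.{u} R) n).obj M)) :
    Module.Finite R M := by
  have h' : Module.Finite k ((singleFunctor (ModuleCat.{u} R) n).obj (ModuleCat.of R R) ⟶
    (singleFunctor (ModuleCat.{u} R) n).obj M) := h
  have h1 : Module.Finite k (ModuleCat.of R R ⟶ M) :=
    Module.Finite.of_injective (Functor.mapLinearMap k (singleFunctor (ModuleCat.{u} R) n)
      (X := ModuleCat.of R R) (Y := M)) (singleFunctor (ModuleCat.{u} R) n).map_injective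
  obtain ⟨s, hs⟩ := h1
  classical
  refine ⟨⟨s.image fun f => f.hom (1 : R), ?_⟩⟩
  rw [eq_top_iff]
  rintro x -
  have h2 : ∀ f ∈ Submodule.span k (s : Set (ModuleCat.of R R ⟶ M)),
      f.hom (1 : R) ∈ Submodule.span R ((s.image fun f => f.hom (1 : R) : Finset M) : Set M) := by
    intro f hf
    induction hf using Submodule.span_induction with
    | mem f hf => exact Submodule.subset_span (Finset.mem_image_of_mem _ hf)
    | zero => exact Submodule.zero_mem _
    | add f g _ _ hf hg => exact Submodule.add_mem _ hf hg
    | smul c f _ hf => exact Submodule.smul_mem _ (algebraMap k R c) hf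
  have h3 := h2 (ModuleCat.ofHom (LinearMap.toSpanSingleton R M x)) (by rw [hs]; trivial)
  simpa using h3

/-- Such an object is a shifted module, finitely generated by `hfin` and without self-extensions in
large degrees, hence projective by `hR`. -/
theorem isPerfect_of_concentrated (hR : SharpHom R) {Y : DerivedCategory (ModuleCat.{u} R)} {a : ℤ}
    (hfin : Module.Finite k (gen R a ⟶ Y)) (h0 : ∀ n, n ≠ a → ∀ f : gen R n ⟶ Y, f = 0)
    (hext : ∃ N : ℤ, ∀ n, N ≤ n → ∀ f : Y ⟶ Y⟦n⟧, f = 0) : IsPerfect Y := by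
  have h1 : Y.IsGE a := (isGE_iff Y a).2 fun i hi => isZero_homology_of_gen (h0 i (by omega))
  have h2 : Y.IsLE a := (isLE_iff Y a).2 fun i hi => isZero_homology_of_gen (h0 i (by omega))
  obtain ⟨M, ⟨e⟩⟩ := exists_iso_singleFunctor_obj_of_isGE_of_isLE Y a
  have hM : Module.Finite R M := module_finite_of_hom_gen (k := k) a
    (Module.Finite.of_surjective (Linear.rightComp k (gen R a) e.hom) fun f =>
      ⟨f ≫ e.inv, by
        change (f ≫ e.inv) ≫ e.hom = f
        rw [Category.assoc, e.inv_hom_id, Category.comp_id]⟩)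
  have hP : Module.Projective R M := by
    refine hR M hM ?_
    obtain ⟨N, hN⟩ := hext
    refine ⟨N, fun n hn => hom_shift_eq_zero (-a) (X' := Y) (Y' := Y⟦n⟧) ?_ ?_ (hN n hn)⟩
    · exact ((singleFunctors (ModuleCat.{u} R)).shiftIso (-a) a 0 (by omega)).app M ≪≫ e.symm
    · exact shiftComm _ _ _ ≪≫ (shiftFunctor _ n).mapIso
        (((singleFunctors (ModuleCat.{u} R)).shiftIso (-a) a 0 (by omega)).app M ≪≫ e.symm)
  exact ⟨_, isStrictlyPerfect_single (M := M) a, ⟨e.symm⟩⟩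

end Perfect

end

/-! ### Perfection of bounded objects without high self-extensions. -/

noncomputable section

section Perfect

open DerivedCategory

variable {k : Type u} [Field k] {R : Type u} [Ring R] [Algebra k R] [FiniteDimensional k R]

/-- Over a symmetric algebra with the property `SharpHom`, an object with bounded finite-dimensional
homology and without self-extensions in large degrees is perfect. -/
theorem isPerfect_of_bounded {t : R →ₗ[k] k} (ht : IsSymmetrizingForm t) (hR : SharpHom R) (a : ℤ)
    (d : ℕ) : ∀ (r : ℕ) (Y : DerivedCategory (ModuleCat.{u} R)),
      (∀ n, Module.Finite k (gen R n ⟶ Y)) → (∀ n, n < a ∨ a + d < n → ∀ f : gen R n ⟶ Y, f = 0) →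
      (∃ N : ℤ, ∀ n, N ≤ n → ∀ f : Y ⟶ Y⟦n⟧, f = 0) → Module.finrank k (gen R (a + d) ⟶ Y) = r →
      IsPerfect Y := by
  induction d with
  | zero =>
    intro r Y hfin h0 hext _
    exact isPerfect_of_concentrated hR (hfin a) (fun n hn => h0 n (by omega)) hext
  | succ d ihd =>
    intro r
    induction r using Nat.strong_induction_on with
    | _ r ihr =>
    intro Y hfin h0 hext hr
    set b : ℤ := a + (d + 1 : ℕ) with hb
    -- Without homology in the top degree `b` the amplitude drops. Otherwise the cone of a nonzero
    -- class `y` has smaller homology in degree `b`.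
    by_cases hy : ∀ y : gen R b ⟶ Y, y = 0
    · refine ihd _ Y hfin (fun n hn f => ?_) hext rfl
      by_cases hn' : n = b
      · subst hn'
        exact hy f
      · exact h0 n (by omega) f
    · push Not at hy
      obtain ⟨y, hy⟩ := hy
      obtain ⟨Y', g, h, hT⟩ := distinguished_cocone_triangle y
      let ε : (gen R b)⟦(1 : ℤ)⟧ ≅ gen R (b - 1) := genShift R b 1 (b - 1)
      have hyg : y ≫ g = 0 := comp_distTriang_mor_zero₁₂ _ hT
      have hlift : ∀ {Z : DerivedCategory (ModuleCat.{u} R)} (f : Z ⟶ Y') (_ : f ≫ h = 0),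
          ∃ f' : Z ⟶ Y, f = f' ≫ g := fun f hf => Triangle.coyoneda_exact₃ _ hT f hf
      have hne : ∀ n, n ≠ b - 1 → ∀ f : gen R n ⟶ (gen R b)⟦(1 : ℤ)⟧, f = 0 := fun n hn f => by
        rw [← cancel_mono ε.hom, zero_comp]
        exact gen_hom_eq_zero hn _
      -- The cone can gain homology only in degree `b - 1 = a + d`, which still lies in the
      -- interval.
      have h0' : ∀ n, n < a ∨ b < n → ∀ f : gen R n ⟶ Y', f = 0 := fun n hn f => by
        obtain ⟨f', rfl⟩ := hlift f (hne n (by omega) _)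
        rw [h0 n hn f', zero_comp]
      have hY : ∀ n, n < a → ∀ f : Y ⟶ gen R n, f = 0 := fun n hn f =>
        eq_zero_of_comp_gen ht f fun f' => by rw [h0 n (Or.inl hn) f', zero_comp]
      have hfin' : ∀ n, Module.Finite k (gen R n ⟶ Y') := fun n => by
        have h1 : Module.Finite k (gen R n ⟶ (gen R b)⟦(1 : ℤ)⟧) := by
          have := gen_hom_finite (k := k) (R := R) n (b - 1)
          exact Module.Finite.of_surjective (Linear.rightComp k (gen R n) ε.inv) fun f =>
            ⟨f ≫ ε.hom, by
              change (f ≫ ε.hom) ≫ ε.inv = f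
              rw [Category.assoc, ε.hom_inv_id, Category.comp_id]⟩
        have := hfin n
        have h2 : Module.Finite k (LinearMap.ker (Linear.rightComp k (gen R n) h)) := by
          let G : (gen R n ⟶ Y) →ₗ[k] LinearMap.ker (Linear.rightComp k (gen R n) h) :=
            (Linear.rightComp k (gen R n) g).codRestrict _ fun f => by
              change (f ≫ g) ≫ h = 0
              have hgh : g ≫ h = 0 := comp_distTriang_mor_zero₂₃ _ hT
              rw [Category.assoc, hgh, comp_zero]
          refine Module.Finite.of_surjective G fun f => ?_
          obtain ⟨f', hf'⟩ := hlift f.1 f.2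
          exact ⟨f', Subtype.ext hf'.symm⟩
        have h3 : Module.Finite k ((gen R n ⟶ Y') ⧸
            LinearMap.ker (Linear.rightComp k (gen R n) h)) :=
          Module.Finite.equiv (LinearMap.quotKerEquivRange _).symm
        exact Module.Finite.of_submodule_quotient
          (LinearMap.ker (Linear.rightComp k (gen R n) h))
      have hrank : Module.finrank k (gen R b ⟶ Y') < r := by
        let G : (gen R b ⟶ Y) →ₗ[k] (gen R b ⟶ Y') := Linear.rightComp k (gen R b) g
        have hG : Function.Surjective G := fun f => by
          obtain ⟨f', rfl⟩ := hlift f (hne b (by omega) _)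
          exact ⟨f', rfl⟩
        have := hfin b
        have h1 := G.finrank_range_add_finrank_ker
        rw [LinearMap.range_eq_top.2 hG, finrank_top, hr] at h1
        have h2 : 0 < Module.finrank k (LinearMap.ker G) := by
          have : Nontrivial (LinearMap.ker G) :=
            ⟨⟨⟨y, hyg⟩, 0, fun h => hy (congrArg Subtype.val h)⟩⟩
          exact Module.finrank_pos
        omega
      refine IsPerfect.of_distinguished (rot_of_distTriang _ hT)
        (ihr _ hrank Y' hfin' h0' ?_ rfl) ⟨_, isStrictlyPerfect_genComplex (b - 1), ⟨ε.symm⟩⟩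
      obtain ⟨N, hN⟩ := hext
      -- Three bounds are needed: `N` for the self-extensions of `Y`, `n > d` so that the degree `b
      -- - n - 1` lies below `a`, and `n ≥ 2` so that the degree `b - 1 + n` lies above `b`. First
      -- `g ≫ f` is lifted to a self-extension of `Y` and so vanishes; then `f` factors through a
      -- shift of the regular module.
      refine ⟨max N (d + 2), fun n hn f => ?_⟩
      have h1 : g ≫ f = 0 := by
        obtain ⟨f', hf'⟩ : ∃ f' : Y ⟶ Y⟦n⟧, g ≫ f = f' ≫ (n.negOnePow • g⟦n⟧') :=
          Triangle.coyoneda_exact₃ _ (Triangle.shift_distinguished _ hT n) (g ≫ f) (by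
            let ε' : ((gen R b)⟦n⟧)⟦(1 : ℤ)⟧ ≅ gen R (b - n - 1) :=
              (shiftFunctor _ (1 : ℤ)).mapIso (genShift R b n (b - n)) ≪≫ genShift R (b - n) 1 _
            have hz : ∀ w : Y ⟶ ((gen R b)⟦n⟧)⟦(1 : ℤ)⟧, w = 0 := fun w => by
              rw [← cancel_mono ε'.hom, zero_comp]
              exact hY _ (by omega) _
            exact hz _)
        rw [hf', hN n (by omega) f', zero_comp]
      obtain ⟨f', hf'⟩ : ∃ f' : (gen R b)⟦(1 : ℤ)⟧ ⟶ Y'⟦n⟧, f = h ≫ f' :=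
        Triangle.yoneda_exact₃ _ hT f h1
      rw [hf', hom_shift_eq_zero (-n) (genShift R (b - 1) (-n) (b - 1 + n) |> fun e =>
        (shiftFunctor _ (-n)).mapIso ε ≪≫ e) (shiftShiftNeg Y' n) (h0' _ (by omega)) f', comp_zero]

end Perfect

end

/-! ### Perfection of the image of the regular module and orthogonality of gluings. -/

noncomputable section

namespace Gluing

open DerivedCategory

variable {k : Type u} [Field k] {R : Type u} [Ring R] [Algebra k R] [FiniteDimensional k R]
  {S : Type u} [Ring S] [Algebra k S] [FiniteDimensional k S]
  {𝒟'' : Type*} [Category 𝒟''] [HasZeroObject 𝒟''] [Preadditive 𝒟''] [Linear k 𝒟'']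
  [HasShift 𝒟'' ℤ] [∀ n : ℤ, (shiftFunctor 𝒟'' n).Additive] [Pretriangulated 𝒟'']
  (g : Gluing k (DerivedCategory (ModuleCat.{u} S)) (DerivedCategory (ModuleCat.{u} R)) 𝒟'')

/-- The shifts of the image of the regular module. -/
def imageShift (n s m : ℤ) (h : s + m = n := by omega) :
    (g.i.functor.obj (gen S n))⟦s⟧ ≅ g.i.functor.obj (gen S m) :=
  (g.i.functor.commShiftIso s).symm.app (gen S n) ≪≫ g.i.functor.mapIso (genShift S n s m h)

/-- Finite total homology comes from the two adjoints of `i`, and the vanishing of positive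
self-extensions from full faithfulness. -/
theorem isPerfect_image {t : R →ₗ[k] k} (ht : IsSymmetrizingForm t) (hR : SharpHom R) (n : ℤ) :
    IsPerfect (g.i.functor.obj (gen S n)) := by
  have hfin : ∀ m, Module.Finite k (gen R m ⟶ g.i.functor.obj (gen S n)) := fun m => by
    have := finite_hom_gen ht g.adjL g.adjR (n - m)
    let e := genShift R m m 0
    let e' := g.imageShift n m (n - m)
    let F : (gen R m ⟶ g.i.functor.obj (gen S n)) →ₗ[k]
        (gen R 0 ⟶ g.i.functor.obj (gen S (n - m))) :=
      Linear.leftComp k _ e.inv ∘ₗ Linear.rightComp k _ e'.hom ∘ₗ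
        Functor.mapLinearMap k (shiftFunctor (DerivedCategory (ModuleCat.{u} R)) m)
    refine Module.Finite.of_injective F fun f f' h => ?_
    apply (shiftFunctor (DerivedCategory (ModuleCat.{u} R)) m).map_injective
    rw [← cancel_mono e'.hom, ← cancel_epi e.inv]
    exact h
  obtain ⟨c, hc⟩ : ∃ c : ℕ, ∀ m, (∃ f : gen R 0 ⟶ g.i.functor.obj (gen S m), f ≠ 0) →
      -(c : ℤ) ≤ m ∧ m ≤ c := by
    have h := finite_setOf_hom_ne_zero ht g.adjL g.adjR
    obtain ⟨c, hc⟩ := (h.image Int.natAbs).bddAbove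
    refine ⟨c, fun m hm => ?_⟩
    have := hc ⟨m, hm, rfl⟩
    omega
  refine isPerfect_of_bounded ht hR (n - c) (2 * c) _ _ hfin (fun m hm => ?_)
    ⟨1, fun s hs f => ?_⟩ rfl
  · refine hom_shift_eq_zero m (genShift R m m 0) (g.imageShift n m (n - m)) fun f => ?_
    by_contra hf
    have := hc _ ⟨f, hf⟩
    omega
  · let e := g.imageShift n s (n - s)
    rw [← cancel_mono e.hom, zero_comp]
    obtain ⟨f', hf'⟩ := g.i.functor.map_surjective (f ≫ e.hom)
    rw [← hf', gen_hom_eq_zero (by omega) f', Functor.map_zero]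

/-- Over a symmetric algebra with the property `SharpHom`, there are no morphisms in a gluing from
the left hand side to the right hand side. -/
theorem hom_eq_zero {t : R →ₗ[k] k} (ht : IsSymmetrizingForm t) (hR : SharpHom R)
    (Y : DerivedCategory (ModuleCat.{u} S)) (Z : 𝒟'')
    (f : g.i.functor.obj Y ⟶ g.j.functor.obj Z) : f = 0 := by
  have h1 : ∀ (n : ℤ) (f : g.i.functor.obj (gen S n) ⟶ g.j.functor.obj Z), f = 0 := fun n f => by
    obtain ⟨P, hP, ⟨e⟩⟩ := g.isPerfect_image ht hR n
    obtain ⟨σ, hσ⟩ := hP.exists_duality ht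
    rw [← cancel_epi e.hom, comp_zero]
    refine (Module.forall_dual_apply_eq_zero_iff k (e.hom ≫ f)).1 fun l => ?_
    obtain ⟨w, hw⟩ := hσ _ l
    -- The dual morphism runs from the right side to the left side, where a gluing allows only zero.
    have hw0 : w = 0 := by
      rw [← cancel_mono e.hom, zero_comp]
      exact g.orth Z (gen S n) _
    rw [hw, hw0, comp_zero, map_zero]
  have h2 : IsZero (g.iR.obj (g.j.functor.obj Z)) := isZero_of_gen _ fun n f => by
    apply (g.adjR.homEquiv _ _).symm.injective
    exact (h1 n _).trans (h1 n _).symm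
  apply (g.adjR.homEquiv _ _).injective
  exact h2.eq_of_tgt _ _

end Gluing

end

/-! ### Recollements of direct factors of symmetric algebras -/

noncomputable section

namespace DirectFactor

open DerivedCategory

variable {k : Type u} [Field k] {R S S' : Type u} [Ring R] [Ring S] [Ring S'] [Algebra k R]
    [Algebra k S] [Algebra k S'] (d : DirectFactor k R S)

theorem ι_mul_right (s : S) (r : R) : d.ι s * r = d.ι (s * d.π r) := by
  rw [d.ι_mul, d.ι_π, ← mul_assoc, ← d.comm, d.e_mul_ι]

theorem mul_ι (s : S) (r : R) : r * d.ι s = d.ι (d.π r * s) := by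
  rw [d.ι_mul, d.ι_π, d.comm, mul_assoc, d.e_mul_ι]

theorem ι_injective : Function.Injective d.ι := fun s t h => by
  rw [← d.π_ι s, h, d.π_ι]

theorem isSymmetrizingForm {t : R →ₗ[k] k} (ht : IsSymmetrizingForm t) :
    IsSymmetrizingForm (t ∘ₗ d.ι) where
  comm a b := by
    change t (d.ι (a * b)) = t (d.ι (b * a))
    rw [d.ι_mul, d.ι_mul, ht.comm]
  nondeg c h := d.ι_injective (by
    rw [map_zero]
    refine ht.nondeg _ fun r => ?_
    rw [d.mul_ι]
    exact h _)

/-- Restriction is fully faithful on derived categories, so self-extensions may be computed over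
`R`; cutting by `e` returns projectivity to `S`. -/
theorem sharpHom (d : DirectFactor k R S) (h : SharpHom R) : SharpHom S := by
  intro M hM hN
  have h1 : Module.Finite R (d.res.obj M) := by
    obtain ⟨s, hs⟩ := hM
    refine ⟨⟨s, ?_⟩⟩
    rw [eq_top_iff]
    rintro (x : M) -
    have hx : x ∈ Submodule.span S (s : Set M) := by rw [hs]; trivial
    induction hx using Submodule.span_induction with
    | mem x hx => exact Submodule.subset_span hx
    | zero => exact Submodule.zero_mem _
    | add x y _ _ hx hy => exact Submodule.add_mem _ hx hy
    | smul c x _ hx =>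
      have : (c • x : M) = (d.ι c • (show d.res.obj M from x) : d.res.obj M) := by
        rw [d.res_smul, d.π_ι]
      rw [this]
      exact Submodule.smul_mem _ _ hx
  have h2 : Module.Projective R (d.res.obj M) := by
    refine h _ h1 ?_
    obtain ⟨N, hN⟩ := hN
    refine ⟨N, fun n hn f => ?_⟩
    let X := (singleFunctor (ModuleCat.{u} S) 0).obj M
    let e : d.dRes.obj X ≅ (singleFunctor (ModuleCat.{u} R) 0).obj (d.res.obj M) :=
      (d.res.mapDerivedCategorySingleFunctor 0).app M
    let e' : d.dRes.obj (X⟦n⟧) ≅ ((singleFunctor (ModuleCat.{u} R) 0).obj (d.res.obj M))⟦n⟧ :=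
      (d.dRes.commShiftIso n).app X ≪≫ (shiftFunctor _ n).mapIso e
    obtain ⟨f', hf'⟩ := d.dRes.map_surjective (e.hom ≫ f ≫ e'.inv)
    rw [← cancel_epi e.hom, ← cancel_mono e'.inv, Category.assoc, ← hf', hN n hn f',
      Functor.map_zero, comp_zero, zero_comp]
  have h3 : Projective (d.cut.obj (d.res.obj M)) :=
    d.cutAdjRes.map_projective _ ((IsProjective.iff_projective (d.res.obj M)).1 h2)
  exact (IsProjective.iff_projective M).2 (Projective.of_iso (d.cutRes M) h3)

/-- A direct factor of `R` which is contained in another one is a direct factor of the latter. -/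
def between (d' : DirectFactor k R S') (h : d'.e * d.e = d'.e) : DirectFactor k S S' where
  π := AlgHom.ofLinearMap (d'.π.toLinearMap ∘ₗ d.ι)
    (by
      change d'.π (d.ι 1) = 1
      refine d'.ι_injective ?_
      rw [d'.ι_π, d.ι_one, d'.ι_one, h])
    (fun x y => by
      change d'.π (d.ι (x * y)) = d'.π (d.ι x) * d'.π (d.ι y)
      rw [d.ι_mul, map_mul])
  ι := d.π.toLinearMap ∘ₗ d'.ι
  π_ι s := by
    change d'.π (d.ι (d.π (d'.ι s))) = s
    refine d'.ι_injective ?_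
    rw [d.ι_π, d'.ι_π, ← mul_assoc, h, d'.e_mul_ι]
  e := d.π d'.e
  ι_π s := by
    change d.π (d'.ι (d'.π (d.ι s))) = _
    rw [d'.ι_π, map_mul, d.π_ι]
  comm s := by
    have := d'.comm (d.ι s)
    rw [d.ι_mul_right, d.mul_ι] at this
    exact d.ι_injective this.symm |>.symm

theorem triEquivalent_of_e_eq_one (h : d.e = 1) :
    TriEquivalent k (DerivedCategory (ModuleCat.{u} R)) (DerivedCategory (ModuleCat.{u} S)) := by
  let Φ : TriFunctor k (DerivedCategory (ModuleCat.{u} R)) (DerivedCategory (ModuleCat.{u} R)) :=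
    { functor := 𝟭 _ }
  have h1 : Φ.functor.Full := inferInstanceAs (𝟭 (DerivedCategory (ModuleCat.{u} R))).Full
  have h2 : Φ.functor.Faithful := inferInstanceAs (𝟭 (DerivedCategory (ModuleCat.{u} R))).Faithful
  refine d.triEquivalent_of_essImage Φ fun X =>
    ⟨fun _ => (d.isIso_unit_iff X).2 fun n f => ?_, fun _ => ⟨X, ⟨Iso.refl _⟩⟩⟩
  rw [h, sub_self, genMul_zero, zero_comp]

end DirectFactor

/-- A central idempotent. -/
structure CentralIdem (k : Type u) [Field k] (A : Type u) [Ring A] [Algebra k A] where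
  e : A
  central : e ∈ Subring.center A
  idem : IsIdempotentElem e

namespace CentralIdem

variable {k : Type u} [Field k] {A : Type u} [Ring A] [Algebra k A]

theorem comm (e : CentralIdem k A) (a : A) : e.e * a = a * e.e :=
  (Subring.mem_center_iff.1 e.central a).symm

/-- The algebra `e A` for a central idempotent `e`. -/
abbrev alg [FiniteDimensional k A] (e : CentralIdem k A) : FDAlg k :=
  FDAlg.of k e.idem.Corner

theorem mul_mul_self (e : CentralIdem k A) (a : A) : e.e * a * e.e = e.e * a := by
  rw [mul_assoc, ← e.comm, ← mul_assoc, e.idem.eq]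

/-- `e A` as a direct factor of `A`. -/
def factor (e : CentralIdem k A) : DirectFactor k A e.idem.Corner where
  π := AlgHom.ofLinearMap
    { toFun := fun a => ⟨e.e * a * e.e, a, rfl⟩
      map_add' := fun a b => Subtype.ext (by
        change e.e * (a + b) * e.e = e.e * a * e.e + e.e * b * e.e
        rw [mul_add, add_mul])
      map_smul' := fun c a => Subtype.ext (by
        change e.e * (c • a) * e.e = c • (e.e * a * e.e)
        rw [mul_smul_comm, smul_mul_assoc]) }
    (Subtype.ext (by
      change e.e * 1 * e.e = e.e
      rw [mul_one, e.idem.eq]))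
    (fun a b => Subtype.ext (by
      rw [corner_mul_val]
      change e.e * (a * b) * e.e = (e.e * a * e.e) * (e.e * b * e.e)
      rw [e.mul_mul_self, e.mul_mul_self, e.mul_mul_self, ← mul_assoc, ← mul_assoc,
        e.mul_mul_self]))
  ι :=
    { toFun := fun x => x.1
      map_add' := fun x y => corner_add_val e.idem x y
      map_smul' := fun c x => corner_smul_val e.idem c x }
  π_ι x := Subtype.ext (by
    obtain ⟨-, r, rfl⟩ := x
    change e.e * (e.e * r * e.e) * e.e = e.e * r * e.e
    rw [e.mul_mul_self, e.mul_mul_self, ← mul_assoc, e.idem.eq])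
  e := e.e
  ι_π a := e.mul_mul_self a
  comm := e.comm

theorem nontrivial_alg [FiniteDimensional k A] (e : CentralIdem k A) :
    Nontrivial e.alg.carrier ↔ e.e ≠ 0 := by
  rw [nontrivial_iff_exists_ne (0 : e.alg.carrier)] 
  constructor
  · rintro ⟨x, hx⟩ h
    refine hx (Subtype.ext ?_)
    obtain ⟨-, r, rfl⟩ := x
    change e.e * r * e.e = 0
    rw [h, mul_zero]
  · exact fun h => ⟨1, fun h1 => h (congrArg Subtype.val h1)⟩

/-- The central idempotent of `A` given by one of a direct factor. -/
def lift {E : Type u} [Ring E] [Algebra k E] (d : DirectFactor k A E) (c : E) (hc : c * c = c)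
    (hc' : ∀ x, c * x = x * c) : CentralIdem k A where
  e := d.ι c
  central := Subring.mem_center_iff.2 fun a => by rw [d.ι_mul_right, d.mul_ι, hc']
  idem := by rw [IsIdempotentElem, ← d.ι_mul, hc]

end CentralIdem

theorem isEquivalence_of_comp_essSurj {C D E : Type*} [Category C] [Category D] [Category E]
    (F : C ⥤ D) (G : D ⥤ E) [G.IsEquivalence] [(F ⋙ G).Full] [(F ⋙ G).Faithful]
    (h : ∀ X, (F ⋙ G).essImage X) : F.IsEquivalence := by
  have : (F ⋙ G).EssSurj := ⟨h⟩
  have : (F ⋙ G).IsEquivalence := {}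
  exact Functor.isEquivalence_of_comp_right F G

variable {k : Type u} [Field k] {A : Type u} [Ring A] [Algebra k A] [FiniteDimensional k A]

/-- A nontrivial recollement of the derived category of a direct factor of a symmetric algebra with
the property `SharpHom` comes from a decomposition of the central idempotent. -/
theorem exists_centralIdem_of_recollement {t : Aᵐᵒᵖ →ₗ[k] k} (ht : IsSymmetrizingForm t)
    (hA : SharpHom Aᵐᵒᵖ) {E : FDAlg k} (d : DirectFactor k A E.carrier) {Λ B C : FDAlg k}
    (hΛ : TriEquivalent k (DMod Λ) (DMod E)) (r : Recollement k (DMod B) (DMod Λ) (DMod C))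
    (hr : r.IsNontrivial) : ∃ e₁ e₂ : CentralIdem k A, e₁.e ≠ 0 ∧ e₂.e ≠ 0 ∧ e₁.e + e₂.e = d.e ∧
      e₁.e * e₂.e = 0 ∧ TriEquivalent k (DMod B) (DMod e₁.alg) ∧
      TriEquivalent k (DMod C) (DMod e₂.alg) := by
  obtain ⟨Φ, hΦ⟩ := hΛ
  let g := r.gluing Φ
  obtain ⟨c₁, c₂, hc, hc₁, hcomm, hi, hj⟩ := g.exists_central
    (g.hom_eq_zero (d.op.isSymmetrizingForm ht) (d.op.sharpHom hA))
  have hc₂ : c₂ = 1 - c₁ := (eq_sub_of_add_eq' hc)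
  have hc₁₂ : c₁ * c₂ = 0 := by rw [hc₂, mul_sub, mul_one, hc₁, sub_self]
  have hc₂₂ : c₂ * c₂ = c₂ := by
    conv_lhs => rw [hc₂, sub_mul, one_mul, ← hc₂, hc₁₂, sub_zero]
  have hcomm₂ : ∀ x, c₂ * x = x * c₂ := fun x => by
    rw [hc₂, sub_mul, mul_sub, one_mul, mul_one, hcomm]
  let e₁ : CentralIdem k A := CentralIdem.lift d c₁.unop (congrArg MulOpposite.unop hc₁)
    fun x => (congrArg MulOpposite.unop (hcomm (MulOpposite.op x))).symm
  let e₂ : CentralIdem k A := CentralIdem.lift d c₂.unop (congrArg MulOpposite.unop hc₂₂)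
    fun x => (congrArg MulOpposite.unop (hcomm₂ (MulOpposite.op x))).symm
  have hle : ∀ c : E.carrier, d.ι c * d.e = d.ι c := fun c => by rw [← d.comm, d.e_mul_ι]
  let d₁ : DirectFactor k E.carrierᵐᵒᵖ e₁.alg.carrierᵐᵒᵖ := (d.between e₁.factor (hle _)).op
  let d₂ : DirectFactor k E.carrierᵐᵒᵖ e₂.alg.carrierᵐᵒᵖ := (d.between e₂.factor (hle _)).op
  have hd₁ : d₁.e = c₁ := MulOpposite.unop_injective (d.π_ι c₁.unop)
  have hd₂ : d₂.e = c₂ := MulOpposite.unop_injective (d.π_ι c₂.unop)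
  refine ⟨e₁, e₂, fun h => ?_, fun h => ?_, ?_, ?_, ?_, ?_⟩
  -- If `c₁ = 0`, the condition for lying in the image of `j_!` is void, so `j_!` would be an
  -- equivalence. Likewise `c₂ = 0` would make `i_*` an equivalence.
  · have h0 : c₁ = 0 := MulOpposite.unop_injective (d.ι_injective (h.trans (map_zero d.ι).symm))
    have : (r.jShriek.functor ⋙ Φ.functor).Full := g.j_full
    have : (r.jShriek.functor ⋙ Φ.functor).Faithful := g.j_faithful
    exact hr.2.2 (isEquivalence_of_comp_essSurj r.jShriek.functor Φ.functor fun X =>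
      (hj X).2 fun n f => by rw [h0, genMul_zero, zero_comp])
  · have h0 : c₂ = 0 := MulOpposite.unop_injective (d.ι_injective (h.trans (map_zero d.ι).symm))
    have : (r.iLower.functor ⋙ Φ.functor).Full := g.i_full
    have : (r.iLower.functor ⋙ Φ.functor).Faithful := g.i_faithful
    exact hr.1 (isEquivalence_of_comp_essSurj r.iLower.functor Φ.functor fun X =>
      (hi X).2 fun n f => by rw [h0, genMul_zero, zero_comp])
  · change d.ι _ + d.ι _ = _
    rw [← map_add, ← MulOpposite.unop_add, hc, MulOpposite.unop_one, d.ι_one]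
  · change d.ι _ * d.ι _ = _
    rw [← d.ι_mul, ← MulOpposite.unop_mul, hcomm₂, hc₁₂, MulOpposite.unop_zero, map_zero]
  · refine d₁.triEquivalent_of_essImage g.i fun X => (hi X).trans ?_
    rw [d₁.isIso_unit_iff, hd₁, hc₂]
  · refine d₂.triEquivalent_of_essImage g.j fun X => (hj X).trans ?_
    rw [d₂.isIso_unit_iff, hd₂, hc₂, sub_sub_cancel]

end

/-! ### Recollements given by decompositions -/

noncomputable section

section Splitting

variable (k : Type*) [Field k]
  (𝒟' : Type*) [Category 𝒟'] [HasZeroObject 𝒟'] [Preadditive 𝒟'] [Linear k 𝒟'] [HasShift 𝒟' ℤ]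
  [∀ n : ℤ, (shiftFunctor 𝒟' n).Additive] [Pretriangulated 𝒟']
  (𝒟 : Type*) [Category 𝒟] [HasZeroObject 𝒟] [Preadditive 𝒟] [Linear k 𝒟] [HasShift 𝒟 ℤ]
  [∀ n : ℤ, (shiftFunctor 𝒟 n).Additive] [Pretriangulated 𝒟]
  (𝒟'' : Type*) [Category 𝒟''] [HasZeroObject 𝒟''] [Preadditive 𝒟''] [Linear k 𝒟'']
  [HasShift 𝒟'' ℤ] [∀ n : ℤ, (shiftFunctor 𝒟'' n).Additive] [Pretriangulated 𝒟'']

/-- A decomposition of a triangulated category into two orthogonal subcategories. -/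
structure Splitting where
  i : TriFunctor k 𝒟' 𝒟
  p : TriFunctor k 𝒟 𝒟'
  j : TriFunctor k 𝒟'' 𝒟
  q : TriFunctor k 𝒟 𝒟''
  adjIP : i.functor ⊣ p.functor
  adjPI : p.functor ⊣ i.functor
  adjJQ : j.functor ⊣ q.functor
  adjQJ : q.functor ⊣ j.functor
  i_full : i.functor.Full
  i_faithful : i.functor.Faithful
  j_full : j.functor.Full
  j_faithful : j.functor.Faithful
  isZero_p_j : ∀ X, IsZero (p.functor.obj (j.functor.obj X))
  isZero_q_i : ∀ X, IsZero (q.functor.obj (i.functor.obj X))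
  isZero_of_isZero : ∀ X, IsZero (p.functor.obj X) → IsZero (q.functor.obj X) → IsZero X

attribute [instance] Splitting.i_full Splitting.i_faithful Splitting.j_full Splitting.j_faithful

variable {k 𝒟' 𝒟 𝒟''}

namespace Splitting

/-- Interchanging the two sides of a splitting. -/
def swap (s : Splitting k 𝒟' 𝒟 𝒟'') : Splitting k 𝒟'' 𝒟 𝒟' where
  i := s.j
  p := s.q
  j := s.i
  q := s.p
  adjIP := s.adjJQ
  adjPI := s.adjQJ
  adjJQ := s.adjIP
  adjQJ := s.adjPI
  i_full := s.j_full
  i_faithful := s.j_faithful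
  j_full := s.i_full
  j_faithful := s.i_faithful
  isZero_p_j := s.isZero_q_i
  isZero_q_i := s.isZero_p_j
  isZero_of_isZero X h h' := s.isZero_of_isZero X h' h

theorem isIso_map_of_isZero {C D : Type*} [Category C] [HasZeroObject C] [Preadditive C]
    [HasShift C ℤ] [∀ n : ℤ, (shiftFunctor C n).Additive] [Pretriangulated C]
    [Category D] [HasZeroObject D] [Preadditive D]
    [HasShift D ℤ] [∀ n : ℤ, (shiftFunctor D n).Additive] [Pretriangulated D]
    (F : C ⥤ D) [F.CommShift ℤ] [F.IsTriangulated] {X Y Z : C} {a : X ⟶ Y} {b : Y ⟶ Z}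
    {c : Z ⟶ X⟦(1 : ℤ)⟧} (h : Triangle.mk a b c ∈ distTriang C) :
    (IsZero (F.obj X) → IsIso (F.map b)) ∧ (IsIso (F.map a) ↔ IsZero (F.obj Z)) :=
  ⟨(Triangle.isZero₁_iff_isIso₂ _ (F.map_distinguished _ h)).1,
    (Triangle.isZero₃_iff_isIso₁ _ (F.map_distinguished _ h)).symm⟩

variable (s : Splitting k 𝒟' 𝒟 𝒟'')

theorem isIso_of_isIso {X Y : 𝒟} (w : X ⟶ Y) (h : IsIso (s.p.functor.map w))
    (h' : IsIso (s.q.functor.map w)) : IsIso w := by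
  obtain ⟨Z, b, c, hT⟩ := distinguished_cocone_triangle w
  exact (Triangle.isZero₃_iff_isIso₁ _ hT).1 (s.isZero_of_isZero _
    ((isIso_map_of_isZero s.p.functor hT).2.1 h) ((isIso_map_of_isZero s.q.functor hT).2.1 h'))

/-- The cone `W` of the counit has zero image under `p` and the same image as `X` under `q`, so the
comparison from `W` to `j q X` becomes invertible under both functors, which together detect
isomorphisms. -/
theorem exists_triangle (X : 𝒟) : ∃ h : s.j.functor.obj (s.q.functor.obj X) ⟶
      (s.i.functor.obj (s.p.functor.obj X))⟦(1 : ℤ)⟧,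
    Triangle.mk (s.adjIP.counit.app X) (s.adjQJ.unit.app X) h ∈ distTriang 𝒟 := by
  obtain ⟨W, b, c, hT⟩ := distinguished_cocone_triangle (s.adjIP.counit.app X)
  change X ⟶ W at b
  change W ⟶ (s.i.functor.obj (s.p.functor.obj X))⟦(1 : ℤ)⟧ at c
  have h1 : (s.adjIP.counit.app X : s.i.functor.obj (s.p.functor.obj X) ⟶ X) ≫
      (s.adjQJ.unit.app X : X ⟶ s.j.functor.obj (s.q.functor.obj X)) = 0 :=
    (s.adjIP.homEquiv _ _).injective ((s.isZero_p_j _).eq_of_tgt _ _)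
  obtain ⟨w, hw⟩ : ∃ w : W ⟶ s.j.functor.obj (s.q.functor.obj X),
      (s.adjQJ.unit.app X : X ⟶ s.j.functor.obj (s.q.functor.obj X)) = b ≫ w :=
    Triangle.yoneda_exact₂ _ hT _ h1
  have hp : IsIso (s.p.functor.map (s.adjIP.counit.app X)) := by
    have := s.adjIP.right_triangle_components X
    have h2 : IsIso (s.adjIP.unit.app (s.p.functor.obj X)) := inferInstance
    rw [(IsIso.eq_inv_of_hom_inv_id this : _ = _)]
    infer_instance
  have hq : IsIso (s.q.functor.map (s.adjQJ.unit.app X)) := by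
    have := s.adjQJ.left_triangle_components X
    have h2 : IsIso (s.adjQJ.counit.app (s.q.functor.obj X)) := inferInstance
    rw [(IsIso.eq_inv_of_inv_hom_id this : _ = _)]
    infer_instance
  have hpW : IsZero (s.p.functor.obj W) := (isIso_map_of_isZero s.p.functor hT).2.1 hp
  have hqb : IsIso (s.q.functor.map b) :=
    (isIso_map_of_isZero s.q.functor hT).1 (s.isZero_q_i _)
  have hw' : IsIso w := by
    refine s.isIso_of_isIso w ?_ ?_
    · exact ⟨0, hpW.eq_of_src _ _, (s.isZero_p_j _).eq_of_src _ _⟩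
    · have h3 : IsIso (s.q.functor.map b ≫ s.q.functor.map w) := by
        rw [← Functor.map_comp, ← hw]
        exact hq
      exact IsIso.of_isIso_comp_left (s.q.functor.map b) _
  refine ⟨inv w ≫ c, isomorphic_distinguished _ hT _ (Triangle.isoMk _ _
    (Iso.refl (s.i.functor.obj (s.p.functor.obj X))) (Iso.refl X) (asIso w).symm ?_ ?_ ?_)⟩
  · exact (Category.comp_id _).trans (Category.id_comp _).symm
  · change s.adjQJ.unit.app X ≫ inv w = 𝟙 X ≫ b
    rw [Category.id_comp, IsIso.comp_inv_eq]
    exact hw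
  · change (inv w ≫ c) ≫ (shiftFunctor 𝒟 (1 : ℤ)).map (𝟙 _) = inv w ≫ c
    rw [CategoryTheory.Functor.map_id, Category.comp_id]

/-- The recollement given by a splitting. -/
def recollement : Recollement k 𝒟' 𝒟 𝒟'' where
  iLower := s.i
  iStar := s.p
  iShriek := s.p
  jStar := s.q
  jLower := s.j
  jShriek := s.j
  adjIStar := s.adjPI
  adjIShriek := s.adjIP
  adjJShriek := s.adjJQ
  adjJLower := s.adjQJ
  iLower_full := s.i_full
  iLower_faithful := s.i_faithful
  jLower_full := s.j_full
  jLower_faithful := s.j_faithful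
  jShriek_full := s.j_full
  jShriek_faithful := s.j_faithful
  iShriek_jLower := s.isZero_p_j
  triangle₁ := s.exists_triangle
  triangle₂ := s.swap.exists_triangle

/-- If `i` were an equivalence, `j X` would be some `i Y` with `Y ≅ p (j X) = 0`, forcing `X = 0`.
-/
theorem not_isEquivalence (h : ∃ X : 𝒟'', ¬ IsZero X) : ¬ s.i.functor.IsEquivalence := by
  obtain ⟨X, hX⟩ := h
  intro hi
  refine hX ?_
  have h1 : IsZero (s.j.functor.obj X) := by
    obtain ⟨Y, ⟨e⟩⟩ := hi.essSurj.mem_essImage (s.j.functor.obj X)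
    have h2 : IsZero Y := (s.isZero_p_j X).of_iso
      (asIso (s.adjIP.unit.app Y) ≪≫ s.p.functor.mapIso e)
    exact (s.i.functor.map_isZero h2).of_iso e.symm
  rw [IsZero.iff_id_eq_zero]
  exact s.j.functor.map_injective (h1.eq_of_src _ _)

theorem isNontrivial_recollement (h : ∃ X : 𝒟', ¬ IsZero X) (h' : ∃ X : 𝒟'', ¬ IsZero X) :
    s.recollement.IsNontrivial :=
  ⟨s.not_isEquivalence h', s.swap.not_isEquivalence h, s.swap.not_isEquivalence h⟩

end Splitting

end Splitting

namespace DirectFactor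

open DerivedCategory

variable {k : Type u} [Field k] {R S S' : Type u} [Ring R] [Ring S] [Ring S'] [Algebra k R]
    [Algebra k S] [Algebra k S'] (d : DirectFactor k R S) (d' : DirectFactor k R S')

theorem isZero_dCut_dRes (h : d.e + d'.e = 1) (N : DerivedCategory (ModuleCat.{u} S')) :
    IsZero (d.dCut.obj (d'.dRes.obj N)) := by
  have hπ : d'.π d.e = 0 := by
    rw [eq_sub_of_add_eq h, map_sub, map_one, d'.π_e, sub_self]
  let L := Q.objPreimage N
  let F := d.cut.mapHomologicalComplex (ComplexShape.up ℤ)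
  let F' := d'.res.mapHomologicalComplex (ComplexShape.up ℤ)
  have e : d.dCut.obj (d'.dRes.obj N) ≅ Q.obj (F.obj (F'.obj L)) :=
    d.dCut.mapIso (d'.dRes.mapIso (Q.objObjPreimageIso N).symm ≪≫
      d'.res.mapDerivedCategoryFactors.app L) ≪≫ d.cut.mapDerivedCategoryFactors.app _
  have h0 : IsZero (F.obj (F'.obj L)) := by
    rw [IsZero.iff_id_eq_zero]
    ext n x
    obtain ⟨x, hx⟩ := x
    refine Subtype.ext ?_
    change x = 0
    rw [← show d.e • x = x from hx]
    change d'.π d.e • (show L.X n from x) = 0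
    rw [hπ, zero_smul]
  exact (Q.map_isZero h0).of_iso e

/-- Two complementary direct factors split the derived category. -/
def splitting (h : d.e + d'.e = 1) {𝒟 : Type*} [Category 𝒟] [HasZeroObject 𝒟] [Preadditive 𝒟]
    [Linear k 𝒟] [HasShift 𝒟 ℤ] [∀ n : ℤ, (shiftFunctor 𝒟 n).Additive] [Pretriangulated 𝒟]
    (Φ : TriFunctor k 𝒟 (DerivedCategory (ModuleCat.{u} R))) [Φ.functor.IsEquivalence] :
    Splitting k (DerivedCategory (ModuleCat.{u} S)) 𝒟 (DerivedCategory (ModuleCat.{u} S')) where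
  i := d.triRes.comp Φ.inv
  p := Φ.comp d.triCut
  j := d'.triRes.comp Φ.inv
  q := Φ.comp d'.triCut
  adjIP := d.dResAdjCut.comp Φ.invAdj
  adjPI := Φ.adjInv.comp d.dCutAdjRes
  adjJQ := d'.dResAdjCut.comp Φ.invAdj
  adjQJ := Φ.adjInv.comp d'.dCutAdjRes
  i_full := inferInstanceAs (d.dRes ⋙ Φ.inv.functor).Full
  i_faithful := inferInstanceAs (d.dRes ⋙ Φ.inv.functor).Faithful
  j_full := inferInstanceAs (d'.dRes ⋙ Φ.inv.functor).Full
  j_faithful := inferInstanceAs (d'.dRes ⋙ Φ.inv.functor).Faithful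
  isZero_p_j X := (d.isZero_dCut_dRes d' h X).of_iso
    (d.dCut.mapIso (Φ.functor.asEquivalence.counitIso.app _))
  isZero_q_i X := (d'.isZero_dCut_dRes d (by rw [add_comm, h]) X).of_iso
    (d'.dCut.mapIso (Φ.functor.asEquivalence.counitIso.app _))
  isZero_of_isZero X h1 h2 := by
    have h3 : IsZero (Φ.functor.obj X) := isZero_of_gen _ fun n f => by
      have h4 : genMul n d.e ≫ f = 0 := by
        rw [← d.comp_unit_comp_counit]
        have : d.dCutAdjRes.unit.app (Φ.functor.obj X) = 0 :=
          (d.dRes.map_isZero h1).eq_of_tgt _ _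
        rw [this, zero_comp, comp_zero]
      have h5 : genMul n d'.e ≫ f = 0 := by
        rw [← d'.comp_unit_comp_counit]
        have : d'.dCutAdjRes.unit.app (Φ.functor.obj X) = 0 :=
          (d'.dRes.map_isZero h2).eq_of_tgt _ _
        rw [this, zero_comp, comp_zero]
      rw [← Category.id_comp f, ← genMul_one, ← h, genMul_add, Preadditive.add_comp, h4, h5,
        add_zero]
    rw [IsZero.iff_id_eq_zero]
    exact Φ.functor.map_injective (h3.eq_of_src _ _)

end DirectFactor

theorem not_isZero_gen {R : Type u} [Ring R] [Nontrivial R] : ¬ IsZero (gen R 0) := fun h =>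
  one_ne_zero (genMul_injective (h.eq_of_src (genMul 0 (1 : R)) (genMul 0 0)))

/-- A decomposition of a direct factor gives nontrivial recollements of the algebras which are
derived equivalent to it. -/
theorem exists_recollement {k : Type u} [Field k] {Λ E E₁ E₂ : FDAlg k}
    (hΛ : TriEquivalent k (DMod Λ) (DMod E)) (d₁ : DirectFactor k E.carrier E₁.carrier)
    (d₂ : DirectFactor k E.carrier E₂.carrier) (h : d₁.e + d₂.e = 1) [Nontrivial E₁.carrier]
    [Nontrivial E₂.carrier] :
    ∃ r : Recollement k (DMod E₁) (DMod Λ) (DMod E₂), r.IsNontrivial := by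
  obtain ⟨Φ, hΦ⟩ := hΛ
  exact ⟨_, (d₁.op.splitting d₂.op (MulOpposite.unop_injective h) Φ).isNontrivial_recollement
    ⟨_, not_isZero_gen⟩ ⟨_, not_isZero_gen⟩⟩

end

/-! ### Decompositions of central idempotents -/

noncomputable section

namespace DirectFactor

variable {k : Type u} [Field k] {R S S' : Type u} [Ring R] [Ring S] [Ring S'] [Algebra k R]
    [Algebra k S] [Algebra k S'] (d : DirectFactor k R S) (d' : DirectFactor k R S')

theorem π_ι_eq_zero (h : d.e * d'.e = 0) (s : S') : d.π (d'.ι s) = 0 :=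
  d.ι_injective (by rw [d.ι_π, ← d'.e_mul_ι, ← mul_assoc, h, zero_mul, map_zero])

/-- Two complementary direct factors decompose an algebra as a product. -/
def prodEquiv (h : d.e + d'.e = 1) : R ≃ₐ[k] S × S' :=
  AlgEquiv.ofBijective (d.π.prod d'.π) (by
    have h1 : d.e * d'.e = 0 := by
      rw [eq_sub_of_add_eq' h, mul_sub, mul_one, d.isIdempotentElem, sub_self]
    have h2 : d'.e * d.e = 0 := by rw [d'.comm, h1]
    constructor
    · rw [injective_iff_map_eq_zero]
      intro x hx
      have hx1 : d.π x = 0 := congrArg Prod.fst hx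
      have hx2 : d'.π x = 0 := congrArg Prod.snd hx
      rw [← one_mul x, ← h, add_mul, ← d.ι_π, ← d'.ι_π, hx1, hx2, map_zero, map_zero, add_zero]
    · rintro ⟨s, s'⟩
      refine ⟨d.ι s + d'.ι s', Prod.ext ?_ ?_⟩
      · change d.π (d.ι s + d'.ι s') = s
        rw [map_add, d.π_ι, d.π_ι_eq_zero d' h1, add_zero]
      · change d'.π (d.ι s + d'.ι s') = s'
        rw [map_add, d'.π_ι, d'.π_ι_eq_zero d h2, zero_add])

end DirectFactor

namespace CentralIdem

variable {k : Type u} [Field k] {A : Type u} [Ring A] [Algebra k A]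

/-- The central idempotent `e` is the sum of the nonzero orthogonal central idempotents `e₁`
and `e₂`. -/
structure IsSum (e e₁ e₂ : CentralIdem k A) : Prop where
  ne_zero_left : e₁.e ≠ 0
  ne_zero_right : e₂.e ≠ 0
  add_eq : e₁.e + e₂.e = e.e
  mul_eq_zero : e₁.e * e₂.e = 0

/-- A central idempotent is primitive if it is nonzero and not a nontrivial sum. -/
def IsPrimitive (e : CentralIdem k A) : Prop :=
  e.e ≠ 0 ∧ ∀ e₁ e₂, ¬ IsSum e e₁ e₂

variable {e e₁ e₂ : CentralIdem k A}

theorem IsSum.swap (h : IsSum e e₁ e₂) : IsSum e e₂ e₁ :=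
  ⟨h.ne_zero_right, h.ne_zero_left, by rw [add_comm, h.add_eq], by rw [e₂.comm, h.mul_eq_zero]⟩

theorem IsSum.mul_left (h : IsSum e e₁ e₂) : e₁.e * e.e = e₁.e := by
  rw [← h.add_eq, mul_add, e₁.idem.eq, h.mul_eq_zero, add_zero]

/-- The left summand as a direct factor. -/
def IsSum.factor (h : IsSum e e₁ e₂) : DirectFactor k e.idem.Corner e₁.idem.Corner :=
  e.factor.between e₁.factor h.mul_left

theorem IsSum.factor_add (h : IsSum e e₁ e₂) : h.factor.e + h.swap.factor.e = 1 := by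
  change e.factor.π e₁.e + e.factor.π e₂.e = 1
  rw [← map_add, h.add_eq]
  exact e.factor.π_e

/-- Otherwise `e = b + (e - b)` would be a nontrivial orthogonal decomposition. -/
theorem IsPrimitive.eq_of_le {b : CentralIdem k A} (he : IsPrimitive e) (hb : b.e ≠ 0)
    (h : b.e * e.e = b.e) : b.e = e.e := by
  by_contra hne
  have h' : e.e * b.e = b.e := by rw [e.comm, h]
  let c : CentralIdem k A :=
    { e := e.e - b.e
      central := sub_mem e.central b.central
      idem := by
        rw [IsIdempotentElem, sub_mul, mul_sub, mul_sub, e.idem.eq, b.idem.eq, h, h', sub_self,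
          sub_zero] }
  refine he.2 b c ⟨hb, fun hc => hne (sub_eq_zero.1 hc).symm, add_sub_cancel _ _, ?_⟩
  change b.e * (e.e - b.e) = 0
  rw [mul_sub, h, b.idem.eq, sub_self]

/-- The products `b e₁` and `b e₂` are orthogonal with sum `b`, so primitivity makes one of them
zero. -/
theorem IsPrimitive.le_or_le {b : CentralIdem k A} (hb : IsPrimitive b) (h : IsSum e e₁ e₂)
    (hbe : b.e * e.e = b.e) : b.e * e₁.e = b.e ∨ b.e * e₂.e = b.e := by
  have hsum : b.e * e₁.e + b.e * e₂.e = b.e := by rw [← mul_add, h.add_eq, hbe]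
  have hmul : ∀ c : CentralIdem k A, IsIdempotentElem (b.e * c.e) := fun c => by
    rw [IsIdempotentElem, mul_assoc, ← mul_assoc c.e, c.comm, mul_assoc, c.idem.eq, ← mul_assoc,
      b.idem.eq]
  by_contra hne
  rw [not_or] at hne
  refine hb.2 ⟨_, mul_mem b.central e₁.central, hmul e₁⟩ ⟨_, mul_mem b.central e₂.central, hmul e₂⟩
    ⟨fun h0 => hne.2 ?_, fun h0 => hne.1 ?_, hsum, ?_⟩
  · change b.e * e₁.e = 0 at h0
    rw [h0, zero_add] at hsum
    exact hsum
  · change b.e * e₂.e = 0 at h0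
    rw [h0, add_zero] at hsum
    exact hsum
  · change b.e * e₁.e * (b.e * e₂.e) = 0
    rw [mul_assoc, ← mul_assoc e₁.e, e₁.comm, mul_assoc, h.mul_eq_zero, mul_zero, mul_zero]

variable [FiniteDimensional k A]

/-- A product decomposition of the corner provides the idempotents `(1, 0)` and `(0, 1)`, which
remain central and orthogonal in `A`. -/
theorem IsPrimitive.isIndecomposableAlg (he : IsPrimitive e) :
    IsIndecomposableAlg k e.idem.Corner := by
  refine ⟨e.nontrivial_alg.2 he.1, fun B C _ _ _ _ hB hC => ⟨fun φ => ?_⟩⟩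
  have hφ : ∀ x : B × C, e.factor.ι (φ.symm x) = 0 → x = 0 := fun x hx =>
    φ.symm.injective ((e.factor.ι_injective (hx.trans (map_zero _).symm)).trans (map_zero _).symm)
  refine he.2 (lift e.factor (φ.symm (1, 0)) (by rw [← map_mul]; simp) (fun x => ?_))
    (lift e.factor (φ.symm (0, 1)) (by rw [← map_mul]; simp) (fun x => ?_)) ⟨?_, ?_, ?_, ?_⟩
  · apply φ.injective
    rw [map_mul, map_mul, φ.apply_symm_apply]
    ext <;> simp
  · apply φ.injective
    rw [map_mul, map_mul, φ.apply_symm_apply]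
    ext <;> simp
  · exact fun h => one_ne_zero (congrArg Prod.fst (hφ _ h))
  · exact fun h => one_ne_zero (congrArg Prod.snd (hφ _ h))
  · change e.factor.ι _ + e.factor.ι _ = e.e
    rw [← map_add, ← map_add]
    have : ((1, 0) + (0, 1) : B × C) = 1 := by ext <;> simp
    rw [this, map_one, e.factor.ι_one]
    rfl
  · change e.factor.ι _ * e.factor.ι _ = 0
    rw [← e.factor.ι_mul, ← map_mul]
    have : ((1, 0) * (0, 1) : B × C) = 0 := by ext <;> simp
    rw [this, map_zero, map_zero]

theorem isPrimitive_of_isIndecomposableAlg (he : IsIndecomposableAlg k e.idem.Corner) :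
    IsPrimitive e :=
  ⟨e.nontrivial_alg.1 he.1, fun e₁ e₂ h => (he.2 e₁.idem.Corner e₂.idem.Corner
    (e₁.nontrivial_alg.2 h.ne_zero_left) (e₂.nontrivial_alg.2 h.ne_zero_right)).false
      (h.factor.prodEquiv h.swap.factor h.factor_add)⟩

theorem IsSum.finrank_lt (h : IsSum e e₁ e₂) :
    Module.finrank k e₁.idem.Corner < Module.finrank k e.idem.Corner := by
  have := (h.factor.prodEquiv h.swap.factor h.factor_add).toLinearEquiv.finrank_eq
  rw [Module.finrank_prod] at this
  have : Nontrivial e₂.idem.Corner := e₂.nontrivial_alg.2 h.ne_zero_right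
  have : 0 < Module.finrank k e₂.idem.Corner := Module.finrank_pos
  omega

/-- The idempotent `1`. -/
def one (k : Type u) [Field k] (A : Type u) [Ring A] [Algebra k A] : CentralIdem k A where
  e := 1
  central := one_mem _
  idem := mul_one 1

theorem triEquivalent_one : TriEquivalent k (DMod (FDAlg.of k A)) (DMod (one k A).alg) :=
  (one k A).factor.op.triEquivalent_of_e_eq_one rfl

end CentralIdem

/-! ### Derived simplicity and primitive central idempotents. -/

section Simple

open CentralIdem

variable {k : Type u} [Field k] {A : Type u} [Ring A] [Algebra k A] [FiniteDimensional k A]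
  {e : CentralIdem k A} {Λ : FDAlg k}

/-- The derived category of the zero algebra is zero, whereas the regular module of a nonzero
algebra is a nonzero object. -/
theorem TriEquivalent.nontrivial {Λ Λ' : FDAlg k} (h : TriEquivalent k (DMod Λ) (DMod Λ'))
    (h' : Nontrivial Λ'.carrier) : Nontrivial Λ.carrier := by
  obtain ⟨Φ, hΦ⟩ := h
  by_contra hn
  rw [not_nontrivial_iff_subsingleton] at hn
  have hzero : ∀ X : DMod Λ, IsZero X := fun X => isZero_of_gen X fun n f => by
    rw [← Category.id_comp f, ← genMul_one, Subsingleton.elim (1 : Λ.carrierᵐᵒᵖ) 0, genMul_zero,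
      zero_comp]
  obtain ⟨X, ⟨ε⟩⟩ := hΦ.essSurj.mem_essImage (gen Λ'.carrierᵐᵒᵖ 0)
  exact not_isZero_gen ((Φ.functor.map_isZero (hzero X)).of_iso ε.symm)

theorem isDerivedSimple_of_isPrimitive {t : Aᵐᵒᵖ →ₗ[k] k} (ht : IsSymmetrizingForm t)
    (hA : SharpHom Aᵐᵒᵖ) (he : IsPrimitive e) (hΛ : TriEquivalent k (DMod Λ) (DMod e.alg)) :
    IsDerivedSimple Λ := by
  refine ⟨hΛ.nontrivial (e.nontrivial_alg.2 he.1), fun B C r hr => ?_⟩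
  obtain ⟨e₁, e₂, h1, h2, h3, h4, -, -⟩ := exists_centralIdem_of_recollement ht hA (E := e.alg)
    e.factor hΛ r hr
  exact he.2 e₁ e₂ ⟨h1, h2, h3, h4⟩

theorem CentralIdem.IsSum.exists_recollement {e₁ e₂ : CentralIdem k A} (h : IsSum e e₁ e₂)
    (hΛ : TriEquivalent k (DMod Λ) (DMod e.alg)) :
    ∃ r : Recollement k (DMod e₁.alg) (DMod Λ) (DMod e₂.alg), r.IsNontrivial := by
  have := e₁.nontrivial_alg.2 h.ne_zero_left
  have := e₂.nontrivial_alg.2 h.ne_zero_right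
  exact _root_.exists_recollement hΛ h.factor h.swap.factor h.factor_add

theorem isPrimitive_of_isDerivedSimple (hΛ : TriEquivalent k (DMod Λ) (DMod e.alg))
    (h : IsDerivedSimple Λ) : IsPrimitive e := by
  refine ⟨e.nontrivial_alg.1 (hΛ.symm.nontrivial h.1), fun e₁ e₂ hs => ?_⟩
  obtain ⟨r, hr⟩ := hs.exists_recollement hΛ
  exact h.2 _ _ r hr

end Simple

end

/-! ### Stratifications -/

noncomputable section

namespace Stratification

open CentralIdem

variable {k : Type u} [Field k] {A : Type u} [Ring A] [Algebra k A] [FiniteDimensional k A]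

/-- A labelling of the nodes of a stratification by central idempotents, compatible with the
recollements. -/
structure Labelling (S : Stratification (FDAlg.of k A)) where
  ε : List Bool → CentralIdem k A
  root : (ε []).e = 1
  triEquivalent : ∀ w ∈ S.nodes, TriEquivalent k (DMod (S.alg w)) (DMod (ε w).alg)
  isSum : ∀ w ∈ S.nodes, false :: w ∈ S.nodes → IsSum (ε w) (ε (false :: w)) (ε (true :: w))

/-- Labels are chosen downwards from the root. The equivalence between a node and its label lets the
next recollement be read off in the direct factor, even when the algebra at the node is not a direct
factor of `A`. -/
theorem nonempty_labelling {t : Aᵐᵒᵖ →ₗ[k] k} (ht : IsSymmetrizingForm t) (hA : SharpHom Aᵐᵒᵖ)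
    (S : Stratification (FDAlg.of k A)) : Nonempty (Labelling S) := by
  -- The choice is made for all pairs `(e, w)`, with a dummy value when the hypotheses fail, so that
  -- the labelling can be defined by plain recursion on addresses.
  have h : ∀ (e : CentralIdem k A) (w : List Bool), ∃ e' : Bool → CentralIdem k A, w ∈ S.nodes →
      false :: w ∈ S.nodes → TriEquivalent k (DMod (S.alg w)) (DMod e.alg) →
        IsSum e (e' false) (e' true) ∧
          ∀ b, TriEquivalent k (DMod (S.alg (b :: w))) (DMod (e' b).alg) := fun e w => by
    by_cases hw : w ∈ S.nodes ∧ false :: w ∈ S.nodes ∧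
      TriEquivalent k (DMod (S.alg w)) (DMod e.alg)
    · obtain ⟨hw1, hw2, hw3⟩ := hw
      obtain ⟨r, hr⟩ := S.recollement_of_not_leaf w hw1 hw2
      obtain ⟨e₁, e₂, h1, h2, h3, h4, h5, h6⟩ := exists_centralIdem_of_recollement ht hA
        (E := e.alg) e.factor hw3 r hr
      refine ⟨fun b => bif b then e₂ else e₁, fun _ _ _ => ⟨⟨h1, h2, h3, h4⟩, fun b => ?_⟩⟩
      cases b
      · exact h5
      · exact h6
    · exact ⟨fun _ => e, fun h1 h2 h3 => absurd ⟨h1, h2, h3⟩ hw⟩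
  choose c hc using h
  let ε : List Bool → CentralIdem k A := List.rec (one k A) fun b w e => c e w b
  have hfull : ∀ (b : Bool) (w : List Bool), b :: w ∈ S.nodes → false :: w ∈ S.nodes := by
    rintro (_ | _) w hw
    · exact hw
    · exact (S.full w).2 hw
  have hε : ∀ w ∈ S.nodes, TriEquivalent k (DMod (S.alg w)) (DMod (ε w).alg) := fun w => by
    induction w with
    | nil =>
      intro _
      rw [S.alg_root]
      exact triEquivalent_one
    | cons b w ih =>
      intro hw
      have hw' := S.parent_mem b w hw
      exact (hc (ε w) w hw' (hfull b w hw) (ih hw')).2 b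
  exact ⟨⟨ε, rfl, hε, fun w hw hw' => (hc (ε w) w hw hw' (hε w hw)).1⟩⟩

namespace Labelling

variable {S : Stratification (FDAlg.of k A)} (L : Labelling S)

theorem mem_of_cons {b : Bool} {w : List Bool} (h : b :: w ∈ S.nodes) : false :: w ∈ S.nodes := by
  cases b
  · exact h
  · exact (S.full w).2 h

theorem isSum_cons {b : Bool} {w : List Bool} (h : b :: w ∈ S.nodes) :
    IsSum (L.ε w) (L.ε (b :: w)) (L.ε ((!b) :: w)) := by
  have := L.isSum w (S.parent_mem b w h) (mem_of_cons h)
  cases b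
  · exact this
  · exact this.swap

/-- Each step away from the root costs at least one dimension; this bounds the depth and thereby the
number of nodes. -/
theorem length_add_finrank_le {w : List Bool} (hw : w ∈ S.nodes) :
    w.length + Module.finrank k (L.ε w).idem.Corner ≤
      Module.finrank k (L.ε []).idem.Corner := by
  induction w with
  | nil => simp
  | cons b w ih =>
    have h1 := ih (S.parent_mem b w hw)
    have h2 := (L.isSum_cons hw).finrank_lt
    rw [List.length_cons]
    omega

theorem isFinite (L : Labelling S) : S.IsFinite :=
  (List.finite_length_le Bool (Module.finrank k (L.ε []).idem.Corner)).subset fun w hw => by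
    have := L.length_add_finrank_le hw
    change w.length ≤ _
    omega

theorem isPrimitive (l : S.Leaf) : IsPrimitive (L.ε l.1) :=
  isPrimitive_of_isDerivedSimple (L.triEquivalent _ l.2.1) (S.simple_of_leaf _ l.2.1 l.2.2)

variable {b : CentralIdem k A}

theorem le_parent {x : Bool} {w : List Bool} (hw : x :: w ∈ S.nodes)
    (h : b.e * (L.ε (x :: w)).e = b.e) : b.e * (L.ε w).e = b.e :=
  calc b.e * (L.ε w).e = b.e * (L.ε (x :: w)).e * (L.ε w).e := by rw [h]
    _ = b.e := by rw [mul_assoc, (L.isSum_cons hw).mul_left, h]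

/-- By induction the parents agree; two different siblings have orthogonal labels, and a nonzero
idempotent cannot lie below both. -/
theorem eq_of_length_eq (hb : b.e ≠ 0) {w w' : List Bool} (hw : w ∈ S.nodes) (hw' : w' ∈ S.nodes)
    (h : b.e * (L.ε w).e = b.e) (h' : b.e * (L.ε w').e = b.e) (hl : w.length = w'.length) :
    w = w' := by
  induction w generalizing w' with
  | nil => exact (List.length_eq_zero_iff.1 hl.symm).symm
  | cons x w ih =>
    cases w' with
    | nil => simp at hl
    | cons x' w' =>
      obtain rfl : w = w' := ih (S.parent_mem _ _ hw) (S.parent_mem _ _ hw') (L.le_parent hw h)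
        (L.le_parent hw' h') (by simpa using hl)
      by_cases hx : x = x'
      · rw [hx]
      · obtain rfl : x' = !x := by cases x <;> cases x' <;> simp_all
        refine absurd ?_ hb
        rw [← h', ← h, mul_assoc, (L.isSum_cons hw).mul_eq_zero, mul_zero]

/-- Climbing from `w` to the depth of the leaf leads to the leaf itself; had `w` been strictly
deeper, the leaf would have a child. -/
theorem eq_of_leaf (hb : b.e ≠ 0) (l : S.Leaf) {w : List Bool} (hw : w ∈ S.nodes)
    (h : b.e * (L.ε l.1).e = b.e) (h' : b.e * (L.ε w).e = b.e) (hl : l.1.length ≤ w.length) :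
    l.1 = w := by
  induction w with
  | nil => exact List.length_eq_zero_iff.1 (Nat.le_zero.1 hl)
  | cons x w ih =>
    rcases hl.eq_or_lt with hl | hl
    · exact L.eq_of_length_eq hb l.2.1 hw h h' hl
    · have h1 := ih (S.parent_mem _ _ hw) (L.le_parent hw h') (by simpa using Nat.lt_succ_iff.1 hl)
      refine absurd ?_ l.2.2
      rw [h1]
      exact mem_of_cons hw

/-- At every inner node above it, a primitive `b` lies below one of the two children. This descent
stops by the bound on the depth, and at the leaf reached both idempotents are primitive, hence
equal. -/
theorem exists_leaf (hb : IsPrimitive b) : ∃ l : S.Leaf, (L.ε l.1).e = b.e := by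
  have h : ∀ n : ℕ, (∃ l : S.Leaf, (L.ε l.1).e = b.e) ∨
      ∃ w ∈ S.nodes, w.length = n ∧ b.e * (L.ε w).e = b.e := fun n => by
    induction n with
    | zero => exact Or.inr ⟨[], S.root_mem, rfl, by rw [L.root, mul_one]⟩
    | succ n ih =>
      rcases ih with ih | ⟨w, hw, hn, hle⟩
      · exact Or.inl ih
      · by_cases hw' : false :: w ∈ S.nodes
        · right
          rcases hb.le_or_le (L.isSum w hw hw') hle with h1 | h1
          · exact ⟨_, hw', by simp [hn], h1⟩
          · exact ⟨_, (S.full w).1 hw', by simp [hn], h1⟩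
        · exact Or.inl ⟨⟨w, hw, hw'⟩, ((L.isPrimitive ⟨w, hw, hw'⟩).eq_of_le hb.1 hle).symm⟩
  -- One step beyond the maximal depth there are no nodes, so the first alternative holds.
  rcases h (Module.finrank k (L.ε []).idem.Corner + 1) with h | ⟨w, hw, hn, -⟩
  · exact h
  · have := L.length_add_finrank_le hw
    omega

/-- The block at a leaf. -/
def block (l : S.Leaf) : Block k A where
  e := (L.ε l.1).e
  central := (L.ε l.1).central
  idem := (L.ε l.1).idem
  indecomposable := (L.isPrimitive l).isIndecomposableAlg

theorem block_bijective : Function.Bijective L.block := by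
  have hext : ∀ b b' : Block k A, b.e = b'.e → b = b' := by
    rintro ⟨e, _, _, _⟩ ⟨e', _, _, _⟩ h
    obtain rfl : e = e' := h
    rfl
  constructor
  · have key : ∀ l l' : S.Leaf, L.block l = L.block l' → l.1.length ≤ l'.1.length → l = l' :=
      fun l l' h hl => Subtype.ext (L.eq_of_leaf (L.isPrimitive l).1 l l'.2.1 (L.ε l.1).idem.eq (by
        have h1 : (L.ε l.1).e = (L.ε l'.1).e := congrArg Block.e h
        rw [← h1]
        exact (L.ε l.1).idem.eq) hl)
    intro l l' h
    rcases le_total l.1.length l'.1.length with hl | hl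
    · exact key l l' h hl
    · exact (key l' l h.symm hl).symm
  · intro b
    obtain ⟨l, hl⟩ := L.exists_leaf (b := ⟨b.e, b.central, b.idem⟩)
      (isPrimitive_of_isIndecomposableAlg b.indecomposable)
    exact ⟨l, hext _ _ hl⟩

end Labelling

/-- The algebras of a stratification of an algebra by its direct factors. -/
def factorAlg (ε : List Bool → CentralIdem k A) : List Bool → FDAlg k
  | [] => FDAlg.of k A
  | b :: w => (ε (b :: w)).alg

theorem triEquivalent_factorAlg {ε : List Bool → CentralIdem k A} (h : ε [] = one k A) :
    ∀ w, TriEquivalent k (DMod (factorAlg ε w)) (DMod (ε w).alg)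
  | [] => by
    rw [h]
    exact triEquivalent_one
  | _ :: _ => TriEquivalent.refl

/-- A symmetric algebra with the property `SharpHom` has a stratification. -/
theorem nonempty_of_symmetrizingForm {t : Aᵐᵒᵖ →ₗ[k] k} (ht : IsSymmetrizingForm t)
    (hA : SharpHom Aᵐᵒᵖ) [Nontrivial A] : Nonempty (Stratification (FDAlg.of k A)) := by
  have h : ∀ e : CentralIdem k A, ∃ e' : Bool → CentralIdem k A,
      (∃ e₁ e₂, IsSum e e₁ e₂) → IsSum e (e' false) (e' true) := fun e => by
    by_cases he : ∃ e₁ e₂, IsSum e e₁ e₂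
    · obtain ⟨e₁, e₂, he⟩ := he
      exact ⟨fun b => bif b then e₂ else e₁, fun _ => he⟩
    · exact ⟨fun _ => e, fun h => absurd h he⟩
  choose c hc using h
  let ε : List Bool → CentralIdem k A := List.rec (one k A) fun b _ e => c e b
  -- An address is a node if its parent is a node whose label is not primitive; the branches end
  -- exactly at primitive labels. The tree is not required to be finite here.
  let N : List Bool → Prop := List.rec True fun _ w h => h ∧ ∃ e₁ e₂, IsSum (ε w) e₁ e₂
  have halg : ∀ w, TriEquivalent k (DMod (factorAlg ε w)) (DMod (ε w).alg) :=
    triEquivalent_factorAlg rfl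
  have hne : ∀ w, N w → (ε w).e ≠ 0
    | [], _ => one_ne_zero
    | false :: w, hw => (hc (ε w) hw.2).ne_zero_left
    | true :: w, hw => (hc (ε w) hw.2).ne_zero_right
  exact ⟨{
    nodes := {w | N w}
    alg := factorAlg ε
    root_mem := trivial
    parent_mem := fun b w hw => hw.1
    full := fun w => Iff.rfl
    alg_root := rfl
    simple_of_leaf := fun w hw hw' => isDerivedSimple_of_isPrimitive ht hA
      ⟨hne w hw, fun e₁ e₂ hs => hw' ⟨hw, e₁, e₂, hs⟩⟩ (halg w)
    recollement_of_not_leaf := fun w hw hw' => (hc (ε w) hw'.2).exists_recollement (halg w) }⟩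

end Stratification

end
/-- Let `A` be a finite-dimensional symmetric algebra satisfying (#). If `A ≠ 0` then `𝒟(Mod-A)` has
a stratification; every stratification of `𝒟(Mod-A)` is finite; the simple factors of every
stratification are, up to reordering and `k`-linear triangle equivalence, the derived categories
of the blocks of `A`; in particular any two stratifications have the same simple factors. -/
theorem corollaryc {k : Type u} [Field k] {A : Type u} [Ring A] [Algebra k A]
    [FiniteDimensional k A] (hsymm : IsSymmetricAlg k A) (hsharp : SatisfiesSharp A) :
    (Nontrivial A → Nonempty (Stratification (FDAlg.of k A))) ∧
    (∀ S : Stratification (FDAlg.of k A), S.IsFinite) ∧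
    (∀ S : Stratification (FDAlg.of k A), ∃ σ : S.Leaf ≃ Block k A,
      ∀ l : S.Leaf, TriEquivalent k (DMod (S.factor l)) (DMod (σ l).alg)) ∧
    (∀ S S' : Stratification (FDAlg.of k A), ∃ σ : S.Leaf ≃ S'.Leaf,
      ∀ l : S.Leaf, TriEquivalent k (DMod (S.factor l)) (DMod (S'.factor (σ l)))) := by
  obtain ⟨t, ht⟩ := hsymm.exists_form
  have hA := hsharp.sharpHom
  have hσ : ∀ S : Stratification (FDAlg.of k A), ∃ σ : S.Leaf ≃ Block k A,
      ∀ l : S.Leaf, TriEquivalent k (DMod (S.factor l)) (DMod (σ l).alg) := fun S => by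
    obtain ⟨L⟩ := S.nonempty_labelling ht hA
    exact ⟨Equiv.ofBijective _ L.block_bijective, fun l => L.triEquivalent l.1 l.2.1⟩
  refine ⟨fun _ => Stratification.nonempty_of_symmetrizingForm ht hA, fun S => ?_, hσ,
    fun S S' => ?_⟩
  · obtain ⟨L⟩ := S.nonempty_labelling ht hA
    exact L.isFinite
  · obtain ⟨σ, hσ₁⟩ := hσ S
    obtain ⟨σ', hσ₂⟩ := hσ S'
    refine ⟨σ.trans σ'.symm, fun l => (hσ₁ l).trans ?_⟩
    have := hσ₂ (σ'.symm (σ l))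
    rw [Equiv.apply_symm_apply] at this
    exact this.symm
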